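/- **Setting.** Let $s(x)$ be one of the following functions, with $r>0$, $a>0$: (I) $s(x)=x$; (II) $s(x)=\frac1r\sin(rx)$; (III) $s(x)=\frac a\pi\sinh(\pi x/a)$; (IV) $s(x)=\frac1r e^{ra/4}\vartheta_1(rx\,|\,ira/\pi)$, where $\vartheta_1(z|\tau)=2e^{i\pi\tau/4}\sin z\prod_{n\ge1}(1-q^{2n})(1-2q^{2n}\cos 2z+q^{4n})$, $q=e^{i\pi\tau}$, is the odd Jacobi theta function. Put $\rho=0,1,1,3$ and $(\omega_\nu)_{\nu=0}^{\rho}=(0)$, $(0,\pi/r)$, $(0,ia)$, $(0,\pi/r,ia,-\pi/r-ia)$ in the cases (I), (II), (III), (IV) respectively; $\Omega=\sum_\nu\mathbb Z\omega_\nu$ (the zero set of $s$); $|\omega|=\sum_{\nu=0}^\rho\omega_\nu$; $\xi_\nu=0$ except $\xi_2=-1$, $\xi_3=1$ in case (IV); $P=\frac14\prod_{\nu=1}^{\rho}s(\tfrac12\omega_\nu)^2$. Let $N,\tilde N\in\mathbb Z_{\ge0}$, $\beta>0$, $\lambda\in\mathbb R\setminus\{0\}$, $g=(g_0,\dots,g_{2\rho+1})\in\mathbb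 R^{2\rho+2}$, $|g|=\sum_\nu g_\nu$, $\tilde g_\nu=\frac12(\lambda+1)-g_\nu$. Assume that $ni\beta\notin\Omega$ and $ni\lambda\beta\notin\Omega$ for all integers $n\neq0$, and that $i(\lambda-1)\beta\notin\Omega$. For $x\in\mathbb C^N$, $\tilde x\in\mathbb C^{\tilde N}$ let $$V_j^{\pm}=\frac{\prod_{\nu=0}^{2\rho+1}s(\pm x_j-ig_\nu\beta)}{s(\pm2x_j)s(\pm2x_j-i\beta)}\prod_{\delta=\pm}\prod_{j'\ne j}\frac{s(x_j+\delta x_{j'}\mp i\lambda\beta)}{s(x_j+\delta x_{j'})}\prod_{k=1}^{\tilde N}\frac{s(x_j+\delta\tilde x_k\mp\frac i2(\lambda-1)\beta)}{s(x_j+\delta\tilde x_k\mp\frac i2(\lambda+1)\beta)},$$ $$\tilde V_k^{\pm}=\frac{\prod_{\nu=0}^{2\rho+1}s(\pm\tilde x_k+i\tilde g_\nu\beta)}{s(\pm2\tilde x_k)s(\pm2\tilde x_k+i\lambda\beta)}\prod_{\delta=\pm}\prod_{k'\ne k}\frac{s(\tilde x_k+\delta\tilde x_{k'}\pm i\beta)}{s(\tilde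 x_k+\delta\tilde x_{k'})}\prod_{j=1}^{N}\frac{s(\tilde x_k+\delta x_j\mp\frac i2(\lambda-1)\beta)}{s(\tilde x_k+\delta x_j\pm\frac i2(\lambda+1)\beta)},$$ $$V^0=-P\sum_{\nu=0}^{\rho}\frac{e^{-r\xi_\nu(2\lambda N-2\tilde N+|g|-\frac12(\rho+1)(\lambda+1))\beta}}{\prod_{\mu\neq\nu}s(\frac12(\omega_\nu-\omega_\mu))}\,\frac{\prod_{\mu=0}^{2\rho+1}s(\frac12\omega_\nu+\frac i2\beta-ig_\mu\beta)}{\prod_{\mu=0}^{\rho}s(\frac12(\omega_\nu-\omega_\mu+i(1-\lambda)\beta))}\prod_{\delta=\pm}\prod_{j=1}^N\frac{s(\delta x_j+\frac12\omega_\nu+\frac i2\beta-i\lambda\beta)}{s(\delta x_j+\frac12\omega_\nu+\frac i2\beta)}\prod_{k=1}^{\tilde N}\frac{s(\delta\tilde x_k+\frac12\omega_\nu-\frac i2\lambda\beta+i\beta)}{s(\delta\tilde x_k+\frac12\omega_\nu-\frac i2\lambda\beta)}$$ (the exponential is $1$ in cases (I)–(III)), and let $$A_{N,\tilde N}=\sum_{\varepsilon=\pm}\Bigl(s(i\lambda\beta)\sum_{j=1}^N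 V_j^\varepsilon\,e^{-\varepsilon i\beta\,\partial/\partial x_j}-s(i\beta)\sum_{k=1}^{\tilde N}\tilde V_k^\varepsilon\,e^{+\varepsilon i\lambda\beta\,\partial/\partial\tilde x_k}\Bigr)+V^0,$$ where $e^{b\,\partial/\partial x}f(x)=f(x+b)$. Finally put $$c^0=P\sum_{\nu=0}^{\rho}\frac{e^{-r\xi_\nu(|g|-\frac12(\rho+1)(\lambda+1))\beta}}{\prod_{\mu\ne\nu}s(\frac12(\omega_\nu-\omega_\mu))}\,\frac{\prod_{\mu=0}^{2\rho+1}s(\frac12\omega_\nu+\frac i2\lambda\beta-ig_\mu\beta)}{\prod_{\mu=0}^{\rho}s(\frac12(\omega_\nu-\omega_\mu+i(\lambda-1)\beta))},$$ $$\mathcal E_{N,\tilde N}=c^0+P\,s\bigl(i\beta[2\lambda N-2\tilde N+|g|-\tfrac12(\rho+1)(\lambda+1)]-|\omega|\bigr).$$ **Statement.** (a) In cases (I)–(III) for all parameters as above, and in case (IV) for all such parameters satisfying the balancing condition $2\lambda(N-1)-2(\tilde N+1)+\sum_{\nu=0}^7g_\nu=0$, the constant function $1$ is an eigenfunction of $A_{N,\tilde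 N}$ with eigenvalue $\mathcal E_{N,\tilde N}$: $(A_{N,\tilde N}1)(x,\tilde x)=\mathcal E_{N,\tilde N}$ at every point at which no denominator of the coefficients vanishes. (b) In all four cases (without the balancing condition) let $G(x;\alpha)$ ($x,\alpha\in\mathbb C$, $\operatorname{Re}\alpha\ne0$) be any function, meromorphic in $x$, such that $G(x+\frac{i\alpha}2;\alpha)/G(x-\frac{i\alpha}2;\alpha)=c\,s(x)$ with a constant $c=c(\alpha)\neq0$. Put $$\Psi_n(x;g,\lambda,\beta)=\prod_{j=1}^n\Bigl(\frac{G(2x_j+\frac i2\beta;\beta)G(-2x_j+\frac i2\beta;\beta)}{\prod_{\nu=0}^{2\rho+1}G(x_j+\frac i2\beta-ig_\nu\beta;\beta)G(-x_j+\frac i2\beta-ig_\nu\beta;\beta)}\Bigr)^{1/2}\prod_{1\le j<k\le n}\prod_{\varepsilon,\varepsilon'=\pm}\Bigl(\frac{G(\varepsilon x_j+\varepsilon'x_k+\frac i2\beta;\beta)}{G(\varepsilon x_j+\varepsilon'x_k-i\lambda\beta+\frac i2\beta;\beta)}\Bigr)^{1/2},$$ $$\Psi_{N,\tilde N}(x,\tilde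 x)=\frac{\Psi_N(x;g,\lambda,\beta)\,\Psi_{\tilde N}(\tilde x;g',1/\lambda,\lambda\beta)}{\prod_{j=1}^{N}\prod_{\delta=\pm}\prod_{k=1}^{\tilde N}\bigl(s(x_j+\delta\tilde x_k+\frac i2(\lambda-1)\beta)\,s(x_j+\delta\tilde x_k-\frac i2(\lambda-1)\beta)\bigr)^{1/2}},\qquad g'_\nu=\frac{\lambda+1-2g_\nu}{2\lambda}$$ (principal square roots), and $W(x,\tilde x)=\Psi_{N,\tilde N}(x,\tilde x)\Psi_{N,\tilde N}(-x,-\tilde x)$. Then $A_{N,\tilde N}$ is formally anti-symmetric with respect to the weighted $L^2$ inner product $\langle f,h\rangle=\int\overline{f}\,h\,W$ over real variables. That is, write $z=(x,\tilde x)$ and $A_{N,\tilde N}=\sum_t c_t(z)\,e^{ia_t\cdot\partial_z}$ with real vectors $a_t$. First, the formal adjoint of $A_{N,\tilde N}$, i.e. the operator $\sum_t c_t^\dagger(z)\,e^{ia_t\cdot\partial_z}$ with $c_t^\dagger(z)=\overline{W(\bar z-ia_t)\,c_t(\bar z-ia_t)/W(\bar z)}$, equals $-A_{N,\tilde N}$: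 applied to any function, the two operators agree at almost every $z\in\mathbb C^{N+\tilde N}$. Second, for every measurable $D\subseteq\mathbb R^{N+\tilde N}$ and all $f,h$ such that for each $t$ the integrand $\overline{f(\bar z)}\,c_t(z)\,h(z+ia_t)\,W(z)$ is absolutely integrable over $z\in D$ and over $z\in D-ia_t$ with equal integrals, one has $\langle f,A_{N,\tilde N}h\rangle_D=-\langle A_{N,\tilde N}f,h\rangle_D$. -/

import Mathlib

open Complex MeasureTheory Filter
open scoped ComplexConjugate

noncomputable section

namespace DeformedVanDiejen

/-! ### Analytic difference operators and formal anti-symmetry -/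

/-- The difference operator `∑ t, c_t(z) exp (i a_t · ∂/∂z)` in complex variables indexed by `ι`,
whose shifts `i a_t` are purely imaginary vectors (`a_t` real). -/
structure DifferenceOperator (T ι : Type*) where
  shift : T → ι → ℝ
  coeff : T → (ι → ℂ) → ℂ

/-- The imaginary vector `i a`. -/
def imag {ι : Type*} (a : ι → ℝ) : ι → ℂ := fun i => I * (a i : ℂ)

/-- The real point `x`, seen in `ℂ^ι`. -/
def ofRealVec {ι : Type*} (x : ι → ℝ) : ι → ℂ := fun i => (x i : ℂ)

/-- Coordinatewise complex conjugation. -/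
def conjVec {ι : Type*} (z : ι → ℂ) : ι → ℂ := fun i => conj (z i)

namespace DifferenceOperator

variable {T ι : Type*}

/-- Action on functions: `(A f)(z) = ∑ t, c_t(z) f(z + i a_t)`. -/
def apply [Fintype T] (A : DifferenceOperator T ι) (f : (ι → ℂ) → ℂ) (z : ι → ℂ) : ℂ :=
  ∑ t, A.coeff t z * f (z + imag (A.shift t))

/-- The formal adjoint of `A` for the pairing `∫ conj (f x) g(x) W(x) dx` over real `x`, obtained
by moving the contour `x ↦ x - i a_t` in each term and ignoring what is picked up on the way:
the coefficient of `exp (i a_t · ∂)` is the function whose value at real `x` is the conjugate of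
`W(x - i a_t) c_t(x - i a_t) / W(x)`, continued to complex arguments. -/
def formalAdjoint (W : (ι → ℂ) → ℂ) (A : DifferenceOperator T ι) : DifferenceOperator T ι where
  shift := A.shift
  coeff t z := conj (W (conjVec z - imag (A.shift t)) * A.coeff t (conjVec z - imag (A.shift t))
    / W (conjVec z))

/-- The weighted `L²` inner product `∫_D conj (f x) g(x) W(x) dx`, over `D ⊆ ℝ^ι`. -/
def weightedInner [Fintype ι] (W : (ι → ℂ) → ℂ) (D : Set (ι → ℝ)) (f g : (ι → ℂ) → ℂ) : ℂ :=
  ∫ x in D, conj (f (ofRealVec x)) * g (ofRealVec x) * W (ofRealVec x)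

/-- The integrand of the `t`-th term of `⟨f, A g⟩`, continued to complex arguments. -/
def termIntegrand (W : (ι → ℂ) → ℂ) (A : DifferenceOperator T ι) (f g : (ι → ℂ) → ℂ) (t : T)
    (z : ι → ℂ) : ℂ :=
  conj (f (conjVec z)) * (A.coeff t z * g (z + imag (A.shift t))) * W z

/-- The contour of integration of the `t`-th term of `⟨f, A g⟩` may be moved from `D` to
`D - i a_t`: both integrals converge absolutely, and they agree. -/
def ContourShift [Fintype ι] (W : (ι → ℂ) → ℂ) (A : DifferenceOperator T ι) (D : Set (ι → ℝ))
    (f g : (ι → ℂ) → ℂ) (t : T) : Prop :=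
  IntegrableOn (fun x : ι → ℝ => termIntegrand W A f g t (ofRealVec x)) D ∧
  IntegrableOn
    (fun x : ι → ℝ => termIntegrand W A f g t (ofRealVec x - imag (A.shift t))) D ∧
  ∫ x in D, termIntegrand W A f g t (ofRealVec x) =
    ∫ x in D, termIntegrand W A f g t (ofRealVec x - imag (A.shift t))

/-- `A` is formally anti-symmetric for the weight `W`: its formal adjoint is `-A` (as an operator
on functions of generic complex arguments), and `⟨f, A g⟩ = -⟨A f, g⟩` whenever the contour shifts
are permitted, on any domain of integration in `ℝ^ι`. -/
def IsFormallyAntisymmetric [Fintype T] [Fintype ι] (W : (ι → ℂ) → ℂ)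
    (A : DifferenceOperator T ι) : Prop :=
  (∀ f : (ι → ℂ) → ℂ, ∀ᵐ z : ι → ℂ, (formalAdjoint W A).apply f z = -(A.apply f z)) ∧
  (∀ (D : Set (ι → ℝ)) (f g : (ι → ℂ) → ℂ), MeasurableSet D →
    (∀ t, ContourShift W A D f g t) →
      weightedInner W D f (A.apply g) = -(weightedInner W D (A.apply f) g))

end DifferenceOperator

/-! ### The four cases, the function `s` and its zeros -/

/-- The odd Jacobi theta function `ϑ₁(z | τ)`, `Im τ > 0`, through its product representation with
nome `q = exp (π i τ)`. -/
def jacobiThetaOne (z τ : ℂ) : ℂ :=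
  2 * exp (Real.pi * I * τ / 4) * sin z *
    ∏' n : ℕ, (1 - exp (2 * Real.pi * I * (n + 1) * τ)) *
      (1 - 2 * exp (2 * Real.pi * I * (n + 1) * τ) * cos (2 * z)
        + exp (4 * Real.pi * I * (n + 1) * τ))

/-- The cases (I)--(IV) with their parameters `r`, `a`. -/
inductive Model where
  | rational : Model
  | trigonometric (r : ℝ) : Model
  | hyperbolic (a : ℝ) : Model
  | elliptic (r a : ℝ) : Model

namespace Model

/-- The parameters `r`, `a` of the model are positive. -/
def Positive : Model → Prop
  | rational => True
  | trigonometric r => 0 < r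
  | hyperbolic a => 0 < a
  | elliptic r a => 0 < r ∧ 0 < a

def IsElliptic : Model → Prop
  | elliptic _ _ => True
  | _ => False

/-- The function `s(x)`. -/
def s : Model → ℂ → ℂ
  | rational, x => x
  | trigonometric r, x => 1 / r * sin (r * x)
  | hyperbolic a, x => a / Real.pi * sinh (Real.pi * x / a)
  | elliptic r a, x => 1 / r * exp (r * a / 4) * jacobiThetaOne (r * x) (I * r * a / Real.pi)

def rho : Model → ℕ
  | rational => 0
  | trigonometric _ => 1
  | hyperbolic _ => 1
  | elliptic _ _ => 3

/-- The periods `ω_ν`, `ν = 0, …, ρ`. -/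
def omega : (c : Model) → Fin (c.rho + 1) → ℂ
  | rational => (![0] : Fin 1 → ℂ)
  | trigonometric r => (![0, Real.pi / r] : Fin 2 → ℂ)
  | hyperbolic a => (![0, I * a] : Fin 2 → ℂ)
  | elliptic r a => (![0, Real.pi / r, I * a, -(Real.pi / r) - I * a] : Fin 4 → ℂ)

/-- The products `r ξ_ν`; they vanish except for `ν = 2, 3` in the elliptic case. -/
def rXi : (c : Model) → Fin (c.rho + 1) → ℝ
  | rational => (![0] : Fin 1 → ℝ)
  | trigonometric _ => (![0, 0] : Fin 2 → ℝ)
  | hyperbolic _ => (![0, 0] : Fin 2 → ℝ)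
  | elliptic r _ => (![0, 0, -r, r] : Fin 4 → ℝ)

/-- The period lattice `Ω`. -/
def Omega (c : Model) : AddSubgroup ℂ := AddSubgroup.closure (Set.range c.omega)

/-- The constant `∏_{ν = 1}^ρ s(ω_ν / 2)² / 4`. -/
def prefactor (c : Model) : ℂ := (∏ ν : Fin c.rho, c.s (c.omega ν.succ / 2) ^ 2) / 4

end Model

/-- `G(x; α)` is a Gamma function for `s`: for every `α` with `Re α ≠ 0` it is meromorphic in `x`
and `G(x + iα/2; α) / G(x - iα/2; α) = c s(x)`, as meromorphic functions of `x`, for some constant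
`c ≠ 0` (depending on `α`). -/
def IsGammaFunction (s : ℂ → ℂ) (G : ℂ → ℂ → ℂ) : Prop :=
  ∀ α : ℂ, α.re ≠ 0 → Meromorphic (fun x => G x α) ∧
    ∃ c : ℂ, c ≠ 0 ∧
      ∀ᶠ x in codiscrete ℂ, G (x + I * α / 2) α / G (x - I * α / 2) α = c * s x

/-! ### The deformed operator

Signs `ε, δ` run over `ℤˣ = {1, -1}`; `sg ε` is the sign as a complex number. -/

def sg (ε : ℤˣ) : ℂ := ((ε : ℤ) : ℂ)

section Operator

variable (c : Model) {N M : ℕ} (g : Fin (2 * c.rho + 2) → ℝ) (lam β : ℝ)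

/-- The coefficient `V_j^ε(x, y)`. -/
def V (ε : ℤˣ) (j : Fin N) (x : Fin N → ℂ) (y : Fin M → ℂ) : ℂ :=
  (∏ ν, c.s (sg ε * x j - I * g ν * β)) /
      (c.s (sg ε * (2 * x j)) * c.s (sg ε * (2 * x j) - I * β)) *
    ∏ δ : ℤˣ,
      ((∏ j' ∈ Finset.univ.erase j,
          c.s (x j + sg δ * x j' - sg ε * (I * lam * β)) / c.s (x j + sg δ * x j')) *
        ∏ k : Fin M,
          c.s (x j + sg δ * y k - sg ε * (I * (lam - 1) * β / 2)) /
            c.s (x j + sg δ * y k - sg ε * (I * (lam + 1) * β / 2)))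

/-- The coefficient `Ṽ_k^ε(x, y)`, with `g̃_ν = (λ + 1) / 2 - g_ν`. -/
def Vt (ε : ℤˣ) (k : Fin M) (x : Fin N → ℂ) (y : Fin M → ℂ) : ℂ :=
  (∏ ν, c.s (sg ε * y k + I * ((lam + 1) / 2 - g ν) * β)) /
      (c.s (sg ε * (2 * y k)) * c.s (sg ε * (2 * y k) + I * lam * β)) *
    ∏ δ : ℤˣ,
      ((∏ k' ∈ Finset.univ.erase k,
          c.s (y k + sg δ * y k' + sg ε * (I * β)) / c.s (y k + sg δ * y k')) *
        ∏ j : Fin N,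
          c.s (y k + sg δ * x j - sg ε * (I * (lam - 1) * β / 2)) /
            c.s (y k + sg δ * x j + sg ε * (I * (lam + 1) * β / 2)))

/-- The potential `V⁰(x, y)`. -/
def V0 (x : Fin N → ℂ) (y : Fin M → ℂ) : ℂ :=
  -(c.prefactor *
    ∑ ν, exp (-(c.rXi ν *
          (2 * lam * N - 2 * M + ∑ μ, g μ - 1 / 2 * (c.rho + 1) * (lam + 1)) * β)) /
        (∏ μ ∈ Finset.univ.erase ν, c.s ((c.omega ν - c.omega μ) / 2)) *
      ((∏ μ, c.s (c.omega ν / 2 + I * β / 2 - I * g μ * β)) /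
        ∏ μ, c.s ((c.omega ν - c.omega μ + I * (1 - lam) * β) / 2)) *
      ∏ δ : ℤˣ,
        ((∏ j : Fin N,
            c.s (sg δ * x j + c.omega ν / 2 + I * β / 2 - I * lam * β) /
              c.s (sg δ * x j + c.omega ν / 2 + I * β / 2)) *
          ∏ k : Fin M,
            c.s (sg δ * y k + c.omega ν / 2 - I * lam * β / 2 + I * β) /
              c.s (sg δ * y k + c.omega ν / 2 - I * lam * β / 2)))

/-- The constant `c⁰`. -/
def c0 : ℂ :=
  c.prefactor *
    ∑ ν, exp (-(c.rXi ν * (∑ μ, g μ - 1 / 2 * (c.rho + 1) * (lam + 1)) * β)) /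
        (∏ μ ∈ Finset.univ.erase ν, c.s ((c.omega ν - c.omega μ) / 2)) *
      ((∏ μ, c.s (c.omega ν / 2 + I * lam * β / 2 - I * g μ * β)) /
        ∏ μ, c.s ((c.omega ν - c.omega μ + I * (lam - 1) * β) / 2))

/-- The eigenvalue `𝓔_{N, M}`. -/
def eigenvalue (N M : ℕ) : ℂ :=
  c0 c g lam β + c.prefactor *
    c.s (I * β * (2 * lam * N - 2 * M + ∑ ν, g ν - 1 / 2 * (c.rho + 1) * (lam + 1))
      - ∑ ν, c.omega ν)

/-- The operator `A_{N, M}` in the variables `z = (x, y)`. The term `(ε, j)` shifts `x_j` by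
`-ε i β`, the term `(ε, k)` shifts `y_k` by `ε i λ β`, and the last term is `V⁰`. -/
def opA (N M : ℕ) :
    DifferenceOperator ((ℤˣ × Fin N) ⊕ (ℤˣ × Fin M) ⊕ Unit) (Fin N ⊕ Fin M) where
  shift
    | .inl (ε, j) => Pi.single (.inl j) (-(((ε : ℤ) : ℝ) * β))
    | .inr (.inl (ε, k)) => Pi.single (.inr k) (((ε : ℤ) : ℝ) * lam * β)
    | .inr (.inr _) => 0
  coeff
    | .inl (ε, j) => fun z =>
        c.s (I * lam * β) * V c g lam β ε j (fun i => z (.inl i)) (fun i => z (.inr i))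
    | .inr (.inl (ε, k)) => fun z =>
        -(c.s (I * β) * Vt c g lam β ε k (fun i => z (.inl i)) (fun i => z (.inr i)))
    | .inr (.inr _) => fun z => V0 c g lam β (fun i => z (.inl i)) (fun i => z (.inr i))

/-- No denominator in the coefficients of `A_{N, M}` vanishes at `z = (x, y)`. -/
structure Regular (z : Fin N ⊕ Fin M → ℂ) : Prop where
  x_single : ∀ j : Fin N, 2 * z (.inl j) ∉ c.Omega ∧
    ∀ ε : ℤˣ, 2 * z (.inl j) + sg ε * (I * β) ∉ c.Omega
  y_single : ∀ k : Fin M, 2 * z (.inr k) ∉ c.Omega ∧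
    ∀ ε : ℤˣ, 2 * z (.inr k) + sg ε * (I * lam * β) ∉ c.Omega
  x_pair : ∀ j j' : Fin N, j ≠ j' → ∀ δ : ℤˣ, z (.inl j) + sg δ * z (.inl j') ∉ c.Omega
  y_pair : ∀ k k' : Fin M, k ≠ k' → ∀ δ : ℤˣ, z (.inr k) + sg δ * z (.inr k') ∉ c.Omega
  xy_pair : ∀ (j : Fin N) (k : Fin M) (ε δ : ℤˣ),
    z (.inl j) + sg δ * z (.inr k) + sg ε * (I * (lam + 1) * β / 2) ∉ c.Omega

/-- `iβ/m` is not a rational multiple of a period, for `m ∈ {1, -1, 1/λ, -1/λ}`. -/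
def NonResonant : Prop :=
  ∀ n : ℤ, n ≠ 0 → n * (I * β) ∉ c.Omega ∧ n * (I * lam * β) ∉ c.Omega

/-- The balancing condition `2λ(N - 1) - 2(M + 1) + ∑ g_ν = 0`. -/
def Balanced (N M : ℕ) : Prop :=
  2 * lam * ((N : ℝ) - 1) - 2 * ((M : ℝ) + 1) + ∑ ν, g ν = 0

end Operator

/-! ### The groundstate and the weight function -/

section Weight

variable (c : Model) (G : ℂ → ℂ → ℂ)

/-- `Ψ_n(x; g, λ, β)`. -/
def Psi {n : ℕ} (g : Fin (2 * c.rho + 2) → ℝ) (lam β : ℝ) (x : Fin n → ℂ) : ℂ :=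
  (∏ j, (G (2 * x j + I * β / 2) β * G (-(2 * x j) + I * β / 2) β /
      ∏ ν, (G (x j + I * β / 2 - I * g ν * β) β *
        G (-(x j) + I * β / 2 - I * g ν * β) β)) ^ (1 / 2 : ℂ)) *
    ∏ j, ∏ k ∈ Finset.Ioi j, ∏ ε : ℤˣ, ∏ ε' : ℤˣ,
      (G (sg ε * x j + sg ε' * x k + I * β / 2) β /
        G (sg ε * x j + sg ε' * x k - I * lam * β + I * β / 2) β) ^ (1 / 2 : ℂ)

/-- `Ψ_{N, M}(x, y; g, λ, β)`, where `g'_ν = (λ + 1 - 2 g_ν) / (2 λ)`. -/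
def PsiDeformed {N M : ℕ} (g : Fin (2 * c.rho + 2) → ℝ) (lam β : ℝ)
    (z : Fin N ⊕ Fin M → ℂ) : ℂ :=
  Psi c G g lam β (fun j => z (.inl j)) *
      Psi c G (fun ν => (lam + 1 - 2 * g ν) / (2 * lam)) (1 / lam) (lam * β)
        (fun k => z (.inr k)) /
    ∏ j : Fin N, ∏ δ : ℤˣ, ∏ k : Fin M,
      (c.s (z (.inl j) + sg δ * z (.inr k) + I * (lam - 1) * β / 2) *
        c.s (z (.inl j) + sg δ * z (.inr k) - I * (lam - 1) * β / 2)) ^ (1 / 2 : ℂ)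

/-- The weight `Ψ_{N, M}(x, y) Ψ_{N, M}(-x, -y)`. -/
def weight {N M : ℕ} (g : Fin (2 * c.rho + 2) → ℝ) (lam β : ℝ) (z : Fin N ⊕ Fin M → ℂ) : ℂ :=
  PsiDeformed c G g lam β z * PsiDeformed c G g lam β (-z)

end Weight

end DeformedVanDiejen

end

noncomputable section

namespace DeformedVanDiejen

/-! Part (a) is an identity between residues. Consider the function `∏ s(z - a_i) / s(z - b_i)` of
`z` with poles `b` at `± x_j`, `± y_k + i(λ+1)β/2`, `ω_ν/2 + iβ/2` and `ω_ν/2 + iλβ/2`, and zeros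
`a` at `± x_j + iλβ`, `± y_k + i(λ-1)β/2` and `i g_ν β`. The duplication formula `∏ s(u - ω_μ/2) = L
s(2u)`, with `L² = P`, collapses the products over half-periods. Up to the normalisation of `s'(0)`
and the factor `L²`, the residues at the first two families are then `-s(iλβ) V` and `s(iβ) Ṽ`,
those of the third family sum to `-V⁰`, and those of the fourth to `c⁰`. At the fourth family the
variables drop out: numerator and denominator are exchanged by the reflection in a half-period, so
only exponentials remain.

The sum of the residues is `s(∑ (b_i - a_i))`, which is the remaining part of the eigenvalue
(`residueSum_eq`). This is proved algebraically: the three-term relation of `s` is a partial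
fraction decomposition in two of the poles and reduces `n + 1` poles to `n`. Outside the elliptic
case an addition identity for `s(u)s(v)` closes the induction for every value of `∑ (b_i - a_i)`; in
the elliptic case the sum has to vanish, which is the balancing condition. The same condition makes
the exponentials in `V⁰` and `c⁰` agree with the residues. The identity needs all poles to be
distinct, which is more than regularity of the coefficients; the extra conditions are removed by
translating all variables by a common small `t` and using continuity.

For theta functions, the three-term relation and the duplication formula both follow from
Liouville's theorem: two entire functions with the same multipliers are proportional once the simple
zeros of one are zeros of the other.

Part (b) rests on a pointwise identity, `W(z - i a_t) c_t(z - i a_t) = -conj(c_t(conj z)) W(z)`, for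
almost every `z`. Since `Ψ` is even, `W = Ψ²` and the square roots disappear. As a function of
`x_j`, `W` is a constant times `h(x_j) h(-x_j)`, and by the difference equation of `G` the
coefficient `V` is, up to a constant, the ratio of two values of `h` one step apart. Hence moving
`V^ε` through `W` gives `V^{-ε}`, which is also its complex conjugate; the minus sign comes from the
purely imaginary argument of `s(iλβ)`. The `y`-terms follow from the exchange of `(x, g, λ, β)` with
`(y, g', 1/λ, λβ)`, and `V⁰` changes sign under conjugation. -/

/-! ### The infinite product `∏ (1 - Q^(n+1) w)` -/

/-- The entire function `∏_{n ≥ 1} (1 - Q^n w)` of `w`. -/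
def qProd (Q w : ℂ) : ℂ := ∏' n : ℕ, (1 - Q ^ (n + 1) * w)

section QProd

variable {Q : ℂ} (hQ : ‖Q‖ < 1)
include hQ

lemma summable_norm_qProd (w : ℂ) : Summable fun n : ℕ => ‖-(Q ^ (n + 1) * w)‖ := by
  simpa using ((summable_nat_add_iff 1).mpr
    (summable_geometric_of_lt_one (norm_nonneg Q) hQ)).mul_right ‖w‖

lemma multipliable_qProd (w : ℂ) : Multipliable fun n : ℕ => 1 - Q ^ (n + 1) * w := by
  simpa [sub_eq_add_neg] using multipliable_one_add_of_summable (summable_norm_qProd hQ w)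

/-- Without its first factor the product is the same product at `Q w`. This functional equation is
the source of the quasi-periodicity of theta in the imaginary direction. -/
lemma qProd_eq_mul (w : ℂ) : qProd Q w = (1 - Q * w) * qProd Q (Q * w) := by
  have h : (fun n : ℕ => 1 - Q ^ (n + 1 + 1) * w) = fun n : ℕ => 1 - Q ^ (n + 1) * (Q * w) := by
    funext n; ring
  unfold qProd
  rw [tprod_eq_zero_mul' (by rw [h]; exact multipliable_qProd hQ _), h]
  simp

lemma qProd_ne_zero {w : ℂ} (hw : ∀ n : ℕ, Q ^ (n + 1) * w ≠ 1) : qProd Q w ≠ 0 := by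
  have := tprod_one_add_ne_zero_of_summable (f := fun n : ℕ => -(Q ^ (n + 1) * w))
    (fun n h => hw n (by linear_combination -h)) (summable_norm_qProd hQ w)
  simpa [qProd, sub_eq_add_neg] using this

lemma differentiable_qProd : Differentiable ℂ (qProd Q) := by
  rw [← differentiableOn_univ]
  have h : HasProdLocallyUniformlyOn (fun (n : ℕ) (w : ℂ) => 1 + -(Q ^ (n + 1) * w))
      (fun w => ∏' n : ℕ, (1 + -(Q ^ (n + 1) * w))) Set.univ := by
    refine hasProdLocallyUniformlyOn_of_forall_compact isOpen_univ fun K _ hK => ?_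
    obtain ⟨B, hB⟩ := hK.isBounded.exists_norm_le
    refine Summable.hasProdUniformlyOn_nat_one_add hK
      (((summable_nat_add_iff 1).mpr
        (summable_geometric_of_lt_one (norm_nonneg Q) hQ)).mul_right B)
      (.of_forall fun n w hw => ?_) (fun n => by fun_prop)
    rw [norm_neg, norm_mul, norm_pow]
    exact mul_le_mul_of_nonneg_left (hB w hw) (by positivity)
  have h2 := h.differentiableOn (.of_forall fun s => by
    simpa [Finset.prod_fn] using DifferentiableOn.finsetProd (fun _ _ => by fun_prop)) isOpen_univ
  refine h2.congr fun w _ => ?_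
  simp [qProd, sub_eq_add_neg]

end QProd

lemma conj_qProd (Q w : ℂ) : conj (qProd Q w) = qProd (conj Q) (conj w) := by
  unfold qProd
  rw [Function.LeftInverse.map_tprod (g := starRingEnd ℂ) _ Complex.continuous_conj
    (g' := starRingEnd ℂ) Complex.continuous_conj (fun x => by simp)]
  simp

/-! ### The theta function of the elliptic case -/

section Theta

variable {r a : ℝ}

/-- The square of the nome of the elliptic case. -/
def nomeSq (r a : ℝ) : ℝ := Real.exp (-(2 * r * a))

lemma norm_nomeSq_lt_one (hr : 0 < r) (ha : 0 < a) : ‖(nomeSq r a : ℂ)‖ < 1 := by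
  rw [Complex.norm_real, nomeSq, Real.norm_eq_abs, abs_of_pos (Real.exp_pos _), Real.exp_lt_one_iff]
  have := mul_pos hr ha
  linarith

lemma ofReal_nomeSq (r a : ℝ) : (nomeSq r a : ℂ) = exp (-(2 * r * a)) := by
  simp [nomeSq]

/-- The leading constant of the product formula of `s` in the elliptic case. -/
def thetaConst (r a : ℝ) : ℂ := 2 / r * qProd (nomeSq r a) 1

lemma thetaConst_ne_zero (hr : 0 < r) (ha : 0 < a) : thetaConst r a ≠ 0 := by
  refine mul_ne_zero (div_ne_zero two_ne_zero (by exact_mod_cast hr.ne')) ?_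
  have hQ := norm_nomeSq_lt_one hr ha
  refine qProd_ne_zero hQ fun n h => ?_
  have h2 := congrArg norm h
  rw [mul_one, norm_pow, norm_one] at h2
  exact absurd h2 (pow_lt_one₀ (norm_nonneg _) hQ (by omega)).ne

/-- The factor `exp(ra/4)` cancels the power of the nome in front of theta, and the quadratic `1 -
2q cos 2z + q²` splits into linear factors in `exp(± 2irx)`. Periods, zeros, parity and conjugation
are all read off from this form. -/
lemma elliptic_s_eq (hr : 0 < r) (ha : 0 < a) (x : ℂ) :
    (Model.elliptic r a).s x = thetaConst r a * (sin (r * x) *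
      (qProd (nomeSq r a) (exp (2 * I * r * x)) * qProd (nomeSq r a) (exp (-(2 * I * r * x))))) := by
  have hQ := norm_nomeSq_lt_one hr ha
  have hpi : (Real.pi : ℂ) ≠ 0 := by exact_mod_cast Real.pi_ne_zero
  have e1 (n : ℕ) : exp (2 * Real.pi * I * (n + 1) * (I * r * a / Real.pi))
      = (nomeSq r a : ℂ) ^ (n + 1) := by
    rw [ofReal_nomeSq, ← Complex.exp_nat_mul]
    congr 1
    field_simp
    push_cast
    linear_combination (r * a * (n + 1) : ℂ) * I_sq
  have e2 (n : ℕ) : exp (4 * Real.pi * I * (n + 1) * (I * r * a / Real.pi))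
      = ((nomeSq r a : ℂ) ^ (n + 1)) ^ 2 := by
    rw [← e1, ← Complex.exp_nat_mul]
    congr 1
    push_cast
    ring
  have e3 : exp (r * a / 4) * exp (Real.pi * I * (I * r * a / Real.pi) / 4) = 1 := by
    rw [← Complex.exp_add, ← Complex.exp_zero]
    congr 1
    field_simp
    linear_combination (r * a : ℂ) * I_sq
  have e4 : (∏' n : ℕ, (1 - exp (2 * Real.pi * I * (n + 1) * (I * r * a / Real.pi))) *
      (1 - 2 * exp (2 * Real.pi * I * (n + 1) * (I * r * a / Real.pi)) * cos (2 * (r * x))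
        + exp (4 * Real.pi * I * (n + 1) * (I * r * a / Real.pi)))) =
      qProd (nomeSq r a) 1 * (qProd (nomeSq r a) (exp (2 * I * r * x)) *
        qProd (nomeSq r a) (exp (-(2 * I * r * x)))) := by
    unfold qProd
    rw [← (multipliable_qProd hQ _).tprod_mul (multipliable_qProd hQ _),
      ← (multipliable_qProd hQ _).tprod_mul
        ((multipliable_qProd hQ _).mul (multipliable_qProd hQ _))]
    refine tprod_congr fun n => ?_
    rw [e1, e2, Complex.cos]
    have h1 : exp (2 * (r * x) * I) = exp (2 * I * r * x) := by congr 1; ring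
    have h2 : exp (-(2 * (r * x)) * I) = exp (-(2 * I * r * x)) := by congr 1; ring
    have h3 : exp (2 * I * r * x) * exp (-(2 * I * r * x)) = 1 := by
      rw [← Complex.exp_add]; simp
    rw [h1, h2]
    generalize (nomeSq r a : ℂ) ^ (n + 1) = q
    linear_combination -(1 - q) * q ^ 2 * h3
  have e3' : exp (r * a / 4 : ℂ) * exp (Real.pi * I * (I * r * a / Real.pi) / 4) = 1 := e3
  simp only [Model.s, jacobiThetaOne, e4, thetaConst]
  linear_combination (1 / r * 2 * sin (r * x) * (qProd (nomeSq r a) 1 *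
    (qProd (nomeSq r a) (exp (2 * I * r * x)) * qProd (nomeSq r a) (exp (-(2 * I * r * x)))))) * e3'

lemma elliptic_s_add_real_period (hr : 0 < r) (ha : 0 < a) (x : ℂ) :
    (Model.elliptic r a).s (x + Real.pi / r) = -(Model.elliptic r a).s x := by
  have hr' : (r : ℂ) ≠ 0 := by exact_mod_cast hr.ne'
  rw [elliptic_s_eq hr ha, elliptic_s_eq hr ha]
  have h1 : (r : ℂ) * (x + Real.pi / r) = r * x + Real.pi := by field_simp
  have h2 : exp (2 * I * r * (x + Real.pi / r)) = exp (2 * I * r * x) := by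
    rw [show 2 * I * r * (x + Real.pi / r) = 2 * I * r * x + 2 * Real.pi * I by field_simp]
    exact exp_periodic _
  have h3 : exp (-(2 * I * r * (x + Real.pi / r))) = exp (-(2 * I * r * x)) := by
    rw [Complex.exp_neg, h2, Complex.exp_neg]
  rw [h1, h2, h3, Complex.sin_add_pi]
  ring

/-- The shift by `ia` multiplies `exp(2irx)` by the squared nome. One of the two products loses its
first factor and the other gains one; together with the change of the sine they leave a pure
exponential. -/
lemma elliptic_s_add_imag_period (hr : 0 < r) (ha : 0 < a) (x : ℂ) :
    (Model.elliptic r a).s (x + I * a) =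
      -(exp (r * a) * exp (-(2 * I * r * x))) * (Model.elliptic r a).s x := by
  rw [elliptic_s_eq hr ha, elliptic_s_eq hr ha]
  have hQ := norm_nomeSq_lt_one hr ha
  set u := exp (I * r * x) with hu
  have hu0 : u ≠ 0 := exp_ne_zero _
  set q := exp (-(r * a) : ℂ) with hq
  have hq0 : q ≠ 0 := exp_ne_zero _
  have hQq : (nomeSq r a : ℂ) = q ^ 2 := by
    rw [ofReal_nomeSq, hq, ← Complex.exp_nat_mul]; congr 1; push_cast; ring
  have h1 : exp (2 * I * r * x) = u ^ 2 := by
    rw [hu, ← Complex.exp_nat_mul]; congr 1; push_cast; ring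
  have h2 : exp (-(2 * I * r * x)) = (u ^ 2)⁻¹ := by rw [Complex.exp_neg, h1]
  have h3 : exp (2 * I * r * (x + I * a)) = q ^ 2 * u ^ 2 := by
    rw [← h1, hq, ← Complex.exp_nat_mul, ← Complex.exp_add]; congr 1; push_cast
    linear_combination (2 * r * a : ℂ) * I_sq
  have h4 : exp (-(2 * I * r * (x + I * a))) = (q ^ 2)⁻¹ * (u ^ 2)⁻¹ := by
    rw [Complex.exp_neg, h3, mul_inv]
  have h5 : exp (r * a : ℂ) = q⁻¹ := by rw [hq, ← Complex.exp_neg]; simp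
  have h6 : sin (r * x) = (u⁻¹ - u) * I / 2 := by
    rw [Complex.sin, hu, ← Complex.exp_neg]
    congr 4 <;> ring
  have h7 : sin (r * (x + I * a)) = (q⁻¹ * u⁻¹ - q * u) * I / 2 := by
    rw [Complex.sin, hu, hq, ← Complex.exp_neg, ← Complex.exp_neg, ← Complex.exp_add,
      ← Complex.exp_add]
    congr 4
    · linear_combination -(r * a : ℂ) * I_sq
    · linear_combination (r * a : ℂ) * I_sq
  have h8 : qProd (nomeSq r a) (u ^ 2) = (1 - q ^ 2 * u ^ 2) * qProd (nomeSq r a) (q ^ 2 * u ^ 2) := by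
    rw [qProd_eq_mul hQ, hQq]
  have h9 : qProd (nomeSq r a) ((q ^ 2)⁻¹ * (u ^ 2)⁻¹) =
      (1 - (u ^ 2)⁻¹) * qProd (nomeSq r a) ((u ^ 2)⁻¹) := by
    rw [qProd_eq_mul hQ, hQq, ← mul_assoc, mul_inv_cancel₀ (pow_ne_zero 2 hq0), one_mul]
  rw [h4, h3, h2, h1, h5, h6, h7, h8, h9]
  field_simp
  ring

lemma differentiable_elliptic_s (hr : 0 < r) (ha : 0 < a) :
    Differentiable ℂ (Model.elliptic r a).s := by
  have hE := differentiable_qProd (norm_nomeSq_lt_one hr ha)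
  rw [show (Model.elliptic r a).s = _ from funext fun x => elliptic_s_eq hr ha x]
  have e1 : Differentiable ℂ fun x : ℂ => qProd (nomeSq r a) (exp (2 * I * r * x)) :=
    hE.comp (by fun_prop)
  have e2 : Differentiable ℂ fun x : ℂ => qProd (nomeSq r a) (exp (-(2 * I * r * x))) :=
    hE.comp (by fun_prop)
  fun_prop

lemma elliptic_s_neg (hr : 0 < r) (ha : 0 < a) (x : ℂ) :
    (Model.elliptic r a).s (-x) = -(Model.elliptic r a).s x := by
  rw [elliptic_s_eq hr ha, elliptic_s_eq hr ha]
  simp only [mul_neg, neg_neg, Complex.sin_neg]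
  ring

lemma elliptic_s_conj (hr : 0 < r) (ha : 0 < a) (x : ℂ) :
    conj ((Model.elliptic r a).s x) = (Model.elliptic r a).s (conj x) := by
  rw [elliptic_s_eq hr ha, elliptic_s_eq hr ha]
  simp only [map_mul, conj_qProd, thetaConst, ← Complex.exp_conj, map_neg, Complex.conj_ofReal,
    map_div₀, Complex.conj_I, map_ofNat, ← Complex.sin_conj, map_one]
  ring_nf

lemma elliptic_s_eq_zero (hr : 0 < r) (ha : 0 < a) {x : ℂ} (hx : (Model.elliptic r a).s x = 0) :
    ∃ m n : ℤ, x = m * (Real.pi / r) + n * (I * a) := by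
  have hr' : (r : ℂ) ≠ 0 := by exact_mod_cast hr.ne'
  have hQ := norm_nomeSq_lt_one hr ha
  -- A vanishing product has a vanishing factor, so `Q^(n+1) exp(2iry) = 1` for some `n`; solving
  -- for `y` gives a lattice point. The second product is covered by replacing `y` by `-y`.
  have key (y : ℂ) (h : qProd (nomeSq r a) (exp (2 * I * r * y)) = 0) :
      ∃ m n : ℤ, y = m * (Real.pi / r) + n * (I * a) := by
    by_contra hcon
    refine qProd_ne_zero hQ (fun n hn => hcon ?_) h
    rw [ofReal_nomeSq, ← Complex.exp_nat_mul, ← Complex.exp_add, Complex.exp_eq_one_iff] at hn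
    obtain ⟨m, hm⟩ := hn
    refine ⟨m, -(n + 1), ?_⟩
    have h2 : (2 * I * r) * y = (2 * I * r) * (m * (Real.pi / r) + -(n + 1) * (I * a)) := by
      have h3 : (r : ℂ) * (Real.pi / r) = Real.pi := by field_simp
      push_cast at hm
      linear_combination hm + (2 * r * a * (n + 1)) * I_sq - (2 * I * m) * h3
    have h3 := mul_left_cancel₀ (mul_ne_zero (mul_ne_zero two_ne_zero I_ne_zero) hr') h2
    rw [h3]
    push_cast
    ring
  rw [elliptic_s_eq hr ha] at hx
  rcases mul_eq_zero.1 hx with h | h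
  · exact absurd h (thetaConst_ne_zero hr ha)
  rcases mul_eq_zero.1 h with h | h
  · obtain ⟨k, hk⟩ := Complex.sin_eq_zero_iff.1 h
    refine ⟨k, 0, ?_⟩
    field_simp
    push_cast
    linear_combination hk
  rcases mul_eq_zero.1 h with h | h
  · exact key x h
  · obtain ⟨m, n, h2⟩ := key (-x) (by rwa [show 2 * I * r * -x = -(2 * I * r * x) by ring])
    refine ⟨-m, -n, ?_⟩
    push_cast
    linear_combination -h2

/-- The derivative of `s` at the origin does not vanish. -/
lemma elliptic_s_hasDerivAt_zero (hr : 0 < r) (ha : 0 < a) :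
    ∃ d : ℂ, d ≠ 0 ∧ HasDerivAt (Model.elliptic r a).s d 0 := by
  have hr' : (r : ℂ) ≠ 0 := by exact_mod_cast hr.ne'
  have hQ := norm_nomeSq_lt_one hr ha
  have hE := differentiable_qProd hQ
  set F : ℂ → ℂ := fun x => qProd (nomeSq r a) (exp (2 * I * r * x)) *
    qProd (nomeSq r a) (exp (-(2 * I * r * x))) with hF
  have hFd : Differentiable ℂ F := by
    have e1 : Differentiable ℂ fun x : ℂ => qProd (nomeSq r a) (exp (2 * I * r * x)) :=
      hE.comp (by fun_prop)
    have e2 : Differentiable ℂ fun x : ℂ => qProd (nomeSq r a) (exp (-(2 * I * r * x))) :=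
      hE.comp (by fun_prop)
    exact e1.mul e2
  have h1 : qProd (nomeSq r a) 1 ≠ 0 := fun h =>
    thetaConst_ne_zero hr ha (by rw [thetaConst, h, mul_zero])
  have hs : HasDerivAt (fun x : ℂ => sin (r * x)) r 0 := by
    have := ((hasDerivAt_id (0 : ℂ)).const_mul (r : ℂ)).csin
    simpa using this
  refine ⟨thetaConst r a * (r * F 0), ?_, ?_⟩
  · refine mul_ne_zero (thetaConst_ne_zero hr ha) (mul_ne_zero hr' ?_)
    simpa [hF] using h1
  · rw [show (Model.elliptic r a).s = fun x => thetaConst r a * (sin (r * x) * F x) from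
      funext fun x => elliptic_s_eq hr ha x]
    have := (hs.mul (hFd 0).hasDerivAt).const_mul (thetaConst r a)
    simpa using this

end Theta

end DeformedVanDiejen

end


noncomputable section

namespace DeformedVanDiejen

/-! ### Entire functions with the same multipliers -/

/-- Two entire functions with the same multipliers for the periods `p` and `ia` are proportional if
the zeros of one are simple and are zeros of the other. -/
lemma exists_eq_const_mul_of_multipliers {f h : ℂ → ℂ} (hf : Differentiable ℂ f)
    (hh : Differentiable ℂ h) {p a : ℝ} (hp : 0 < p) (ha : 0 < a) {m₁ m₂ : ℂ → ℂ}
    (hm₁ : ∀ u, m₁ u ≠ 0) (hm₂ : ∀ u, m₂ u ≠ 0)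
    (hf₁ : ∀ u, f (u + p) = m₁ u * f u) (hh₁ : ∀ u, h (u + p) = m₁ u * h u)
    (hf₂ : ∀ u, f (u + I * a) = m₂ u * f u) (hh₂ : ∀ u, h (u + I * a) = m₂ u * h u)
    (hz : ∀ u, h u = 0 → f u = 0 ∧ deriv h u ≠ 0) :
    ∃ C : ℂ, ∀ u, f u = C * h u := by
  -- The quotient `f / h` with its removable singularities filled in: at a simple zero of `h` its
  -- limit is the quotient of derivatives. Near such a zero `k` is a quotient of two `dslope`s,
  -- hence differentiable.
  set k : ℂ → ℂ := fun u => if h u = 0 then deriv f u / deriv h u else f u / h u with hk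
  have hkz (u : ℂ) (hu : h u ≠ 0) : k u = f u / h u := by simp [hk, hu]
  have hds {φ : ℂ → ℂ} (hφ : Differentiable ℂ φ) (u : ℂ) : Differentiable ℂ (dslope φ u) := by
    rw [← differentiableOn_univ] at hφ ⊢
    exact (Complex.differentiableOn_dslope Filter.univ_mem).2 hφ
  have hkd : Differentiable ℂ k := by
    intro u
    by_cases hu : h u = 0
    · obtain ⟨hfu, hdu⟩ := hz u hu
      have e : k =ᶠ[nhds u] fun v => dslope f u v / dslope h u v := by
        have hne : ∀ᶠ v in nhds u, dslope h u v ≠ 0 :=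
          (hds hh u).continuous.continuousAt.eventually_ne (by rwa [dslope_same])
        filter_upwards [hne] with v hv
        rcases eq_or_ne v u with rfl | hvu
        · simp [hk, hu]
        · have hvu' : v - u ≠ 0 := sub_ne_zero.2 hvu
          rw [dslope_of_ne _ hvu, slope_def_field, hu, sub_zero] at hv
          have hhv : h v ≠ 0 := fun h0 => hv (by rw [h0, zero_div])
          rw [hkz v hhv, dslope_of_ne _ hvu, dslope_of_ne _ hvu, slope_def_field, slope_def_field,
            hu, hfu, sub_zero, sub_zero]
          field_simp
      exact DifferentiableAt.congr_of_eventuallyEq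
        ((hds hf u u).div (hds hh u u) (by rwa [dslope_same])) e
    · have e : k =ᶠ[nhds u] fun v => f v / h v := by
        filter_upwards [hh.continuous.continuousAt.eventually_ne hu] with v hv using hkz v hv
      exact DifferentiableAt.congr_of_eventuallyEq ((hf u).div (hh u) hu) e
  have hper {T : ℂ} {m : ℂ → ℂ} (hm : ∀ u, m u ≠ 0) (hfT : ∀ u, f (u + T) = m u * f u)
      (hhT : ∀ u, h (u + T) = m u * h u) : Function.Periodic k T := by
    have h1 (u : ℂ) (hu : h u ≠ 0) : k (u + T) = k u := by
      rw [hkz _ (by rw [hhT]; exact mul_ne_zero (hm u) hu), hkz u hu, hfT, hhT,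
        mul_div_mul_left _ _ (hm u)]
    intro u
    by_cases hu : h u = 0
    -- The zero of `h` at `u` is isolated because it is simple, so periodicity holds on a punctured
    -- neighbourhood and passes to `u` by continuity.
    · have h2 : ∀ᶠ v in nhdsWithin u {u}ᶜ, k (v + T) = k v := by
        filter_upwards [(hh u).hasDerivAt.eventually_ne (c := 0) (hz u hu).2] with v hv using h1 v hv
      have t1 : Tendsto (fun v => k (v + T)) (nhdsWithin u {u}ᶜ) (nhds (k (u + T))) :=
        ((hkd.continuous.comp (continuous_add_const T)).tendsto u).mono_left nhdsWithin_le_nhds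
      have t2 : Tendsto k (nhdsWithin u {u}ᶜ) (nhds (k u)) :=
        (hkd.continuous.tendsto u).mono_left nhdsWithin_le_nhds
      exact tendsto_nhds_unique (t1.congr' h2) t2
    · exact h1 u hu
  have hk₁ := hper hm₁ hf₁ hh₁
  have hk₂ := hper hm₂ hf₂ hh₂
  -- Both periods together bring any point into one compact rectangle; the entire function `k` is
  -- therefore bounded and Liouville applies.
  have hbdd : Bornology.IsBounded (Set.range k) := by
    have hK : IsCompact (Set.Icc 0 p ×ℂ Set.Icc 0 a) := isCompact_Icc.reProdIm isCompact_Icc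
    refine (hK.image hkd.continuous).isBounded.subset ?_
    rintro _ ⟨u, rfl⟩
    refine ⟨u - (⌊u.re / p⌋ : ℤ) * (p : ℂ) - (⌊u.im / a⌋ : ℤ) * (I * a), ?_, ?_⟩
    · rw [Complex.mem_reProdIm]
      have e1 : (u - (⌊u.re / p⌋ : ℤ) * (p : ℂ) - (⌊u.im / a⌋ : ℤ) * (I * a)).re
          = u.re - ⌊u.re / p⌋ * p := by simp
      have e2 : (u - (⌊u.re / p⌋ : ℤ) * (p : ℂ) - (⌊u.im / a⌋ : ℤ) * (I * a)).im
          = u.im - ⌊u.im / a⌋ * a := by simp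
      rw [e1, e2]
      exact ⟨⟨Int.sub_floor_div_mul_nonneg _ hp, (Int.sub_floor_div_mul_lt _ hp).le⟩,
        ⟨Int.sub_floor_div_mul_nonneg _ ha, (Int.sub_floor_div_mul_lt _ ha).le⟩⟩
    · rw [hk₂.sub_int_mul_eq, hk₁.sub_int_mul_eq]
  obtain ⟨C, hC⟩ := hkd.exists_const_forall_eq_of_bounded hbdd
  refine ⟨C, fun u => ?_⟩
  by_cases hu : h u = 0
  · rw [hu, (hz u hu).1, mul_zero]
  · rw [← hC u, hkz u hu, div_mul_cancel₀ _ hu]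

section Theta

variable {r a : ℝ} (hr : 0 < r) (ha : 0 < a)
include hr ha

/-- Iterating the two basic shifts keeps the shape `μ exp(ku)` of the multiplier. Only this shape
matters below: it transports vanishing and simplicity of zeros from the origin to every lattice
point. -/
lemma elliptic_s_quasiperiodic (m n : ℤ) : ∃ μ k : ℂ, μ ≠ 0 ∧ ∀ u,
    (Model.elliptic r a).s (u + (m * (Real.pi / r) + n * (I * a))) =
      μ * exp (k * u) * (Model.elliptic r a).s u := by
  have step {T : ℂ} (hT : ∃ μ k : ℂ, μ ≠ 0 ∧ ∀ u,
      (Model.elliptic r a).s (u + T) = μ * exp (k * u) * (Model.elliptic r a).s u) (n : ℤ) :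
      ∃ μ k : ℂ, μ ≠ 0 ∧ ∀ u,
        (Model.elliptic r a).s (u + n * T) = μ * exp (k * u) * (Model.elliptic r a).s u := by
    obtain ⟨μ, k, hμ, h⟩ := hT
    induction n using Int.induction_on with
    | zero => exact ⟨1, 0, one_ne_zero, fun u => by simp⟩
    | succ n ih =>
      obtain ⟨μ', k', hμ', h'⟩ := ih
      refine ⟨μ * μ' * exp (k * (n * T)), k + k',
        mul_ne_zero (mul_ne_zero hμ hμ') (exp_ne_zero _), fun u => ?_⟩
      push_cast at h' ⊢
      rw [show u + (n + 1) * T = u + n * T + T by ring, h, h', add_mul, mul_add, Complex.exp_add,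
        Complex.exp_add]
      ring
    | pred n ih =>
      obtain ⟨μ', k', hμ', h'⟩ := ih
      refine ⟨μ⁻¹ * μ' * exp (-(k * ((-n - 1) * T))), k' - k,
        mul_ne_zero (mul_ne_zero (inv_ne_zero hμ) hμ') (exp_ne_zero _), fun u => ?_⟩
      push_cast at h' ⊢
      have h1 := h (u + (-n - 1) * T)
      rw [show u + (-n - 1) * T + T = u + -n * T by ring, h', mul_add, Complex.exp_add] at h1
      rw [show (k' - k) * u = k' * u - k * u by ring, Complex.exp_sub, Complex.exp_neg]
      have hA := exp_ne_zero (k * u)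
      have hB := exp_ne_zero (k * ((-n - 1) * T))
      generalize exp (k * u) = A at *
      generalize exp (k' * u) = A' at *
      generalize exp (k * ((-n - 1) * T)) = B at *
      field_simp
      linear_combination -h1
  obtain ⟨μ₁, k₁, hμ₁, h₁⟩ := step ⟨-1, 0, by simp, fun u => by
    rw [elliptic_s_add_real_period hr ha]; simp⟩ m
  obtain ⟨μ₂, k₂, hμ₂, h₂⟩ := step (T := I * a) ⟨-exp (r * a), -(2 * I * r),
    neg_ne_zero.2 (exp_ne_zero _), fun u => by
      rw [elliptic_s_add_imag_period hr ha]; simp⟩ n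
  refine ⟨μ₁ * μ₂ * exp (k₂ * (m * (Real.pi / r))), k₁ + k₂,
    mul_ne_zero (mul_ne_zero hμ₁ hμ₂) (exp_ne_zero _), fun u => ?_⟩
  rw [← add_assoc, h₂, h₁, add_mul, mul_add, Complex.exp_add, Complex.exp_add]
  ring

lemma elliptic_s_zero : (Model.elliptic r a).s 0 = 0 := by
  have := elliptic_s_neg hr ha 0
  rw [neg_zero] at this
  linear_combination this / 2

lemma elliptic_s_lattice (m n : ℤ) :
    (Model.elliptic r a).s (m * (Real.pi / r) + n * (I * a)) = 0 := by
  obtain ⟨μ, k, -, h⟩ := elliptic_s_quasiperiodic hr ha m n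
  have := h 0
  rwa [zero_add, elliptic_s_zero hr ha, mul_zero] at this

lemma elliptic_s_sub_eq_zero {u v : ℂ} (hu : (Model.elliptic r a).s u = 0)
    (hv : (Model.elliptic r a).s v = 0) : (Model.elliptic r a).s (u - v) = 0 := by
  obtain ⟨m, n, rfl⟩ := elliptic_s_eq_zero hr ha hu
  obtain ⟨m', n', rfl⟩ := elliptic_s_eq_zero hr ha hv
  have := elliptic_s_lattice hr ha (m - m') (n - n')
  rw [← this]
  congr 1
  push_cast
  ring

/-- Every zero is a lattice point, and quasi-periodicity multiplies the nonzero derivative at the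
origin by a nonzero constant there. -/
lemma elliptic_deriv_s_ne_zero {u : ℂ} (hu : (Model.elliptic r a).s u = 0) :
    deriv (Model.elliptic r a).s u ≠ 0 := by
  obtain ⟨m, n, hmn⟩ := elliptic_s_eq_zero hr ha hu
  obtain ⟨μ, k, hμ, h⟩ := elliptic_s_quasiperiodic hr ha m n
  obtain ⟨d, hd, hd0⟩ := elliptic_s_hasDerivAt_zero hr ha
  have h1 : HasDerivAt (fun v => (Model.elliptic r a).s (v + (m * (Real.pi / r) + n * (I * a))))
      (μ * d) 0 := by
    rw [show (fun v => (Model.elliptic r a).s (v + (m * (Real.pi / r) + n * (I * a)))) = _ from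
      funext h]
    have e : HasDerivAt (fun v : ℂ => μ * exp (k * v)) (μ * (exp (k * 0) * (k * 1))) 0 :=
      (((hasDerivAt_id (0 : ℂ)).const_mul k).cexp).const_mul μ
    have := e.fun_mul hd0
    simpa [elliptic_s_zero hr ha] using this
  have h2 : HasDerivAt (fun v => (Model.elliptic r a).s (v + (m * (Real.pi / r) + n * (I * a))))
      (deriv (Model.elliptic r a).s u) 0 := by
    have := (differentiable_elliptic_s hr ha (0 + u)).hasDerivAt.comp_add_const 0 u
    rw [zero_add] at this
    rwa [← hmn]
  rw [h2.unique h1]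
  exact mul_ne_zero hμ hd

lemma countable_elliptic_s_zeros : {u : ℂ | (Model.elliptic r a).s u = 0}.Countable := by
  refine (Set.countable_range fun x : ℤ × ℤ => x.1 * (Real.pi / r : ℂ) + x.2 * (I * a)).mono ?_
  intro u hu
  obtain ⟨m, n, h⟩ := elliptic_s_eq_zero hr ha hu
  exact ⟨(m, n), h.symm⟩

/-- The multiplier does not depend on `z`. So all products occurring in the three-term relation, as
functions of `x`, have the same multipliers. -/
lemma elliptic_s_mul_add_imag_period (x z : ℂ) :
    (Model.elliptic r a).s (x + I * a + z) * (Model.elliptic r a).s (x + I * a - z) =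
      exp (2 * (r * a)) * exp (-(4 * I * r * x)) *
        ((Model.elliptic r a).s (x + z) * (Model.elliptic r a).s (x - z)) := by
  rw [show x + I * a + z = x + z + I * a by ring, show x + I * a - z = x - z + I * a by ring,
    elliptic_s_add_imag_period hr ha, elliptic_s_add_imag_period hr ha]
  have e1 : exp (-(2 * I * r * (x + z))) * exp (-(2 * I * r * (x - z))) = exp (-(4 * I * r * x)) := by
    rw [← Complex.exp_add]; congr 1; ring
  have e2 : exp (r * a : ℂ) * exp (r * a) = exp (2 * (r * a)) := by
    rw [← Complex.exp_add]; congr 1; ring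
  rw [← e1, ← e2]
  ring

lemma elliptic_s_mul_add_real_period (x z : ℂ) :
    (Model.elliptic r a).s (x + (Real.pi / r : ℝ) + z) *
      (Model.elliptic r a).s (x + (Real.pi / r : ℝ) - z) =
        (Model.elliptic r a).s (x + z) * (Model.elliptic r a).s (x - z) := by
  push_cast
  rw [show x + Real.pi / r + z = x + z + Real.pi / r by ring,
    show x + Real.pi / r - z = x - z + Real.pi / r by ring,
    elliptic_s_add_real_period hr ha, elliptic_s_add_real_period hr ha]
  ring

/-- The three-term relation of the theta function. -/
lemma elliptic_s_three_term (x y z w : ℂ) :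
    (Model.elliptic r a).s (x + z) * (Model.elliptic r a).s (x - z) *
        ((Model.elliptic r a).s (y + w) * (Model.elliptic r a).s (y - w)) =
      (Model.elliptic r a).s (x + w) * (Model.elliptic r a).s (x - w) *
        ((Model.elliptic r a).s (y + z) * (Model.elliptic r a).s (y - z)) -
      (Model.elliptic r a).s (x + y) * (Model.elliptic r a).s (x - y) *
        ((Model.elliptic r a).s (w + z) * (Model.elliptic r a).s (w - z)) := by
  set s := (Model.elliptic r a).s with hs
  have hsd : Differentiable ℂ s := differentiable_elliptic_s hr ha
  have hsc : Continuous s := hsd.continuous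
  have hneg : ∀ u, s (-u) = -s u := elliptic_s_neg hr ha
  -- In the variable `x`, two of the three products are compared with `s(x + y) s(x - y)`. The
  -- condition on `2y` keeps the zeros of the latter simple; the other two conditions allow the
  -- constant to be found at `x = w`, where a term vanishes because `s(0) = 0`.
  have generic (y : ℂ) (h2y : s (2 * y) ≠ 0) (hp : s (w + y) ≠ 0) (hm : s (w - y) ≠ 0) :
      s (x + z) * s (x - z) * (s (y + w) * s (y - w)) =
        s (x + w) * s (x - w) * (s (y + z) * s (y - z)) -
        s (x + y) * s (x - y) * (s (w + z) * s (w - z)) := by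
    obtain ⟨C, hC⟩ := exists_eq_const_mul_of_multipliers
      (f := fun x => s (x + z) * s (x - z) * (s (y + w) * s (y - w)) -
        s (x + w) * s (x - w) * (s (y + z) * s (y - z)))
      (h := fun x => s (x + y) * s (x - y)) (p := Real.pi / r) (a := a) (m₁ := fun _ => 1)
      (m₂ := fun x => exp (2 * (r * a)) * exp (-(4 * I * r * x)))
      (by fun_prop) (by fun_prop) (by have := Real.pi_pos; positivity) ha
      (fun _ => one_ne_zero) (fun _ => mul_ne_zero (exp_ne_zero _) (exp_ne_zero _))
      (fun u => by
        simp only [hs, elliptic_s_mul_add_real_period hr ha, one_mul])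
      (fun u => by
        simp only [hs, elliptic_s_mul_add_real_period hr ha, one_mul])
      (fun u => by
        simp only [hs, elliptic_s_mul_add_imag_period hr ha]; ring)
      (fun u => by
        simp only [hs, elliptic_s_mul_add_imag_period hr ha])
      (fun u hu => by
        have hd1 : HasDerivAt (fun v => s (v + y)) (deriv s (u + y)) u :=
          (hsd (u + y)).hasDerivAt.comp_add_const u y
        have hd2 : HasDerivAt (fun v => s (v - y)) (deriv s (u - y)) u :=
          (hsd (u - y)).hasDerivAt.comp_sub_const u y
        have hd := (hd1.fun_mul hd2).deriv
        have hd' : deriv (fun v => s (v + y) * s (v - y)) u =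
            deriv s (u + y) * s (u - y) + s (u + y) * deriv s (u - y) := hd
        rw [hd']
        have not_both (h1 : s (u + y) = 0) (h2 : s (u - y) = 0) : False := by
          refine h2y ?_
          have := elliptic_s_sub_eq_zero hr ha h1 h2
          rwa [show u + y - (u - y) = 2 * y by ring] at this
        rcases mul_eq_zero.1 hu with h | h
        · obtain ⟨m, n, hmn⟩ := elliptic_s_eq_zero hr ha h
          obtain ⟨μ, k, hμ, hq⟩ := elliptic_s_quasiperiodic hr ha m n
          have e (t : ℂ) : s (u + t) * s (u - t) =
              μ ^ 2 * exp (-(2 * k * y)) * (s (y + t) * s (y - t)) := by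
            -- At a zero `u ≡ -y` modulo the lattice, `s(u + t) s(u - t)` is a factor independent of
            -- `t` times `s(y + t) s(y - t)`. The two compared terms then coincide and cancel.
            rw [show u + t = (-y + t) + (m * (Real.pi / r) + n * (I * a)) by
              linear_combination hmn, show u - t = (-y - t) + (m * (Real.pi / r) + n * (I * a)) by
              linear_combination hmn, hs, hq, hq, ← hs, show -y + t = -(y - t) by ring,
              show -y - t = -(y + t) by ring, hneg, hneg]
            have : exp (k * -(y - t)) * exp (k * -(y + t)) = exp (-(2 * k * y)) := by
              rw [← Complex.exp_add]; congr 1; ring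
            rw [← this]; ring
          refine ⟨?_, ?_⟩
          · simp only [e]; ring
          · rw [h, zero_mul, add_zero]
            exact mul_ne_zero (elliptic_deriv_s_ne_zero hr ha h) fun h' => not_both h h'
        · obtain ⟨m, n, hmn⟩ := elliptic_s_eq_zero hr ha h
          obtain ⟨μ, k, hμ, hq⟩ := elliptic_s_quasiperiodic hr ha m n
          have e (t : ℂ) : s (u + t) * s (u - t) =
              μ ^ 2 * exp (2 * k * y) * (s (y + t) * s (y - t)) := by
            rw [show u + t = (y + t) + (m * (Real.pi / r) + n * (I * a)) by
              linear_combination hmn, show u - t = (y - t) + (m * (Real.pi / r) + n * (I * a)) by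
              linear_combination hmn, hs, hq, hq, ← hs]
            have : exp (k * (y - t)) * exp (k * (y + t)) = exp (2 * k * y) := by
              rw [← Complex.exp_add]; congr 1; ring
            rw [← this]; ring
          refine ⟨?_, ?_⟩
          · simp only [e]; ring
          · rw [h, mul_zero, zero_add]
            exact mul_ne_zero (fun h' => not_both h' h) (elliptic_deriv_s_ne_zero hr ha h))
    have hw := hC w
    have hx := hC x
    have hs0 : s 0 = 0 := elliptic_s_zero hr ha
    rw [sub_self, hs0, mul_zero, zero_mul, sub_zero, add_comm y w,
      show y - w = -(w - y) by ring, hneg] at hw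
    have hCe : C = -(s (w + z) * s (w - z)) := by
      refine mul_right_cancel₀ (mul_ne_zero hp hm) ?_
      linear_combination -hw
    rw [hCe] at hx
    linear_combination hx
  -- The excluded `y` form a countable set, so continuity in `y` extends the relation to all `y`.
  have hcount : ({u : ℂ | s (2 * u) = 0} ∪ ({u : ℂ | s (w + u) = 0} ∪ {u : ℂ | s (w - u) = 0})).Countable := by
    have hz : {u : ℂ | s u = 0}.Countable := countable_elliptic_s_zeros hr ha
    refine Set.Countable.union ?_ (Set.Countable.union ?_ ?_)
    · exact hz.preimage (f := fun u : ℂ => 2 * u) (mul_right_injective₀ two_ne_zero)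
    · exact hz.preimage (f := fun u : ℂ => w + u) (add_right_injective w)
    · exact hz.preimage (f := fun u : ℂ => w - u) sub_right_injective
  have := Continuous.ext_on (hcount.dense_compl ℂ)
    (f := fun y => s (x + z) * s (x - z) * (s (y + w) * s (y - w)))
    (g := fun y => s (x + w) * s (x - w) * (s (y + z) * s (y - z)) -
        s (x + y) * s (x - y) * (s (w + z) * s (w - z))) (by fun_prop) (by fun_prop)
    (fun y hy => by
      simp only [Set.mem_compl_iff, Set.mem_union, Set.mem_ofPred_eq, not_or] at hy
      exact generic y hy.1 hy.2.1 hy.2.2)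
  exact congrFun this y

end Theta

end DeformedVanDiejen

end


/-! ### Duplication formula of the elliptic `s` -/

noncomputable section

namespace DeformedVanDiejen

/-- The four factors together have the multipliers of `s(2u)`, and each zero of `s(2u)`, a
half-lattice point, is a zero of one of them. By Liouville the two sides are proportional;
derivatives at the origin determine the constant. -/
lemma elliptic_duplication {r a : ℝ} (hr : 0 < r) (ha : 0 < a) (u : ℂ) :
    (Model.elliptic r a).s u * (Model.elliptic r a).s (u - Real.pi / r / 2) *
      (Model.elliptic r a).s (u - I * a / 2) *
      (Model.elliptic r a).s (u - (-(Real.pi / r) - I * a) / 2) =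
    -((Model.elliptic r a).s (Real.pi / r / 2) * (Model.elliptic r a).s (I * a / 2) *
      (Model.elliptic r a).s ((-(Real.pi / r) - I * a) / 2) / 2) *
      (Model.elliptic r a).s (2 * u) := by
  have hsd : Differentiable ℂ (Model.elliptic r a).s := differentiable_elliptic_s hr ha
  have hneg := elliptic_s_neg hr ha
  have h1 := elliptic_s_add_real_period hr ha
  have h2 := elliptic_s_add_imag_period hr ha
  have h0 : (Model.elliptic r a).s 0 = 0 := elliptic_s_zero hr ha
  have hlat := elliptic_s_eq_zero hr ha (x := 2 * u)
  have hlat2 := elliptic_s_lattice hr ha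
  have hder := fun v => elliptic_deriv_s_ne_zero hr ha (u := v)
  have hlat3 := fun v => elliptic_s_eq_zero hr ha (x := v)
  set s := (Model.elliptic r a).s with hs
  have hd2 (v : ℂ) : HasDerivAt (fun v => s (2 * v)) (deriv s (2 * v) * 2) v := by
    have := (hsd (2 * v)).hasDerivAt.comp v ((hasDerivAt_id v).const_mul 2)
    simpa using! this
  obtain ⟨C, hC⟩ := exists_eq_const_mul_of_multipliers
    (f := fun u => s u * s (u - Real.pi / r / 2) * s (u - I * a / 2) *
      s (u - (-(Real.pi / r) - I * a) / 2)) (h := fun u => s (2 * u))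
    (p := Real.pi / r) (a := a) (m₁ := fun _ => 1)
    (m₂ := fun x => exp (4 * (r * a)) * exp (-(8 * I * r * x)))
    (by fun_prop) (by fun_prop) (by have := Real.pi_pos; positivity) ha
    (fun _ => one_ne_zero) (fun _ => mul_ne_zero (exp_ne_zero _) (exp_ne_zero _))
    (fun v => by
      push_cast
      simp only [add_sub_right_comm, h1]
      ring)
    (fun v => by
      push_cast
      rw [show 2 * (v + Real.pi / r) = 2 * v + Real.pi / r + Real.pi / r by ring, h1, h1]
      ring)
    (fun v => by
      simp only [add_sub_right_comm, h2]
      have e1 : exp (-(2 * I * r * v)) * exp (-(2 * I * r * (v - Real.pi / r / 2))) *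
          exp (-(2 * I * r * (v - I * a / 2))) *
          exp (-(2 * I * r * (v - (-(Real.pi / r) - I * a) / 2))) = exp (-(8 * I * r * v)) := by
        simp only [← Complex.exp_add]
        congr 1
        ring
      have e2 : exp (r * a : ℂ) ^ 4 = exp (4 * (r * a)) := by
        rw [← Complex.exp_nat_mul]; congr 1
      rw [← e1, ← e2]
      ring)
    (fun v => by
      rw [show 2 * (v + I * a) = 2 * v + I * a + I * a by ring, h2, h2]
      have e1 : exp (r * a : ℂ) ^ 2 * (exp (-(2 * I * r * (2 * v + I * a))) *
          exp (-(2 * I * r * (2 * v)))) = exp (4 * (r * a)) * exp (-(8 * I * r * v)) := by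
        rw [← Complex.exp_nat_mul]
        simp only [← Complex.exp_add]
        congr 1
        push_cast
        linear_combination -(2 * r * a) * I_sq
      rw [← e1]
      ring)
    (fun v hv => by
      refine ⟨?_, ?_⟩
      · obtain ⟨m, n, hmn⟩ := hlat3 _ hv
        -- With `2v` equal to the lattice point of indices `m`, `n`, the parities of `m` and `n`
        -- decide which of the four factors vanishes.
        rcases Int.even_or_odd' m with ⟨m', rfl | rfl⟩ <;>
          rcases Int.even_or_odd' n with ⟨n', rfl | rfl⟩
        · have := hlat2 m' n'
          rw [show (m' * (Real.pi / r) + n' * (I * a) : ℂ) = v by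
            push_cast at hmn; linear_combination -hmn / 2] at this
          simp only [this]; ring
        · have := hlat2 m' n'
          rw [show (m' * (Real.pi / r) + n' * (I * a) : ℂ) = v - I * a / 2 by
            push_cast at hmn; linear_combination -hmn / 2] at this
          simp only [this]; ring
        · have := hlat2 m' n'
          rw [show (m' * (Real.pi / r) + n' * (I * a) : ℂ) = v - Real.pi / r / 2 by
            push_cast at hmn; linear_combination -hmn / 2] at this
          simp only [this]; ring
        · have := hlat2 (m' + 1) (n' + 1)
          rw [show ((m' + 1 : ℤ) * (Real.pi / r) + (n' + 1 : ℤ) * (I * a) : ℂ) =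
              v - (-(Real.pi / r) - I * a) / 2 by
            push_cast at hmn ⊢; linear_combination -hmn / 2] at this
          simp only [this]; ring
      · rw [(hd2 v).deriv]
        exact mul_ne_zero (hder _ hv) two_ne_zero)
  have hd := (hd2 0).const_mul C
  have hP : HasDerivAt (fun u => s u * (s (u - Real.pi / r / 2) * s (u - I * a / 2) *
      s (u - (-(Real.pi / r) - I * a) / 2))) (deriv s 0 * (s (0 - Real.pi / r / 2) *
        s (0 - I * a / 2) * s (0 - (-(Real.pi / r) - I * a) / 2)) + s 0 *
        deriv (fun u => s (u - Real.pi / r / 2) * s (u - I * a / 2) *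
      s (u - (-(Real.pi / r) - I * a) / 2)) 0) 0 := by
    refine (hsd 0).hasDerivAt.fun_mul (DifferentiableAt.hasDerivAt ?_)
    fun_prop
  have he : (fun u => s u * (s (u - Real.pi / r / 2) * s (u - I * a / 2) *
      s (u - (-(Real.pi / r) - I * a) / 2))) = fun u => C * s (2 * u) := by
    funext v
    rw [← hC v]
    ring
  rw [he] at hP
  have hCeq := hd.unique hP
  rw [h0, zero_mul, add_zero, mul_zero] at hCeq
  simp only [zero_sub, hneg] at hCeq
  have hC' : C = -(s (Real.pi / r / 2) * s (I * a / 2) * s ((-(Real.pi / r) - I * a) / 2) / 2) := by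
    refine mul_left_cancel₀ (hder 0 h0) ?_
    linear_combination hCeq / 2
  rw [← hC', hC u]

lemma countable_closure_range {ι : Type*} [Finite ι] (v : ι → ℂ) :
    (AddSubgroup.closure (Set.range v) : Set ℂ).Countable := by
  cases nonempty_fintype ι
  refine (Set.countable_range fun n : ι → ℤ => ∑ i, n i • v i).mono fun x hx => ?_
  obtain ⟨n, hn⟩ := AddSubgroup.mem_closure_range_iff_of_fintype.1 hx
  exact ⟨n, hn.symm⟩

/-! ### Properties of `s` shared by the four cases -/

namespace Model

variable {c : Model} (hc : c.Positive)
include hc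

lemma s_neg (x : ℂ) : c.s (-x) = -c.s x := by
  cases c with
  | rational => rfl
  | trigonometric r => simp [s]
  | hyperbolic a => simp [s, neg_div, Complex.sinh_neg]
  | elliptic r a => exact elliptic_s_neg hc.1 hc.2 x

lemma differentiable_s : Differentiable ℂ c.s := by
  cases c with
  | rational => exact differentiable_id
  | trigonometric r => unfold s; fun_prop
  | hyperbolic a => unfold s; fun_prop
  | elliptic r a => exact differentiable_elliptic_s hc.1 hc.2

lemma s_zero : c.s 0 = 0 := by
  have := s_neg hc 0
  rw [neg_zero] at this
  linear_combination this / 2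

omit hc in
lemma omega_mem (ν : Fin (c.rho + 1)) : c.omega ν ∈ c.Omega :=
  AddSubgroup.subset_closure ⟨ν, rfl⟩

lemma mem_Omega_of_s_eq_zero {x : ℂ} (hx : c.s x = 0) : x ∈ c.Omega := by
  cases c with
  | rational =>
    have : x = 0 := hx
    rw [this]; exact zero_mem _
  | trigonometric r =>
    have hr : (r : ℂ) ≠ 0 := by exact_mod_cast (show (0 : ℝ) < r from hc).ne'
    have h : sin (r * x) = 0 := by simpa [s, hr] using hx
    obtain ⟨k, hk⟩ := Complex.sin_eq_zero_iff.1 h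
    have h1 : (Real.pi / r : ℂ) ∈ (trigonometric r).Omega :=
      omega_mem (c := trigonometric r) (1 : Fin 2)
    have h2 : x = k • (Real.pi / r : ℂ) := by
      rw [zsmul_eq_mul]; field_simp; linear_combination hk
    rw [h2]; exact zsmul_mem h1 k
  | hyperbolic a =>
    have ha : (a : ℂ) ≠ 0 := by exact_mod_cast (show (0 : ℝ) < a from hc).ne'
    have hpi : (Real.pi : ℂ) ≠ 0 := by exact_mod_cast Real.pi_ne_zero
    have h : sinh (Real.pi * x / a) = 0 := by simpa [s, ha, hpi] using hx
    have h' : sin (Real.pi * x / a * I) = 0 := by rw [Complex.sin_mul_I, h, zero_mul]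
    obtain ⟨k, hk⟩ := Complex.sin_eq_zero_iff.1 h'
    have h1 : (I * a : ℂ) ∈ (hyperbolic a).Omega := omega_mem (c := hyperbolic a) (1 : Fin 2)
    have h2 : x = (-k) • (I * a : ℂ) := by
      rw [zsmul_eq_mul]
      push_cast
      have h3 : Real.pi * (x * I) = Real.pi * (k * a) := by
        field_simp at hk
        linear_combination Real.pi * hk
      linear_combination -I * mul_left_cancel₀ hpi h3 + x * I_sq
    rw [h2]; exact zsmul_mem h1 _
  | elliptic r a =>
    obtain ⟨m, n, h⟩ := elliptic_s_eq_zero hc.1 hc.2 hx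
    have h1 : (Real.pi / r : ℂ) ∈ (elliptic r a).Omega := omega_mem (c := elliptic r a) (1 : Fin 4)
    have h2 : (I * a : ℂ) ∈ (elliptic r a).Omega := omega_mem (c := elliptic r a) (2 : Fin 4)
    rw [h, ← zsmul_eq_mul, ← zsmul_eq_mul]
    exact add_mem (zsmul_mem h1 m) (zsmul_mem h2 n)

omit hc in
lemma countable_Omega (c : Model) : (c.Omega : Set ℂ).Countable :=
  countable_closure_range c.omega

end Model

end DeformedVanDiejen

end


noncomputable section

namespace DeformedVanDiejen

namespace Model

variable {c : Model} (hc : c.Positive)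
include hc

lemma s_conj (x : ℂ) : conj (c.s x) = c.s (conj x) := by
  cases c with
  | rational => rfl
  | trigonometric r => simp [s, ← Complex.sin_conj]
  | hyperbolic a => simp [s, ← Complex.sinh_conj]
  | elliptic r a => exact elliptic_s_conj hc.1 hc.2 x

lemma exists_hasDerivAt_s_zero : ∃ d : ℂ, d ≠ 0 ∧ HasDerivAt c.s d 0 := by
  cases c with
  | rational => exact ⟨1, one_ne_zero, hasDerivAt_id 0⟩
  | trigonometric r =>
    have hr : (r : ℂ) ≠ 0 := by exact_mod_cast (show (0 : ℝ) < r from hc).ne'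
    refine ⟨1, one_ne_zero, ?_⟩
    have := (((hasDerivAt_id (0 : ℂ)).const_mul (r : ℂ)).csin).const_mul (1 / r : ℂ)
    have e : HasDerivAt (fun y : ℂ => 1 / r * sin (r * y)) 1 0 := by simpa [hr] using! this
    exact e
  | hyperbolic a =>
    have ha : (a : ℂ) ≠ 0 := by exact_mod_cast (show (0 : ℝ) < a from hc).ne'
    have hpi : (Real.pi : ℂ) ≠ 0 := by exact_mod_cast Real.pi_ne_zero
    refine ⟨1, one_ne_zero, ?_⟩
    have := ((((hasDerivAt_id (0 : ℂ)).const_mul (Real.pi : ℂ)).div_const (a : ℂ)).csinh).const_mul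
      (a / Real.pi : ℂ)
    have e : (a / Real.pi : ℂ) * (Real.pi / a) = 1 := by field_simp
    have e2 : HasDerivAt (fun y : ℂ => a / Real.pi * sinh (Real.pi * y / a)) 1 0 := by
      simpa [e] using! this
    exact e2
  | elliptic r a => exact elliptic_s_hasDerivAt_zero hc.1 hc.2

/-- Centring the exponential at `ω_ν/2` reduces the remaining constant to a sign. This is the
uniform form of quasi-periodicity that treats the four cases together. -/
lemma s_add_omega (ν : Fin (c.rho + 1)) : ∃ σ : ℂ, (σ = 1 ∨ σ = -1) ∧ ∀ x,
    c.s (x + c.omega ν) = σ * exp (2 * I * c.rXi ν * (x + c.omega ν / 2)) * c.s x := by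
  cases c with
  | rational =>
    revert ν
    change ∀ ν : Fin 1, _
    intro ν
    fin_cases ν
    refine ⟨1, .inl rfl, fun x => ?_⟩
    change x + 0 = 1 * exp (2 * I * (0 : ℝ) * (x + 0 / 2)) * x
    simp
  | trigonometric r =>
    have hr : (r : ℂ) ≠ 0 := by exact_mod_cast (show (0 : ℝ) < r from hc).ne'
    revert ν
    change ∀ ν : Fin 2, _
    intro ν
    fin_cases ν
    · refine ⟨1, .inl rfl, fun x => ?_⟩
      change (trigonometric r).s (x + 0) = 1 * exp (2 * I * (0 : ℝ) * (x + 0 / 2)) * _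
      simp
    · refine ⟨-1, .inr rfl, fun x => ?_⟩
      change 1 / r * sin (r * (x + Real.pi / r)) =
        -1 * exp (2 * I * (0 : ℝ) * (x + Real.pi / r / 2)) * (1 / r * sin (r * x))
      rw [show (r : ℂ) * (x + Real.pi / r) = r * x + Real.pi by field_simp, Complex.sin_add_pi]
      simp
  | hyperbolic a =>
    have ha : (a : ℂ) ≠ 0 := by exact_mod_cast (show (0 : ℝ) < a from hc).ne'
    revert ν
    change ∀ ν : Fin 2, _
    intro ν
    fin_cases ν
    · refine ⟨1, .inl rfl, fun x => ?_⟩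
      change (hyperbolic a).s (x + 0) = 1 * exp (2 * I * (0 : ℝ) * (x + 0 / 2)) * _
      simp
    · refine ⟨-1, .inr rfl, fun x => ?_⟩
      change a / Real.pi * sinh (Real.pi * (x + I * a) / a) =
        -1 * exp (2 * I * (0 : ℝ) * (x + I * a / 2)) * (a / Real.pi * sinh (Real.pi * x / a))
      rw [show (Real.pi : ℂ) * (x + I * a) / a = Real.pi * x / a + Real.pi * I by field_simp,
        Complex.sinh_add, Complex.sinh_mul_I, Complex.cosh_mul_I]
      simp
  | elliptic r a =>
    have hr : (r : ℂ) ≠ 0 := by exact_mod_cast hc.1.ne'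
    have h1 := elliptic_s_add_real_period hc.1 hc.2
    have h2 := elliptic_s_add_imag_period hc.1 hc.2
    revert ν
    change ∀ ν : Fin 4, _
    intro ν
    fin_cases ν
    · refine ⟨1, .inl rfl, fun x => ?_⟩
      change (elliptic r a).s (x + 0) = 1 * exp (2 * I * (0 : ℝ) * (x + 0 / 2)) * _
      simp
    · refine ⟨-1, .inr rfl, fun x => ?_⟩
      change (elliptic r a).s (x + Real.pi / r) =
        -1 * exp (2 * I * (0 : ℝ) * (x + Real.pi / r / 2)) * (elliptic r a).s x
      rw [h1]
      simp
    · refine ⟨-1, .inr rfl, fun x => ?_⟩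
      change (elliptic r a).s (x + I * a) =
        -1 * exp (2 * I * (-r : ℝ) * (x + I * a / 2)) * (elliptic r a).s x
      rw [h2, ← Complex.exp_add]
      rw [show (2 * I * (-r : ℝ) * (x + I * a / 2) : ℂ) = r * a + -(2 * I * r * x) by
        push_cast; linear_combination (-r * a) * I_sq]
      ring
    · refine ⟨-1, .inr rfl, fun x => ?_⟩
      change (elliptic r a).s (x + (-(Real.pi / r) - I * a)) =
        -1 * exp (2 * I * r * (x + (-(Real.pi / r) - I * a) / 2)) * (elliptic r a).s x
      -- Since `ω_3` is minus the sum of the two basic periods, the shift by `ω_3` undoes the two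
      -- known shifts starting from `y`.
      obtain ⟨y, rfl⟩ : ∃ y, x = y + I * a + Real.pi / r := ⟨x - Real.pi / r - I * a, by ring⟩
      rw [h1, h2, show y + I * a + Real.pi / r + (-(Real.pi / r) - I * a) = y by ring]
      have e : exp (2 * I * r * (y + I * a + Real.pi / r + (-(Real.pi / r) - I * a) / 2)) *
          (exp (r * a) * exp (-(2 * I * r * y))) = -1 := by
        rw [← Complex.exp_add, ← Complex.exp_add, ← Complex.exp_pi_mul_I]
        congr 1
        field_simp
        linear_combination (r * a) * I_sq
      linear_combination (elliptic r a).s y * e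

/-- Combining the shift by `ω_ν` with oddness turns quasi-periodicity into a reflection in the point
`ω_ν/2`. -/
lemma s_half_omega_add (ν : Fin (c.rho + 1)) : ∃ σ : ℂ, (σ = 1 ∨ σ = -1) ∧ ∀ u,
    c.s (c.omega ν / 2 + u) = σ * exp (2 * I * c.rXi ν * u) * c.s (c.omega ν / 2 - u) := by
  obtain ⟨σ, hσ, h⟩ := s_add_omega hc ν
  refine ⟨-σ, by rcases hσ with rfl | rfl <;> simp, fun u => ?_⟩
  have := h (u - c.omega ν / 2)
  rw [show u - c.omega ν / 2 + c.omega ν = c.omega ν / 2 + u by ring, sub_add_cancel] at this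
  rw [this, show u - c.omega ν / 2 = -(c.omega ν / 2 - u) by ring, s_neg hc]
  ring

/-- Conjugation negates an imaginary half-period, so oddness is enough; it fixes a real one, where a
shift by the full period is used as well. The mixed half-period of the elliptic case is treated by
the real shift after conjugation. -/
lemma conj_s_half_omega_add (ν : Fin (c.rho + 1)) : ∃ χ : ℂ, (χ = 1 ∨ χ = -1) ∧ ∀ u,
    conj (c.s (c.omega ν / 2 + u)) = χ * c.s (c.omega ν / 2 - conj u) := by
  have h0 (w : ℂ) : conj (c.s (0 / 2 + w)) = -1 * c.s (0 / 2 - conj w) := by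
    rw [s_conj hc, zero_div, zero_add, zero_sub, s_neg hc]; ring
  have hreal (p : ℂ) (hp : conj p = p) (hs : ∀ x, c.s (x + p) = - c.s x) (w : ℂ) :
      conj (c.s (p / 2 + w)) = 1 * c.s (p / 2 - conj w) := by
    rw [s_conj hc, map_add, map_div₀, hp, map_ofNat,
      show p / 2 + conj w = -(p / 2 - conj w) + p by ring, hs, s_neg hc]
    ring
  have himag (p : ℂ) (hp : conj p = -p) (w : ℂ) :
      conj (c.s (p / 2 + w)) = -1 * c.s (p / 2 - conj w) := by
    rw [s_conj hc, map_add, map_div₀, hp, map_ofNat,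
      show -p / 2 + conj w = -(p / 2 - conj w) by ring, s_neg hc]
    ring
  cases c with
  | rational =>
    revert ν
    change ∀ ν : Fin 1, _
    intro ν
    fin_cases ν
    exact ⟨-1, .inr rfl, h0⟩
  | trigonometric r =>
    have hr : (r : ℂ) ≠ 0 := by exact_mod_cast (show (0 : ℝ) < r from hc).ne'
    revert ν
    change ∀ ν : Fin 2, _
    intro ν
    fin_cases ν
    · exact ⟨-1, .inr rfl, h0⟩
    · refine ⟨1, .inl rfl, hreal (Real.pi / r) (by simp) fun x => ?_⟩
      change 1 / r * sin (r * (x + Real.pi / r)) = -(1 / r * sin (r * x))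
      rw [show (r : ℂ) * (x + Real.pi / r) = r * x + Real.pi by field_simp, Complex.sin_add_pi]
      ring
  | hyperbolic a =>
    revert ν
    change ∀ ν : Fin 2, _
    intro ν
    fin_cases ν
    · exact ⟨-1, .inr rfl, h0⟩
    · exact ⟨-1, .inr rfl, himag (I * a) (by simp)⟩
  | elliptic r a =>
    have h1 := elliptic_s_add_real_period hc.1 hc.2
    revert ν
    change ∀ ν : Fin 4, _
    intro ν
    fin_cases ν
    · exact ⟨-1, .inr rfl, h0⟩
    · exact ⟨1, .inl rfl, hreal (Real.pi / r) (by simp) h1⟩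
    · exact ⟨-1, .inr rfl, himag (I * a) (by simp)⟩
    · refine ⟨1, .inl rfl, fun w => ?_⟩
      change conj ((elliptic r a).s ((-(Real.pi / r) - I * a) / 2 + w)) =
        1 * (elliptic r a).s ((-(Real.pi / r) - I * a) / 2 - conj w)
      rw [s_conj hc, show (-(Real.pi / r) - I * a) / 2 - conj w =
        -(conj ((-(Real.pi / r) - I * a) / 2 + w) + Real.pi / r) by simp [map_ofNat]; ring, s_neg hc, h1]
      ring

/-- The sign of `L` plays no role later; `L² = P` is what identifies the prefactor of `V⁰` and `c⁰`
with the constants picked up by the residues. -/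
lemma exists_duplication : ∃ L : ℂ, L ^ 2 = c.prefactor ∧ ∀ u,
    ∏ μ, c.s (u - c.omega μ / 2) = L * c.s (2 * u) := by
  cases c with
  | rational =>
    refine ⟨1 / 2, ?_, fun u => ?_⟩
    · change _ = (∏ ν : Fin 0, rational.s (rational.omega ν.succ / 2) ^ 2) / 4
      rw [Finset.univ_eq_empty, Finset.prod_empty]; norm_num
    · change ∏ μ : Fin 1, (u - (![0] : Fin 1 → ℂ) μ / 2) = 1 / 2 * (2 * u)
      simp
  | trigonometric r =>
    have hr : (r : ℂ) ≠ 0 := by exact_mod_cast (show (0 : ℝ) < r from hc).ne'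
    have hs : (trigonometric r).s (Real.pi / r / 2) = 1 / r := by
      change 1 / r * sin (r * (Real.pi / r / 2)) = 1 / r
      rw [show (r : ℂ) * (Real.pi / r / 2) = Real.pi / 2 by field_simp, Complex.sin_pi_div_two,
        mul_one]
    refine ⟨-(1 / r) / 2, ?_, fun u => ?_⟩
    · change _ = (∏ ν : Fin 1, (trigonometric r).s ((![0, Real.pi / r] : Fin 2 → ℂ) ν.succ / 2) ^ 2) / 4
      simp only [Finset.univ_unique, Fin.default_eq_zero, Finset.prod_singleton]
      change _ = (trigonometric r).s (Real.pi / r / 2) ^ 2 / 4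
      rw [hs]; ring
    · change ∏ μ : Fin 2, (trigonometric r).s (u - (![0, Real.pi / r] : Fin 2 → ℂ) μ / 2) = _
      rw [Fin.prod_univ_two]
      change 1 / r * sin (r * (u - 0 / 2)) * (1 / r * sin (r * (u - Real.pi / r / 2))) =
        -(1 / r) / 2 * (1 / r * sin (r * (2 * u)))
      rw [show (r : ℂ) * (u - Real.pi / r / 2) = r * u - Real.pi / 2 by field_simp,
        Complex.sin_sub_pi_div_two, show (r : ℂ) * (2 * u) = 2 * (r * u) by ring,
        Complex.sin_two_mul]
      ring_nf
  | hyperbolic a =>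
    have ha : (a : ℂ) ≠ 0 := by exact_mod_cast (show (0 : ℝ) < a from hc).ne'
    have hpi : (Real.pi : ℂ) ≠ 0 := by exact_mod_cast Real.pi_ne_zero
    have hs : (hyperbolic a).s (I * a / 2) = a / Real.pi * I := by
      change a / Real.pi * sinh (Real.pi * (I * a / 2) / a) = _
      rw [show (Real.pi : ℂ) * (I * a / 2) / a = Real.pi / 2 * I by field_simp, Complex.sinh_mul_I,
        Complex.sin_pi_div_two, one_mul]
    refine ⟨-(a / Real.pi * I) / 2, ?_, fun u => ?_⟩
    · change _ = (∏ ν : Fin 1, (hyperbolic a).s ((![0, I * a] : Fin 2 → ℂ) ν.succ / 2) ^ 2) / 4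
      simp only [Finset.univ_unique, Fin.default_eq_zero, Finset.prod_singleton]
      change _ = (hyperbolic a).s (I * a / 2) ^ 2 / 4
      rw [hs]; ring
    · change ∏ μ : Fin 2, (hyperbolic a).s (u - (![0, I * a] : Fin 2 → ℂ) μ / 2) = _
      rw [Fin.prod_univ_two]
      change a / Real.pi * sinh (Real.pi * (u - 0 / 2) / a) *
        (a / Real.pi * sinh (Real.pi * (u - I * a / 2) / a)) =
        -(a / Real.pi * I) / 2 * (a / Real.pi * sinh (Real.pi * (2 * u) / a))
      rw [show (Real.pi : ℂ) * (u - I * a / 2) / a = Real.pi * u / a - Real.pi / 2 * I by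
          field_simp,
        show (Real.pi : ℂ) * (2 * u) / a = 2 * (Real.pi * u / a) by ring,
        Complex.sinh_two_mul, Complex.sinh_sub, Complex.sinh_mul_I, Complex.cosh_mul_I,
        Complex.sin_pi_div_two, Complex.cos_pi_div_two]
      ring_nf
  | elliptic r a =>
    refine ⟨-((elliptic r a).s (Real.pi / r / 2) * (elliptic r a).s (I * a / 2) *
      (elliptic r a).s ((-(Real.pi / r) - I * a) / 2) / 2), ?_, fun u => ?_⟩
    rotate_left
    · change ∏ μ : Fin 4, (elliptic r a).s
        (u - (![0, Real.pi / r, I * a, -(Real.pi / r) - I * a] : Fin 4 → ℂ) μ / 2) = _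
      rw [Fin.prod_univ_four]
      change (elliptic r a).s (u - 0 / 2) * (elliptic r a).s (u - Real.pi / r / 2) *
        (elliptic r a).s (u - I * a / 2) * (elliptic r a).s (u - (-(Real.pi / r) - I * a) / 2) = _
      rw [zero_div, sub_zero]
      exact elliptic_duplication hc.1 hc.2 u
    · change _ = (∏ ν : Fin 3, (elliptic r a).s
        ((![0, Real.pi / r, I * a, -(Real.pi / r) - I * a] : Fin 4 → ℂ) ν.succ / 2) ^ 2) / 4
      rw [Fin.prod_univ_three]
      change _ = ((elliptic r a).s (Real.pi / r / 2) ^ 2 * (elliptic r a).s (I * a / 2) ^ 2 *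
        (elliptic r a).s ((-(Real.pi / r) - I * a) / 2) ^ 2) / 4
      ring

lemma conj_exp_rXi_omega (ν : Fin (c.rho + 1)) :
    conj (exp (2 * I * c.rXi ν * c.omega ν)) = exp (2 * I * c.rXi ν * c.omega ν) := by
  have h0 (w : ℂ) : conj (exp (2 * I * (0 : ℝ) * w)) = exp (2 * I * (0 : ℝ) * w) := by simp
  cases c with
  | rational =>
    revert ν
    change ∀ ν : Fin 1, _
    intro ν
    fin_cases ν
    exact h0 _
  | trigonometric r =>
    revert ν
    change ∀ ν : Fin 2, _
    intro ν
    fin_cases ν <;> exact h0 _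
  | hyperbolic a =>
    revert ν
    change ∀ ν : Fin 2, _
    intro ν
    fin_cases ν <;> exact h0 _
  | elliptic r a =>
    have hr : (r : ℂ) ≠ 0 := by exact_mod_cast hc.1.ne'
    revert ν
    change ∀ ν : Fin 4, _
    intro ν
    fin_cases ν
    · exact h0 _
    · exact h0 _
    · change conj (exp (2 * I * (-r : ℝ) * (I * a))) = exp (2 * I * (-r : ℝ) * (I * a))
      rw [← Complex.exp_conj]
      simp [map_ofNat]
    · change conj (exp (2 * I * r * (-(Real.pi / r) - I * a))) =
        exp (2 * I * r * (-(Real.pi / r) - I * a))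
      have : exp (2 * I * r * (-(Real.pi / r) - I * a)) = exp (2 * r * a : ℝ) := by
        rw [Complex.exp_eq_exp_iff_exists_int]
        refine ⟨-1, ?_⟩
        push_cast
        field_simp
        linear_combination -(r * a) * I_sq
      rw [this, ← Complex.ofReal_exp, Complex.conj_ofReal]

/-- The product of the remaining half-period factors at a half-period. -/
lemma prod_erase_half_omega_sub {L : ℂ}
    (hL : ∀ u, ∏ μ, c.s (u - c.omega μ / 2) = L * c.s (2 * u)) (ν : Fin (c.rho + 1)) :
    ∃ σ : ℂ, (σ = 1 ∨ σ = -1) ∧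
      (∀ x, c.s (x + c.omega ν) = σ * exp (2 * I * c.rXi ν * (x + c.omega ν / 2)) * c.s x) ∧
      ∏ μ ∈ Finset.univ.erase ν, c.s ((c.omega ν - c.omega μ) / 2) =
        2 * L * (σ * exp (I * c.rXi ν * c.omega ν)) := by
  obtain ⟨σ, hσ, h⟩ := s_add_omega hc ν
  refine ⟨σ, hσ, h, ?_⟩
  obtain ⟨d, hd, hd0⟩ := exists_hasDerivAt_s_zero hc
  have hsd := differentiable_s hc
  have h0 := s_zero hc
  -- The duplication formula is differentiated at `ω_ν/2`. The factor with `μ = ν` vanishes there,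
  -- so the derivative isolates the product over the other half-periods; the derivative `d` of `s`
  -- at the origin cancels.
  have e1 : HasDerivAt (fun u => c.s u * ∏ μ ∈ Finset.univ.erase ν,
      c.s (u + (c.omega ν - c.omega μ) / 2))
      (d * ∏ μ ∈ Finset.univ.erase ν, c.s (0 + (c.omega ν - c.omega μ) / 2) + c.s 0 *
        deriv (fun u => ∏ μ ∈ Finset.univ.erase ν, c.s (u + (c.omega ν - c.omega μ) / 2)) 0) 0 := by
    refine hd0.fun_mul (DifferentiableAt.hasDerivAt ?_)
    exact (Differentiable.fun_finsetProd fun μ _ => by fun_prop) 0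
  have e2 : (fun u => c.s u * ∏ μ ∈ Finset.univ.erase ν,
      c.s (u + (c.omega ν - c.omega μ) / 2)) =
      fun u => L * (σ * exp (2 * I * c.rXi ν * (2 * u + c.omega ν / 2)) * c.s (2 * u)) := by
    funext u
    rw [← h, show 2 * u + c.omega ν = 2 * (u + c.omega ν / 2) by ring, ← hL,
      ← Finset.mul_prod_erase _ _ (Finset.mem_univ ν), add_sub_cancel_right]
    congr 1
    exact Finset.prod_congr rfl fun μ _ => by congr 1; ring
  have e3 : HasDerivAt (fun u : ℂ => c.s (2 * u)) (d * 2) 0 := by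
    have e : HasDerivAt c.s d (2 * 0) := by rwa [mul_zero]
    have := e.comp (0 : ℂ) ((hasDerivAt_id (0 : ℂ)).const_mul 2)
    simpa using! this
  have e4 : HasDerivAt
      (fun u : ℂ => L * (σ * exp (2 * I * c.rXi ν * (2 * u + c.omega ν / 2)) * c.s (2 * u)))
      (L * (deriv (fun u : ℂ => σ * exp (2 * I * c.rXi ν * (2 * u + c.omega ν / 2))) 0 * c.s (2 * 0)
        + σ * exp (2 * I * c.rXi ν * (2 * 0 + c.omega ν / 2)) * (d * 2))) 0 := by
    refine HasDerivAt.const_mul L (HasDerivAt.fun_mul (DifferentiableAt.hasDerivAt ?_) e3)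
    fun_prop
  rw [e2] at e1
  have e5 := e1.unique e4
  simp only [mul_zero, h0, zero_mul, zero_add, add_zero] at e5
  refine mul_left_cancel₀ hd (e5.trans ?_)
  rw [show 2 * I * c.rXi ν * (c.omega ν / 2) = I * c.rXi ν * c.omega ν by ring]
  ring

end Model

end DeformedVanDiejen

end


noncomputable section

namespace DeformedVanDiejen

/-! ### The residue identity -/

section Residue

variable {ι : Type*} [DecidableEq ι]

/-- The sum of the residues of `∏ j, s (z - a j) / s (z - b j)`, for `s` with derivative `1` at `0`. -/
def residueSum (s : ℂ → ℂ) (I : Finset ι) (a b : ι → ℂ) : ℂ :=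
  ∑ i ∈ I, (∏ j ∈ I, s (b i - a j)) / ∏ j ∈ I.erase i, s (b i - b j)

lemma residueSum_insert (s : ℂ → ℂ) {J : Finset ι} {p : ι} (hp : p ∉ J) (a b : ι → ℂ) :
    residueSum s (insert p J) a b =
      s (b p - a p) * (∏ j ∈ J, s (b p - a j)) / ∏ j ∈ J, s (b p - b j) +
      ∑ i ∈ J, s (b i - a p) * (∏ j ∈ J, s (b i - a j)) /
        (s (b i - b p) * ∏ j ∈ J.erase i, s (b i - b j)) := by
  rw [residueSum, Finset.sum_insert hp, Finset.erase_insert hp, Finset.prod_insert hp]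
  congr 1
  refine Finset.sum_congr rfl fun i hi => ?_
  have hip : p ≠ i := fun h => hp (h ▸ hi)
  rw [Finset.prod_insert hp, Finset.erase_insert_of_ne hip,
    Finset.prod_insert (fun h => hp (Finset.mem_of_mem_erase h))]

variable {s : ℂ → ℂ} (hodd : ∀ x, s (-x) = -s x)
  (hthree : ∀ x y z w, s (x + z) * s (x - z) * (s (y + w) * s (y - w)) =
    s (x + w) * s (x - w) * (s (y + z) * s (y - z)) -
      s (x + y) * s (x - y) * (s (w + z) * s (w - z)))
include hodd hthree

omit hodd in
-- The three-term relation centred at `(a + a')/2`. Divided by `s(x - p) s(x - q)`, it is a partial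
-- fraction decomposition of a quotient with two zeros and two poles into quotients with one of
-- each.
lemma three_term_poles (x p q a a' : ℂ) :
    s (x - a) * s (x - a') * (s (p + q - a - a') * s (p - q)) =
      s (x - (a + a' - q)) * s (x - q) * (s (p - a) * s (p - a')) -
        s (x - (a + a' - p)) * s (x - p) * (s (q - a) * s (q - a')) := by
  have h := hthree (x - (a + a') / 2) (p - (a + a') / 2) ((a - a') / 2) (q - (a + a') / 2)
  ring_nf at h ⊢
  linear_combination h

/-- Partial fractions in the poles `b_p` and `b_q`: each term on the right has lost one pole, and
its new zero is chosen so that `∑ (b_i - a_i)` is unchanged. This is the induction step of the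
residue identity. -/
lemma residueSum_step {J : Finset ι} {p q : ι} (hp : p ∉ J) (hq : q ∉ J) (hpq : p ≠ q)
    (a b : ι → ℂ)
    (hb : ∀ i ∈ insert p (insert q J), ∀ j ∈ insert p (insert q J), i ≠ j → s (b i - b j) ≠ 0) :
    s (b p + b q - a p - a q) * s (b p - b q) * residueSum s (insert p (insert q J)) a b =
      s (b p - a p) * s (b p - a q) *
        residueSum s (insert p J) (Function.update a p (a p + a q - b q)) b -
      s (b q - a p) * s (b q - a q) *
        residueSum s (insert q J) (Function.update a q (a p + a q - b p)) b := by
  have hpJ : p ∉ insert q J := by simp [hpq, hp]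
  have hup : ∀ x, ∏ j ∈ J, s (x - Function.update a p (a p + a q - b q) j) =
      ∏ j ∈ J, s (x - a j) := fun x => Finset.prod_congr rfl fun j hj => by
    rw [Function.update_of_ne (ne_of_mem_of_not_mem hj hp)]
  have huq : ∀ x, ∏ j ∈ J, s (x - Function.update a q (a p + a q - b p) j) =
      ∏ j ∈ J, s (x - a j) := fun x => Finset.prod_congr rfl fun j hj => by
    rw [Function.update_of_ne (ne_of_mem_of_not_mem hj hq)]
  rw [residueSum_insert s hpJ, residueSum_insert s hp, residueSum_insert s hq]
  simp only [hup, huq, Function.update_self]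
  rw [Finset.sum_insert hq, Finset.prod_insert hq, Finset.prod_insert hq, Finset.prod_insert hq,
    Finset.erase_insert hq]
  have hJ : ∀ i ∈ J, s (b i - a p) * (∏ j ∈ insert q J, s (b i - a j)) /
        (s (b i - b p) * ∏ j ∈ (insert q J).erase i, s (b i - b j)) =
      s (b i - a p) * (s (b i - a q) * ∏ j ∈ J, s (b i - a j)) /
        (s (b i - b p) * (s (b i - b q) * ∏ j ∈ J.erase i, s (b i - b j))) := fun i hi => by
    rw [Finset.prod_insert hq, Finset.erase_insert_of_ne (ne_of_mem_of_not_mem hi hq).symm,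
      Finset.prod_insert (fun h => hq (Finset.mem_of_mem_erase h))]
  rw [Finset.sum_congr rfl hJ]
  have hbpq : s (b p - b q) ≠ 0 := hb p (by simp) q (by simp) hpq
  have hbqp : s (b q - b p) = -s (b p - b q) := by rw [← hodd, neg_sub]
  have hEp : ∏ j ∈ J, s (b p - b j) ≠ 0 := Finset.prod_ne_zero_iff.2 fun j hj =>
    hb p (by simp) j (by simp [hj]) fun h => hp (h ▸ hj)
  have hEq : ∏ j ∈ J, s (b q - b j) ≠ 0 := Finset.prod_ne_zero_iff.2 fun j hj =>
    hb q (by simp) j (by simp [hj]) fun h => hq (h ▸ hj)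
  have hsum : s (b p + b q - a p - a q) * s (b p - b q) *
      ∑ i ∈ J, s (b i - a p) * (s (b i - a q) * ∏ j ∈ J, s (b i - a j)) /
        (s (b i - b p) * (s (b i - b q) * ∏ j ∈ J.erase i, s (b i - b j))) =
      s (b p - a p) * s (b p - a q) * ∑ i ∈ J, s (b i - (a p + a q - b q)) *
        (∏ j ∈ J, s (b i - a j)) / (s (b i - b p) * ∏ j ∈ J.erase i, s (b i - b j)) -
      s (b q - a p) * s (b q - a q) * ∑ i ∈ J, s (b i - (a p + a q - b p)) *
        (∏ j ∈ J, s (b i - a j)) / (s (b i - b q) * ∏ j ∈ J.erase i, s (b i - b j)) := by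
    rw [Finset.mul_sum, Finset.mul_sum, Finset.mul_sum, ← Finset.sum_sub_distrib]
    refine Finset.sum_congr rfl fun i hi => ?_
    have h := three_term_poles hthree (b i) (b p) (b q) (a p) (a q)
    have h1 : s (b i - b p) ≠ 0 := hb i (by simp [hi]) p (by simp) fun h => hp (h ▸ hi)
    have h2 : s (b i - b q) ≠ 0 := hb i (by simp [hi]) q (by simp) fun h => hq (h ▸ hi)
    have h3 : ∏ j ∈ J.erase i, s (b i - b j) ≠ 0 := Finset.prod_ne_zero_iff.2 fun j hj =>
      hb i (by simp [hi]) j (by simp [Finset.mem_of_mem_erase hj])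
        (Finset.ne_of_mem_erase hj).symm
    generalize (∏ j ∈ J.erase i, s (b i - b j)) = D at *
    generalize (∏ j ∈ J, s (b i - a j)) = R at *
    generalize s (b i - b p) = y1 at *
    generalize s (b i - b q) = y2 at *
    field_simp
    linear_combination R * h
  rw [show b p - (a p + a q - b q) = b p + b q - a p - a q by ring,
    show b q - (a p + a q - b p) = b p + b q - a p - a q by ring, hbqp]
  rw [mul_add, mul_add, hsum]
  field_simp
  ring

variable (hcont : Continuous s) (hzero : {u | s u = 0}.Countable) {T : ℂ}
  (hT : T = 0 ∨ ∀ u v d, s (u + d) * s (v + d) - s u * s v = s d * s (u + v + d))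
include hcont hzero hT

/-- The sum of the residues of a product of quotients `s (z - a j) / s (z - b j)`. -/
theorem residueSum_eq {I : Finset ι} (hI : I.Nonempty) {a b : ι → ℂ}
    (hb : ∀ i ∈ I, ∀ j ∈ I, i ≠ j → s (b i - b j) ≠ 0) (hab : ∑ i ∈ I, (b i - a i) = T) :
    residueSum s I a b = s T := by
  have hs0 : s 0 = 0 := by
    have := hodd 0
    rw [neg_zero] at this
    linear_combination this / 2
  obtain ⟨n, hn⟩ : ∃ n, I.card = n + 1 :=
    ⟨I.card - 1, (Nat.succ_pred_eq_of_pos (Finset.card_pos.2 hI)).symm⟩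
  clear hI
  induction n generalizing I a b with
  | zero =>
    obtain ⟨p, rfl⟩ := Finset.card_eq_one.1 hn
    rw [Finset.sum_singleton] at hab
    simp [residueSum, hab]
  | succ n ih =>
    obtain ⟨p, I', hp, rfl, hI'⟩ := Finset.card_eq_succ.1 hn
    obtain ⟨q, J, hq, rfl, hJ⟩ := Finset.card_eq_succ.1 hI'
    have hpq : p ≠ q := fun h => hp (by simp [h])
    have hpJ : p ∉ J := fun h => hp (by simp [h])
    have hbpq : s (b p - b q) ≠ 0 := hb p (by simp) q (by simp) hpq
    -- Both smaller sums equal `s(T)` by induction, so their coefficients must recombine after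
    -- multiplication by `s(T)`. For `T = 0` this is trivial since `s(0) = 0`; otherwise it is the
    -- addition identity in `hT`.
    have hAB (a : ι → ℂ) : (s (b p - a p) * s (b p - a q) - s (b q - a p) * s (b q - a q)) * s T =
        s (b p + b q - a p - a q) * s (b p - b q) * s T := by
      rcases hT with rfl | hT
      · rw [hs0, mul_zero, mul_zero]
      · have := hT (b q - a p) (b q - a q) (b p - b q)
        rw [show b q - a p + (b p - b q) = b p - a p by ring,
          show b q - a q + (b p - b q) = b p - a q by ring,
          show b q - a p + (b q - a q) + (b p - b q) = b p + b q - a p - a q by ring] at this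
        rw [this]; ring
    have generic (a : ι → ℂ) (hab : ∑ i ∈ insert p (insert q J), (b i - a i) = T)
        (he : s (b p + b q - a p - a q) ≠ 0) :
        residueSum s (insert p (insert q J)) a b = s T := by
      rw [Finset.sum_insert hp, Finset.sum_insert hq] at hab
      have hstep := residueSum_step hodd hthree hpJ hq hpq a b hb
      have ih1 := ih (I := insert p J) (a := Function.update a p (a p + a q - b q)) (b := b)
        (fun i hi j hj => hb i (by simp at hi ⊢; tauto) j (by simp at hj ⊢; tauto)) (by
          rw [Finset.sum_insert hpJ, Function.update_self, ← hab, Finset.sum_congr rfl fun i hi => by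
            rw [Function.update_of_ne (ne_of_mem_of_not_mem hi hpJ)]]
          ring) (by rw [Finset.card_insert_of_notMem hpJ, hJ])
      have ih2 := ih (I := insert q J) (a := Function.update a q (a p + a q - b p)) (b := b)
        (fun i hi j hj => hb i (by simp at hi ⊢; tauto) j (by simp at hj ⊢; tauto)) (by
          rw [Finset.sum_insert hq, Function.update_self, ← hab, Finset.sum_congr rfl fun i hi => by
            rw [Function.update_of_ne (ne_of_mem_of_not_mem hi hq)]]
          ring) (by rw [Finset.card_insert_of_notMem hq, hJ])
      rw [ih1, ih2, ← sub_mul, hAB a] at hstep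
      exact mul_left_cancel₀ (mul_ne_zero he hbpq) hstep
    -- The induction step divides by `s(b_p + b_q - a_p - a_q)`. With two poles this argument is `T`
    -- itself, and its vanishing has to be treated by hand.
    rcases J.eq_empty_or_nonempty with rfl | ⟨k, hk⟩
    · rw [Finset.sum_insert hp, Finset.sum_insert hq, Finset.sum_empty, add_zero] at hab
      by_cases he : s (b p + b q - a p - a q) = 0
      · have hT0 : b p + b q - a p - a q = T := by rw [← hab]; ring
        have hAB' : s (b p - a p) * s (b p - a q) - s (b q - a p) * s (b q - a q) = 0 := by
          rcases hT with rfl | hT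
          · rw [show b p - a p = -(b q - a q) by linear_combination hT0,
              show b p - a q = -(b q - a p) by linear_combination hT0, hodd, hodd]
            ring
          · have := hT (b q - a p) (b q - a q) (b p - b q)
            rw [show b q - a p + (b p - b q) = b p - a p by ring,
              show b q - a q + (b p - b q) = b p - a q by ring,
              show b q - a p + (b q - a q) + (b p - b q) = b p + b q - a p - a q by ring, he,
              mul_zero] at this
            exact this
        rw [← hT0, he, residueSum_insert s hp]
        have hbqp : s (b q - b p) = -s (b p - b q) := by rw [← hodd, neg_sub]
        simp only [insert_empty_eq, Finset.prod_singleton, Finset.sum_singleton,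
          Finset.erase_singleton, Finset.prod_empty, mul_one, hbqp]
        field_simp
        linear_combination hAB'
      · exact generic a (by
          rw [Finset.sum_insert hp, Finset.sum_insert hq, Finset.sum_empty, add_zero, hab]) he
    · have hkp : k ≠ p := fun h => hpJ (h ▸ hk)
      have hkq : k ≠ q := fun h => hq (h ▸ hk)
      -- With a third index `k` available, moving the zero `a_q` by `t` and `a_k` by `-t` keeps the
      -- total sum and makes the divisor nonzero for all but countably many `t`; continuity then
      -- gives `t = 0`.
      set φ : ℂ → ι → ℂ := fun t i => a i + (if i = q then t else 0) - (if i = k then t else 0)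
        with hφ
      have hcount : {t : ℂ | s (b p + b q - a p - a q - t) = 0}.Countable :=
        hzero.preimage (f := fun t : ℂ => b p + b q - a p - a q - t) sub_right_injective
      have hc1 : Continuous fun t => residueSum s (insert p (insert q J)) (φ t) b := by
        refine continuous_finsetSum _ fun i _ => Continuous.div_const ?_ _
        refine continuous_finsetProd _ fun j _ => hcont.comp ?_
        simp only [hφ]
        split_ifs <;> fun_prop
      have hext := Continuous.ext_on (hcount.dense_compl ℂ) hc1 (continuous_const (y := s T))
        (fun t ht => by
          refine generic (φ t) ?_ ?_
          · rw [← hab]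
            simp only [hφ]
            simp only [sub_eq_add_neg, neg_add, Finset.sum_add_distrib, Finset.sum_neg_distrib,
              neg_neg, Finset.sum_ite_eq']
            simp [hk]
          · have : b p + b q - φ t p - φ t q = b p + b q - a p - a q - t := by
              simp [hφ, hpq, hkp.symm, hkq.symm]
              ring
            rw [this]
            exact ht)
      have h0 := congrFun hext 0
      simpa [hφ] using h0

end Residue

namespace Model

variable {c : Model} (hc : c.Positive)
include hc

/-- Here `s(u) s(v)` is a function of `u - v` minus a function of `u + v`, and a common shift
affects only the latter. This identity replaces the balancing condition in cases (I)–(III). -/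
lemma s_mul_sub_s_mul (hell : ¬c.IsElliptic) (u v d : ℂ) :
    c.s (u + d) * c.s (v + d) - c.s u * c.s v = c.s d * c.s (u + v + d) := by
  cases c with
  | rational => simp only [s]; ring
  | trigonometric r =>
    simp only [s, mul_add, Complex.sin_add, Complex.cos_add]
    linear_combination (1 / r) ^ 2 * sin (r * u) * sin (r * v) * Complex.sin_sq_add_cos_sq (r * d)
  | hyperbolic a =>
    simp only [s, mul_add, add_div, Complex.sinh_add, Complex.cosh_add]
    linear_combination (a / Real.pi) ^ 2 * sinh (Real.pi * u / a) * sinh (Real.pi * v / a) *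
      Complex.cosh_sq_sub_sinh_sq (Real.pi * d / a)
  | elliptic r a => exact absurd trivial hell

/-- Outside the elliptic case `s(x + z) s(x - z) = s(x)² - s(z)²`, which makes the relation a
polynomial identity in the four squares. -/
lemma s_three_term (x y z w : ℂ) :
    c.s (x + z) * c.s (x - z) * (c.s (y + w) * c.s (y - w)) =
      c.s (x + w) * c.s (x - w) * (c.s (y + z) * c.s (y - z)) -
        c.s (x + y) * c.s (x - y) * (c.s (w + z) * c.s (w - z)) := by
  by_cases hell : c.IsElliptic
  · cases c with
    | elliptic r a => exact elliptic_s_three_term hc.1 hc.2 x y z w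
    | _ => exact hell.elim
  · have h (x z : ℂ) : c.s (x + z) * c.s (x - z) = c.s x ^ 2 - c.s z ^ 2 := by
      have := s_mul_sub_s_mul hc hell z z (x - z)
      rw [add_sub_cancel, show z + z + (x - z) = x + z by ring] at this
      linear_combination -this
    simp only [h]
    ring

lemma countable_s_zeros : {u | c.s u = 0}.Countable :=
  (countable_Omega c).mono fun _ hu => mem_Omega_of_s_eq_zero hc hu

lemma sum_omega_of_isElliptic (hell : c.IsElliptic) : ∑ ν, c.omega ν = 0 := by
  cases c with
  | elliptic r a =>
    change ∑ ν : Fin 4, (![0, Real.pi / r, I * a, -(Real.pi / r) - I * a] : Fin 4 → ℂ) ν = 0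
    simp [Fin.sum_univ_four]
  | _ => exact hell.elim

theorem residueSum_s {ι : Type*} [DecidableEq ι] {I : Finset ι} (hI : I.Nonempty) {a b : ι → ℂ}
    (hb : ∀ i ∈ I, ∀ j ∈ I, i ≠ j → c.s (b i - b j) ≠ 0)
    (hell : c.IsElliptic → ∑ i ∈ I, (b i - a i) = 0) :
    residueSum c.s I a b = c.s (∑ i ∈ I, (b i - a i)) :=
  residueSum_eq (s_neg hc) (s_three_term hc) (differentiable_s hc).continuous
    (countable_s_zeros hc) (by
      by_cases h : c.IsElliptic
      · exact .inl (hell h)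
      · exact .inr (s_mul_sub_s_mul hc h)) hI hb rfl

end Model

end DeformedVanDiejen

end


noncomputable section

namespace DeformedVanDiejen

/-! ### The coefficients in terms of a single function -/

@[simp] lemma sg_one : sg 1 = 1 := by simp [sg]

@[simp] lemma sg_neg_one : sg (-1) = -1 := by simp [sg]

lemma prod_units {α : Type*} [CommMonoid α] (f : ℤˣ → α) : ∏ δ, f δ = f 1 * f (-1) := by
  rw [show (Finset.univ : Finset ℤˣ) = {1, -1} from rfl, Finset.prod_pair (by decide)]

/-- The factor `s(z - w - u) s(z + w - u) / (s(z - w - v) s(z + w - v))`. -/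
def pairRatio (s : ℂ → ℂ) (w u v z : ℂ) : ℂ :=
  s (z - w - u) * s (z + w - u) / (s (z - w - v) * s (z + w - v))

/-- The product `∏ ν, s(z - i g_ν β)`. -/
def gProd (c : Model) (g : Fin (2 * c.rho + 2) → ℝ) (β : ℝ) (z : ℂ) : ℂ :=
  ∏ ν, c.s (z - I * g ν * β)

section

variable {c : Model} (hc : c.Positive) {N M : ℕ} (g : Fin (2 * c.rho + 2) → ℝ) (lam β : ℝ)
  (x : Fin N → ℂ) (y : Fin M → ℂ)

/-- The factor of the `j`-th variable `x`. -/
def xRatio (c : Model) (lam β : ℝ) (w z : ℂ) : ℂ := pairRatio c.s w (I * lam * β) 0 z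

/-- The factor of the `k`-th variable `y`. -/
def yRatio (c : Model) (lam β : ℝ) (w z : ℂ) : ℂ :=
  pairRatio c.s w (I * (lam - 1) * β / 2) (I * (lam + 1) * β / 2) z

include hc

/-- By oddness of `s` the sign `ε` can be absorbed into the variable: both coefficients are values
of one expression at `z = ε x_j`, which will be recognised as a residue. -/
lemma V_eq (ε : ℤˣ) (j : Fin N) :
    V c g lam β ε j x y = gProd c g β (sg ε * x j) /
      (c.s (2 * (sg ε * x j)) * c.s (2 * (sg ε * x j) - I * β)) *
      ((∏ j' ∈ Finset.univ.erase j, xRatio c lam β (x j') (sg ε * x j)) *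
        ∏ k, yRatio c lam β (y k) (sg ε * x j)) := by
  have hs := Model.s_neg hc
  unfold V gProd
  rw [prod_units, mul_mul_mul_comm, ← Finset.prod_mul_distrib, ← Finset.prod_mul_distrib,
    mul_left_comm 2 (sg ε)]
  congr 2
  · refine Finset.prod_congr rfl fun j' _ => ?_
    unfold xRatio pairRatio
    rcases Int.units_eq_one_or ε with rfl | rfl
    · simp only [sg_one, sg_neg_one, sub_zero, one_mul, div_mul_div_comm, neg_mul,
        ← sub_eq_add_neg]
      rw [mul_comm (c.s (x j - x j' - _)), mul_comm (c.s (x j - x j'))]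
    · simp only [sg_one, sg_neg_one, sub_zero, one_mul, div_mul_div_comm, neg_mul,
        ← sub_eq_add_neg, sub_neg_eq_add]
      rw [show -x j - x j' - I * lam * β = -(x j + x j' + I * lam * β) by ring,
        show -x j + x j' - I * lam * β = -(x j - x j' + I * lam * β) by ring,
        show -x j - x j' = -(x j + x j') by ring, show -x j + x j' = -(x j - x j') by ring]
      simp only [hs, neg_mul_neg]
  · refine Finset.prod_congr rfl fun k _ => ?_
    unfold yRatio pairRatio
    rcases Int.units_eq_one_or ε with rfl | rfl
    · simp only [sg_one, sg_neg_one, one_mul, div_mul_div_comm, neg_mul, ← sub_eq_add_neg]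
      rw [mul_comm (c.s (x j - y k - _)), mul_comm (c.s (x j - y k - I * (lam + 1) * β / 2))]
    · simp only [sg_one, sg_neg_one, one_mul, div_mul_div_comm, neg_mul, ← sub_eq_add_neg,
        sub_neg_eq_add]
      rw [show -x j - y k - I * (lam - 1) * β / 2 = -(x j + y k + I * (lam - 1) * β / 2) by ring,
        show -x j + y k - I * (lam - 1) * β / 2 = -(x j - y k + I * (lam - 1) * β / 2) by ring,
        show -x j - y k - I * (lam + 1) * β / 2 = -(x j + y k + I * (lam + 1) * β / 2) by ring,
        show -x j + y k - I * (lam + 1) * β / 2 = -(x j - y k + I * (lam + 1) * β / 2) by ring]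
      simp only [hs, neg_mul_neg]

/-- After the shift by `i(λ+1)β/2` the factors are the functions `xRatio`, `yRatio` and `gProd` that
already occur in `V`. So `V` and `Ṽ` belong to different poles of the same function. -/
lemma Vt_eq (ε : ℤˣ) (k : Fin M) :
    Vt c g lam β ε k x y = gProd c g β (sg ε * y k + I * (lam + 1) * β / 2) /
      (c.s (2 * (sg ε * y k)) * c.s (2 * (sg ε * y k) + I * lam * β)) *
      ((∏ k' ∈ Finset.univ.erase k,
          yRatio c lam β (y k') (sg ε * y k + I * (lam + 1) * β / 2)) *
        ∏ j, xRatio c lam β (x j) (sg ε * y k + I * (lam + 1) * β / 2)) := by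
  have hs := Model.s_neg hc
  unfold Vt gProd
  rw [prod_units, mul_mul_mul_comm, ← Finset.prod_mul_distrib, ← Finset.prod_mul_distrib,
    mul_left_comm 2 (sg ε)]
  congr 2
  · refine Finset.prod_congr rfl fun ν _ => ?_
    ring_nf
  · refine Finset.prod_congr rfl fun k' _ => ?_
    unfold yRatio pairRatio
    rw [show sg ε * y k + I * (lam + 1) * β / 2 - y k' - I * (lam - 1) * β / 2 =
        sg ε * y k - y k' + I * β by ring,
      show sg ε * y k + I * (lam + 1) * β / 2 + y k' - I * (lam - 1) * β / 2 =
        sg ε * y k + y k' + I * β by ring,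
      show sg ε * y k + I * (lam + 1) * β / 2 - y k' - I * (lam + 1) * β / 2 =
        sg ε * y k - y k' by ring,
      show sg ε * y k + I * (lam + 1) * β / 2 + y k' - I * (lam + 1) * β / 2 =
        sg ε * y k + y k' by ring]
    rcases Int.units_eq_one_or ε with rfl | rfl
    · simp only [sg_one, sg_neg_one, one_mul, div_mul_div_comm, neg_mul, ← sub_eq_add_neg]
      rw [mul_comm (c.s (y k - y k' + _)), mul_comm (c.s (y k - y k'))]
    · simp only [sg_one, sg_neg_one, one_mul, div_mul_div_comm, neg_mul, ← sub_eq_add_neg]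
      rw [show -y k - y k' + I * β = -(y k + y k' - I * β) by ring,
        show -y k + y k' + I * β = -(y k - y k' - I * β) by ring,
        show -y k - y k' = -(y k + y k') by ring, show -y k + y k' = -(y k - y k') by ring]
      simp only [hs, neg_mul_neg]
  · refine Finset.prod_congr rfl fun j _ => ?_
    unfold xRatio pairRatio
    rw [show sg ε * y k + I * (lam + 1) * β / 2 - x j - I * lam * β =
        sg ε * y k - x j - I * (lam - 1) * β / 2 by ring,
      show sg ε * y k + I * (lam + 1) * β / 2 + x j - I * lam * β =
        sg ε * y k + x j - I * (lam - 1) * β / 2 by ring,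
      show sg ε * y k + I * (lam + 1) * β / 2 - x j - 0 =
        sg ε * y k - x j + I * (lam + 1) * β / 2 by ring,
      show sg ε * y k + I * (lam + 1) * β / 2 + x j - 0 =
        sg ε * y k + x j + I * (lam + 1) * β / 2 by ring]
    rcases Int.units_eq_one_or ε with rfl | rfl
    · simp only [sg_one, sg_neg_one, one_mul, div_mul_div_comm, neg_mul, ← sub_eq_add_neg]
      rw [mul_comm (c.s (y k - x j - _)), mul_comm (c.s (y k - x j + I * (lam + 1) * β / 2))]
    · simp only [sg_one, sg_neg_one, one_mul, div_mul_div_comm, neg_mul, ← sub_eq_add_neg,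
        sub_neg_eq_add]
      rw [show -y k - x j - I * (lam - 1) * β / 2 = -(y k + x j + I * (lam - 1) * β / 2) by ring,
        show -y k + x j - I * (lam - 1) * β / 2 = -(y k - x j + I * (lam - 1) * β / 2) by ring,
        show -y k - x j + I * (lam + 1) * β / 2 = -(y k + x j - I * (lam + 1) * β / 2) by ring,
        show -y k + x j + I * (lam + 1) * β / 2 = -(y k - x j - I * (lam + 1) * β / 2) by ring]
      simp only [hs, neg_mul_neg]

omit hc in
lemma V0_eq :
    V0 c g lam β x y = -(c.prefactor *
      ∑ ν, exp (-(c.rXi ν *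
          (2 * lam * N - 2 * M + ∑ μ, g μ - 1 / 2 * (c.rho + 1) * (lam + 1)) * β)) /
        (∏ μ ∈ Finset.univ.erase ν, c.s ((c.omega ν - c.omega μ) / 2)) *
      (gProd c g β (c.omega ν / 2 + I * β / 2) /
        ∏ μ, c.s ((c.omega ν - c.omega μ + I * (1 - lam) * β) / 2)) *
      ((∏ j, xRatio c lam β (x j) (c.omega ν / 2 + I * β / 2)) *
        ∏ k, yRatio c lam β (y k) (c.omega ν / 2 + I * β / 2))) := by
  unfold V0 gProd
  congr 2
  refine Finset.sum_congr rfl fun ν _ => ?_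
  congr 1
  rw [prod_units, mul_mul_mul_comm, ← Finset.prod_mul_distrib, ← Finset.prod_mul_distrib]
  congr 1
  · refine Finset.prod_congr rfl fun j _ => ?_
    unfold xRatio pairRatio
    simp only [sg_one, sg_neg_one, sub_zero, one_mul, div_mul_div_comm, neg_mul]
    rw [mul_comm (c.s (_ - x j - _)), mul_comm (c.s (_ - x j))]
    congr 3 <;> ring
  · refine Finset.prod_congr rfl fun k _ => ?_
    unfold yRatio pairRatio
    simp only [sg_one, sg_neg_one, one_mul, div_mul_div_comm, neg_mul]
    rw [mul_comm (c.s (_ - y k - _)), mul_comm (c.s (_ - y k - I * (lam + 1) * β / 2))]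
    congr 3 <;> ring

end

/-! ### The poles -/

section Poles

/-- Labels of the poles. -/
abbrev PoleIndex (c : Model) (N M : ℕ) : Type :=
  (ℤˣ × Fin N) ⊕ (ℤˣ × Fin M) ⊕ Fin (c.rho + 1) ⊕ Fin (c.rho + 1)

/-- The two halves of the range of indices of the `g_ν`. -/
def gIndex (c : Model) : Fin (c.rho + 1) ⊕ Fin (c.rho + 1) ≃ Fin (2 * c.rho + 2) :=
  finSumFinEquiv.trans (finCongr (by omega))

variable (c : Model) {N M : ℕ} (g : Fin (2 * c.rho + 2) → ℝ) (lam β : ℝ)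
  (x : Fin N → ℂ) (y : Fin M → ℂ)

/-- The poles of the function whose residues are the coefficients. -/
def pole : PoleIndex c N M → ℂ
  | .inl (ε, j) => sg ε * x j
  | .inr (.inl (ε, k)) => sg ε * y k + I * (lam + 1) * β / 2
  | .inr (.inr (.inl ν)) => c.omega ν / 2 + I * β / 2
  | .inr (.inr (.inr ν)) => c.omega ν / 2 + I * lam * β / 2

/-- The zeros of the function whose residues are the coefficients. -/
def zero : PoleIndex c N M → ℂ
  | .inl (ε, j) => sg ε * x j + I * lam * β
  | .inr (.inl (ε, k)) => sg ε * y k + I * (lam - 1) * β / 2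
  | .inr (.inr ν) => I * g (gIndex c ν) * β

/-- Each pair `± x_j` contributes `-2iλβ`, each pair `± y_k` contributes `2iβ`, and each half-period
occurs twice. The total is minus the argument of `s` in the eigenvalue; under balancing it vanishes
in the elliptic case, where `∑ ω_ν = 0`. -/
lemma sum_pole_sub_zero :
    ∑ i, (pole c lam β x y i - zero c g lam β x y i) =
      -(I * β * (2 * lam * N - 2 * M + ∑ ν, g ν - 1 / 2 * (c.rho + 1) * (lam + 1)) -
        ∑ ν, c.omega ν) := by
  have hg : ∑ ν, (g ν : ℂ) = ∑ ν, (g (gIndex c (.inl ν)) : ℂ) + ∑ ν, (g (gIndex c (.inr ν)) : ℂ) := by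
    rw [← Fintype.sum_sum_type fun i => (g (gIndex c i) : ℂ)]
    exact ((gIndex c).sum_comp fun i => (g i : ℂ)).symm
  rw [Fintype.sum_sum_type, Fintype.sum_sum_type, Fintype.sum_sum_type]
  have e1 : ∑ p : ℤˣ × Fin N, (pole c lam β x y (.inl p) - zero c g lam β x y (.inl p)) =
      -(2 * N * (I * lam * β)) := by
    have (p : ℤˣ × Fin N) : pole c lam β x y (.inl p) - zero c g lam β x y (.inl p) =
        -(I * lam * β) := by
      obtain ⟨ε, j⟩ := p; simp only [pole, zero]; ring
    simp only [this, Finset.sum_const, Finset.card_univ, Fintype.card_prod, Fintype.card_fin,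
      Fintype.card_units_int, nsmul_eq_mul]
    push_cast; ring
  have e2 : ∑ p : ℤˣ × Fin M, (pole c lam β x y (.inr (.inl p)) -
      zero c g lam β x y (.inr (.inl p))) = 2 * M * (I * β) := by
    have (p : ℤˣ × Fin M) : pole c lam β x y (.inr (.inl p)) -
        zero c g lam β x y (.inr (.inl p)) = I * β := by
      obtain ⟨ε, j⟩ := p; simp only [pole, zero]; ring
    simp only [this, Finset.sum_const, Finset.card_univ, Fintype.card_prod, Fintype.card_fin,
      Fintype.card_units_int, nsmul_eq_mul]
    push_cast; ring
  rw [e1, e2, Complex.ofReal_sum, hg]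
  simp only [pole, zero, Finset.sum_sub_distrib, Finset.sum_add_distrib, Finset.sum_const,
    Finset.card_univ, Fintype.card_fin, nsmul_eq_mul, ← Finset.sum_mul, ← Finset.mul_sum,
    ← Finset.sum_div]
  push_cast
  ring

end Poles

lemma prod_erase_inl {α β' γ : Type*} [Fintype α] [Fintype β'] [DecidableEq α] [DecidableEq β']
    [CommMonoid γ] (f : α ⊕ β' → γ) (a : α) :
    ∏ i ∈ Finset.univ.erase (.inl a), f i =
      (∏ i ∈ Finset.univ.erase a, f (.inl i)) * ∏ i, f (.inr i) := by
  rw [← Finset.prod_disjSum]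
  congr 1
  ext i
  rcases i with i | i <;> simp

lemma prod_erase_inr {α β' γ : Type*} [Fintype α] [Fintype β'] [DecidableEq α] [DecidableEq β']
    [CommMonoid γ] (f : α ⊕ β' → γ) (b : β') :
    ∏ i ∈ Finset.univ.erase (.inr b), f i =
      (∏ i, f (.inl i)) * ∏ i ∈ Finset.univ.erase b, f (.inr i) := by
  rw [← Finset.prod_disjSum]
  congr 1
  ext i
  rcases i with i | i <;> simp

lemma prod_erase_units_prod {n : ℕ} {γ : Type*} [CommMonoid γ] (f : ℤˣ × Fin n → γ) (ε : ℤˣ)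
    (j : Fin n) :
    ∏ i ∈ Finset.univ.erase (ε, j), f i =
      f (-ε, j) * ∏ j' ∈ Finset.univ.erase j, (f (1, j') * f (-1, j')) := by
  have e : (Finset.univ.erase (ε, j) : Finset (ℤˣ × Fin n)) =
      insert (-ε, j) ((Finset.univ : Finset ℤˣ) ×ˢ (Finset.univ.erase j)) := by
    ext ⟨δ, i⟩
    rcases Int.units_eq_one_or ε with rfl | rfl <;> rcases Int.units_eq_one_or δ with rfl | rfl <;>
      by_cases h : i = j <;> simp [h]
  rw [e, Finset.prod_insert (by simp), Finset.prod_product_right]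
  simp only [prod_units]

end DeformedVanDiejen

end


/-! ### Identification of the residues with the coefficients -/

noncomputable section

namespace DeformedVanDiejen

/-- Here `A` is `s(2εx_j - iλβ)`. It occurs once among the zeros, from the reflected variable, and
once among the poles at `ω_ν/2 + iλβ/2`; `L²` compensates the two duplication constants. -/
lemma residue_cancel_x {L A : ℂ} (hL : L ≠ 0) (hA : A ≠ 0) (S B C d e m n k : ℂ) :
    L ^ 2 * (-(S * A) * n * (m * k) / (C * d * (e * (L * B * (L * A))))) =
      -(S * (k / (C * B) * (n / d * (m / e)))) := by
  field_simp

lemma residue_cancel_y {L A : ℂ} (hL : L ≠ 0) (hA : A ≠ 0) (S B C d e m n k : ℂ) :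
    L ^ 2 * (n * (S * A * m * k) / (d * (C * e * (L * B * (L * A))))) =
      S * (k / (C * B) * (m / e * (n / d))) := by
  field_simp

section Residues

variable {c : Model} (hc : c.Positive) {N M : ℕ} (g : Fin (2 * c.rho + 2) → ℝ) (lam β : ℝ)
  (x : Fin N → ℂ) (y : Fin M → ℂ)

/-- The summand of index `i` of the residue identity. -/
def residueTerm (c : Model) (g : Fin (2 * c.rho + 2) → ℝ) (lam β : ℝ)
    (x : Fin N → ℂ) (y : Fin M → ℂ) (i : PoleIndex c N M) : ℂ :=
  (∏ j, c.s (pole c lam β x y i - zero c g lam β x y j)) /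
    ∏ j ∈ Finset.univ.erase i, c.s (pole c lam β x y i - pole c lam β x y j)

lemma prod_units_prod {n : ℕ} {γ : Type*} [CommMonoid γ] (f : ℤˣ × Fin n → γ) :
    ∏ i, f i = ∏ j, (f (1, j) * f (-1, j)) := by
  rw [Fintype.prod_prod_type_right]
  simp only [prod_units]

lemma prod_sub_zero (z : ℂ) :
    ∏ j, c.s (z - zero c g lam β x y j) =
      (∏ j, (c.s (z - x j - I * lam * β) * c.s (z + x j - I * lam * β))) *
      ((∏ k, (c.s (z - y k - I * (lam - 1) * β / 2) * c.s (z + y k - I * (lam - 1) * β / 2))) *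
        gProd c g β z) := by
  rw [Fintype.prod_sum_type, Fintype.prod_sum_type, prod_units_prod, prod_units_prod]
  congr 1
  · refine Finset.prod_congr rfl fun j _ => ?_
    simp only [zero, sg_one, sg_neg_one]
    ring_nf
  congr 1
  · refine Finset.prod_congr rfl fun j _ => ?_
    simp only [zero, sg_one, sg_neg_one]
    ring_nf
  · simp only [zero, gProd]
    exact (gIndex c).prod_comp fun ν => c.s (z - I * g ν * β)

lemma prod_sub_pole_x (z : ℂ) :
    ∏ p : ℤˣ × Fin N, c.s (z - pole c lam β x y (.inl p)) =
      ∏ j, (c.s (z - x j - 0) * c.s (z + x j - 0)) := by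
  rw [prod_units_prod]
  refine Finset.prod_congr rfl fun j _ => ?_
  simp only [pole, sg_one, sg_neg_one]
  ring_nf

lemma prod_sub_pole_y (z : ℂ) :
    ∏ p : ℤˣ × Fin M, c.s (z - pole c lam β x y (.inr (.inl p))) =
      ∏ k, (c.s (z - y k - I * (lam + 1) * β / 2) * c.s (z + y k - I * (lam + 1) * β / 2)) := by
  rw [prod_units_prod]
  refine Finset.prod_congr rfl fun j _ => ?_
  simp only [pole, sg_one, sg_neg_one]
  ring_nf

variable {L : ℂ} (hL : ∀ u, ∏ μ, c.s (u - c.omega μ / 2) = L * c.s (2 * u))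
include hL

lemma prod_sub_pole_omega (z : ℂ) :
    ∏ ν, c.s (z - pole c lam β x y (.inr (.inr (.inl ν)))) = L * c.s (2 * z - I * β) := by
  rw [show 2 * z - I * β = 2 * (z - I * β / 2) by ring, ← hL]
  refine Finset.prod_congr rfl fun ν _ => ?_
  simp only [pole]
  ring_nf

lemma prod_sub_pole_omega' (z : ℂ) :
    ∏ ν, c.s (z - pole c lam β x y (.inr (.inr (.inr ν)))) = L * c.s (2 * z - I * lam * β) := by
  rw [show 2 * z - I * lam * β = 2 * (z - I * lam * β / 2) by ring, ← hL]
  refine Finset.prod_congr rfl fun ν _ => ?_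
  simp only [pole]
  ring_nf

variable (hL0 : L ≠ 0)
include hc hL0

/-- The zeros attached to `± x_j` supply `-s(iλβ)` and the factor cancelled by the second family of
half-period poles; the first family and the pole at `-εx_j` give the denominator of `V`. -/
lemma residueTerm_x (ε : ℤˣ) (j : Fin N) (h : c.s (2 * (sg ε * x j) - I * lam * β) ≠ 0) :
    L ^ 2 * residueTerm c g lam β x y (.inl (ε, j)) =
      -(c.s (I * lam * β) * V c g lam β ε j x y) := by
  have hs := Model.s_neg hc
  rw [residueTerm, prod_sub_zero, prod_erase_inl, Fintype.prod_sum_type, Fintype.prod_sum_type,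
    prod_sub_pole_y, prod_sub_pole_omega lam β x y hL, prod_sub_pole_omega' lam β x y hL,
    prod_erase_units_prod, V_eq hc]
  have hz : pole c lam β x y (.inl (ε, j)) = sg ε * x j := rfl
  rw [hz]
  have e1 : ∏ j', (c.s (sg ε * x j - x j' - I * lam * β) * c.s (sg ε * x j + x j' - I * lam * β)) =
      -(c.s (I * lam * β) * c.s (2 * (sg ε * x j) - I * lam * β)) * ∏ j' ∈ Finset.univ.erase j,
        (c.s (sg ε * x j - x j' - I * lam * β) * c.s (sg ε * x j + x j' - I * lam * β)) := by
    rw [← Finset.mul_prod_erase _ _ (Finset.mem_univ j)]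
    congr 1
    rw [← neg_mul, ← hs]
    rcases Int.units_eq_one_or ε with rfl | rfl
    · simp only [sg_one]; ring_nf
    · simp only [sg_neg_one]
      rw [mul_comm]; ring_nf
  have e2 : c.s (sg ε * x j - pole c lam β x y (.inl (-ε, j))) = c.s (2 * (sg ε * x j)) := by
    rcases Int.units_eq_one_or ε with rfl | rfl
    · simp only [pole, sg_one, sg_neg_one]; ring_nf
    · simp only [pole, neg_neg, sg_one, sg_neg_one]; ring_nf
  have e3 : ∏ j' ∈ Finset.univ.erase j, (c.s (sg ε * x j - pole c lam β x y (.inl (1, j'))) *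
        c.s (sg ε * x j - pole c lam β x y (.inl (-1, j')))) =
      ∏ j' ∈ Finset.univ.erase j, (c.s (sg ε * x j - x j' - 0) * c.s (sg ε * x j + x j' - 0)) := by
    refine Finset.prod_congr rfl fun j _ => ?_
    simp only [pole, sg_one, sg_neg_one]
    ring_nf
  rw [e1, e2, e3]
  simp only [xRatio, yRatio, pairRatio, Finset.prod_div_distrib]
  exact residue_cancel_x hL0 h _ _ _ _ _ _ _ _

/-- At `εy_k + i(λ+1)β/2` the two families of half-period poles exchange their roles: the first
gives the denominator `s(2εy_k + iλβ)` and the second cancels `s(2εy_k + iβ)`. -/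
lemma residueTerm_y (ε : ℤˣ) (k : Fin M) (h : c.s (2 * (sg ε * y k) + I * β) ≠ 0) :
    L ^ 2 * residueTerm c g lam β x y (.inr (.inl (ε, k))) =
      c.s (I * β) * Vt c g lam β ε k x y := by
  have hs := Model.s_neg hc
  rw [residueTerm, prod_sub_zero, prod_erase_inr, prod_erase_inl, Fintype.prod_sum_type,
    prod_sub_pole_x, prod_sub_pole_omega lam β x y hL, prod_sub_pole_omega' lam β x y hL,
    prod_erase_units_prod, Vt_eq hc]
  have hz : pole c lam β x y (.inr (.inl (ε, k))) = sg ε * y k + I * (lam + 1) * β / 2 := rfl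
  rw [hz]
  set z := sg ε * y k + I * (lam + 1) * β / 2 with hzdef
  have e1 : ∏ j', (c.s (z - y j' - I * (lam - 1) * β / 2) *
        c.s (z + y j' - I * (lam - 1) * β / 2)) =
      (c.s (I * β) * c.s (2 * (sg ε * y k) + I * β)) * ∏ j' ∈ Finset.univ.erase k,
        (c.s (z - y j' - I * (lam - 1) * β / 2) * c.s (z + y j' - I * (lam - 1) * β / 2)) := by
    rw [← Finset.mul_prod_erase _ _ (Finset.mem_univ k)]
    congr 1
    rcases Int.units_eq_one_or ε with rfl | rfl
    · simp only [hzdef, sg_one]; ring_nf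
    · simp only [hzdef, sg_neg_one]
      rw [mul_comm]; ring_nf
  have e2 : c.s (z - pole c lam β x y (.inr (.inl (-ε, k)))) = c.s (2 * (sg ε * y k)) := by
    rcases Int.units_eq_one_or ε with rfl | rfl
    · simp only [hzdef, pole, sg_one, sg_neg_one]; ring_nf
    · simp only [hzdef, pole, neg_neg, sg_one, sg_neg_one]; ring_nf
  have e3 : ∏ j' ∈ Finset.univ.erase k, (c.s (z - pole c lam β x y (.inr (.inl (1, j')))) *
        c.s (z - pole c lam β x y (.inr (.inl (-1, j'))))) =
      ∏ j' ∈ Finset.univ.erase k, (c.s (z - y j' - I * (lam + 1) * β / 2) *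
        c.s (z + y j' - I * (lam + 1) * β / 2)) := by
    refine Finset.prod_congr rfl fun j _ => ?_
    simp only [pole, sg_one, sg_neg_one]
    ring_nf
  have e4 : 2 * z - I * β = 2 * (sg ε * y k) + I * lam * β := by rw [hzdef]; ring
  have e5 : 2 * z - I * lam * β = 2 * (sg ε * y k) + I * β := by rw [hzdef]; ring
  rw [e1, e2, e3, e4, e5]
  simp only [xRatio, yRatio, pairRatio, Finset.prod_div_distrib]
  exact residue_cancel_y hL0 h _ _ _ _ _ _ _ _

omit hL hL0 hc in
lemma residueTerm_omega (ν : Fin (c.rho + 1)) :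
    residueTerm c g lam β x y (.inr (.inr (.inl ν))) =
      1 / (∏ μ ∈ Finset.univ.erase ν, c.s ((c.omega ν - c.omega μ) / 2)) *
      (gProd c g β (c.omega ν / 2 + I * β / 2) /
        ∏ μ, c.s ((c.omega ν - c.omega μ + I * (1 - lam) * β) / 2)) *
      ((∏ j, xRatio c lam β (x j) (c.omega ν / 2 + I * β / 2)) *
        ∏ k, yRatio c lam β (y k) (c.omega ν / 2 + I * β / 2)) := by
  rw [residueTerm, prod_sub_zero, prod_erase_inr, prod_erase_inr, prod_erase_inl,
    prod_sub_pole_x, prod_sub_pole_y]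
  have hz : pole c lam β x y (.inr (.inr (.inl ν))) = c.omega ν / 2 + I * β / 2 := rfl
  rw [hz]
  have e1 : ∏ μ ∈ Finset.univ.erase ν,
      c.s (c.omega ν / 2 + I * β / 2 - pole c lam β x y (.inr (.inr (.inl μ)))) =
      ∏ μ ∈ Finset.univ.erase ν, c.s ((c.omega ν - c.omega μ) / 2) := by
    refine Finset.prod_congr rfl fun μ _ => ?_
    simp only [pole]
    ring_nf
  have e2 : ∏ μ, c.s (c.omega ν / 2 + I * β / 2 - pole c lam β x y (.inr (.inr (.inr μ)))) =
      ∏ μ, c.s ((c.omega ν - c.omega μ + I * (1 - lam) * β) / 2) := by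
    refine Finset.prod_congr rfl fun μ _ => ?_
    simp only [pole]
    ring_nf
  rw [e1, e2]
  simp only [xRatio, yRatio, pairRatio, Finset.prod_div_distrib]
  field_simp

omit hL hL0 hc in
lemma residueTerm_omega' (ν : Fin (c.rho + 1)) :
    residueTerm c g lam β x y (.inr (.inr (.inr ν))) =
      1 / (∏ μ ∈ Finset.univ.erase ν, c.s ((c.omega ν - c.omega μ) / 2)) *
      (gProd c g β (c.omega ν / 2 + I * lam * β / 2) /
        ∏ μ, c.s ((c.omega ν - c.omega μ + I * (lam - 1) * β) / 2)) *
      ((∏ j, xRatio c lam β (x j) (c.omega ν / 2 + I * lam * β / 2)) *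
        ∏ k, yRatio c lam β (y k) (c.omega ν / 2 + I * lam * β / 2)) := by
  rw [residueTerm, prod_sub_zero, prod_erase_inr, prod_erase_inr, prod_erase_inr,
    prod_sub_pole_x, prod_sub_pole_y]
  have hz : pole c lam β x y (.inr (.inr (.inr ν))) = c.omega ν / 2 + I * lam * β / 2 := rfl
  rw [hz]
  have e1 : ∏ μ ∈ Finset.univ.erase ν,
      c.s (c.omega ν / 2 + I * lam * β / 2 - pole c lam β x y (.inr (.inr (.inr μ)))) =
      ∏ μ ∈ Finset.univ.erase ν, c.s ((c.omega ν - c.omega μ) / 2) := by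
    refine Finset.prod_congr rfl fun μ _ => ?_
    simp only [pole]
    ring_nf
  have e2 : ∏ μ, c.s (c.omega ν / 2 + I * lam * β / 2 - pole c lam β x y (.inr (.inr (.inl μ)))) =
      ∏ μ, c.s ((c.omega ν - c.omega μ + I * (lam - 1) * β) / 2) := by
    refine Finset.prod_congr rfl fun μ _ => ?_
    simp only [pole]
    ring_nf
  rw [e1, e2]
  simp only [xRatio, yRatio, pairRatio, Finset.prod_div_distrib]
  field_simp

end Residues

/-! ### Reflection in half-periods and nonvanishing -/

namespace Model

variable {c : Model} (hc : c.Positive)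
include hc

/-- At the points `ω_ν/2 + u` the factors of the variables are constant. -/
lemma pairRatio_half_omega (ν : Fin (c.rho + 1)) (w u v : ℂ) (z : ℂ)
    (hz : z - u - c.omega ν / 2 = -(z - v - c.omega ν / 2))
    (h1 : c.s (z - w - v) ≠ 0) (h2 : c.s (z + w - v) ≠ 0) :
    pairRatio c.s w u v z = exp (4 * I * c.rXi ν * (z - u - c.omega ν / 2)) := by
  obtain ⟨σ, hσ, h⟩ := s_half_omega_add hc ν
  have hσ2 : σ ^ 2 = 1 := by rcases hσ with rfl | rfl <;> norm_num
  -- By `hz` the reflection in `ω_ν/2` takes each numerator argument to the denominator argument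
  -- with the opposite sign of `w`. All dependence on `w` cancels and the sign `σ` enters squared.
  have e1 := h (z - u - c.omega ν / 2 - w)
  have e2 := h (z - u - c.omega ν / 2 + w)
  rw [show c.omega ν / 2 + (z - u - c.omega ν / 2 - w) = z - w - u by ring,
    show c.omega ν / 2 - (z - u - c.omega ν / 2 - w) = z + w - v by
      linear_combination -hz] at e1
  rw [show c.omega ν / 2 + (z - u - c.omega ν / 2 + w) = z + w - u by ring,
    show c.omega ν / 2 - (z - u - c.omega ν / 2 + w) = z - w - v by
      linear_combination -hz] at e2
  have e3 : exp (2 * I * c.rXi ν * (z - u - c.omega ν / 2 - w)) *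
      exp (2 * I * c.rXi ν * (z - u - c.omega ν / 2 + w)) =
      exp (4 * I * c.rXi ν * (z - u - c.omega ν / 2)) := by
    rw [← Complex.exp_add]; congr 1; ring
  rw [pairRatio, e1, e2, ← e3]
  field_simp
  linear_combination hσ2

/-- For `L = 0` the product would vanish identically, although the zeros of its factors form a
countable set. -/
lemma duplication_ne_zero {L : ℂ}
    (hL : ∀ u, ∏ μ, c.s (u - c.omega μ / 2) = L * c.s (2 * u)) : L ≠ 0 := by
  rintro rfl
  have hcount : (⋃ μ, {u : ℂ | c.s (u - c.omega μ / 2) = 0}).Countable :=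
    Set.countable_iUnion fun μ =>
      (countable_s_zeros hc).preimage (f := fun u : ℂ => u - c.omega μ / 2) (sub_left_injective)
  obtain ⟨u, hu⟩ := (hcount.dense_compl ℂ).nonempty
  refine hu ?_
  have := hL u
  rw [zero_mul, Finset.prod_eq_zero_iff] at this
  obtain ⟨μ, -, h⟩ := this
  exact Set.mem_iUnion.2 ⟨μ, h⟩

lemma s_sub_half_omega_ne_zero {L : ℂ}
    (hL : ∀ u, ∏ μ, c.s (u - c.omega μ / 2) = L * c.s (2 * u)) {u : ℂ} (hu : c.s (2 * u) ≠ 0)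
    (μ : Fin (c.rho + 1)) : c.s (u - c.omega μ / 2) ≠ 0 := by
  have h : ∏ μ, c.s (u - c.omega μ / 2) ≠ 0 := by
    rw [hL]; exact mul_ne_zero (duplication_ne_zero hc hL) hu
  exact Finset.prod_ne_zero_iff.1 h μ (Finset.mem_univ μ)

lemma s_half_omega_sub_ne_zero {ν μ : Fin (c.rho + 1)} (h : ν ≠ μ) :
    c.s ((c.omega ν - c.omega μ) / 2) ≠ 0 := by
  obtain ⟨L, -, hL⟩ := exists_duplication hc
  obtain ⟨σ, hσ, -, h2⟩ := prod_erase_half_omega_sub hc hL ν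
  have hσ0 : σ ≠ 0 := by rcases hσ with rfl | rfl <;> norm_num
  have h3 : ∏ μ ∈ Finset.univ.erase ν, c.s ((c.omega ν - c.omega μ) / 2) ≠ 0 := by
    rw [h2]
    exact mul_ne_zero (mul_ne_zero two_ne_zero (duplication_ne_zero hc hL))
      (mul_ne_zero hσ0 (exp_ne_zero _))
  exact Finset.prod_ne_zero_iff.1 h3 μ (by simp [h.symm])

end Model

end DeformedVanDiejen

end


/-! ### The eigenvalue identity at generic points -/

noncomputable section

namespace DeformedVanDiejen

namespace Model

variable {c : Model}

lemma rXi_eq_zero (h : ¬c.IsElliptic) (ν : Fin (c.rho + 1)) : c.rXi ν = 0 := by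
  cases c with
  | rational =>
    revert ν
    change ∀ ν : Fin 1, _
    intro ν
    fin_cases ν
    rfl
  | trigonometric r =>
    revert ν
    change ∀ ν : Fin 2, _
    intro ν
    fin_cases ν <;> rfl
  | hyperbolic a =>
    revert ν
    change ∀ ν : Fin 2, _
    intro ν
    fin_cases ν <;> rfl
  | elliptic r a => exact absurd trivial h

lemma rho_of_isElliptic (h : c.IsElliptic) : c.rho = 3 := by
  cases c with
  | elliptic r a => rfl
  | _ => exact h.elim

end Model

section Generic

variable {c : Model} (hc : c.Positive) {N M : ℕ} (g : Fin (2 * c.rho + 2) → ℝ) (lam β : ℝ)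

/-- No denominator in the coefficients vanishes, in terms of the values of `s`. -/
structure NonSingular (c : Model) {N M : ℕ} (lam β : ℝ) (x : Fin N → ℂ) (y : Fin M → ℂ) : Prop where
  x_double : ∀ j, c.s (2 * x j) ≠ 0
  x_shift : ∀ j (ε : ℤˣ), c.s (2 * x j + sg ε * (I * β)) ≠ 0
  y_double : ∀ k, c.s (2 * y k) ≠ 0
  y_shift : ∀ k (ε : ℤˣ), c.s (2 * y k + sg ε * (I * lam * β)) ≠ 0
  x_pair : ∀ j j', j ≠ j' → ∀ δ : ℤˣ, c.s (x j + sg δ * x j') ≠ 0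
  y_pair : ∀ k k', k ≠ k' → ∀ δ : ℤˣ, c.s (y k + sg δ * y k') ≠ 0
  xy_pair : ∀ j k (ε δ : ℤˣ), c.s (x j + sg δ * y k + sg ε * (I * (lam + 1) * β / 2)) ≠ 0

/-- All the poles are distinct. -/
structure Generic (c : Model) {N M : ℕ} (lam β : ℝ) (x : Fin N → ℂ) (y : Fin M → ℂ) : Prop
    extends NonSingular c lam β x y where
  x_generic : ∀ j (ε : ℤˣ), c.s (2 * x j + sg ε * (I * lam * β)) ≠ 0
  y_generic : ∀ k (ε : ℤˣ), c.s (2 * y k + sg ε * (I * β)) ≠ 0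

variable {lam β} {x : Fin N → ℂ} {y : Fin M → ℂ}

include hc

lemma s_neg_ne_zero {u v : ℂ} (h : c.s u ≠ 0) (huv : v = u ∨ v = -u) : c.s v ≠ 0 := by
  rcases huv with rfl | rfl
  · exact h
  · rw [Model.s_neg hc]; exact neg_ne_zero.2 h

lemma s_signed_double_ne_zero {w u : ℂ} (h : ∀ ε : ℤˣ, c.s (2 * w + sg ε * u) ≠ 0) (ε : ℤˣ)
    {v : ℂ} (hv : v = u ∨ v = -u) : c.s (2 * (sg ε * w) + v) ≠ 0 := by
  have h1 := h 1
  have h2 := h (-1)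
  rw [sg_one] at h1
  rw [sg_neg_one] at h2
  rcases Int.units_eq_one_or ε with rfl | rfl <;> rcases hv with rfl | rfl
  · exact s_neg_ne_zero hc h1 (.inl (by simp only [sg_one]; ring))
  · exact s_neg_ne_zero hc h2 (.inl (by simp only [sg_one]; ring))
  · exact s_neg_ne_zero hc h2 (.inr (by simp only [sg_neg_one]; ring))
  · exact s_neg_ne_zero hc h1 (.inr (by simp only [sg_neg_one]; ring))

lemma s_signed_pair_ne_zero {w w' : ℂ} (h : ∀ δ : ℤˣ, c.s (w + sg δ * w') ≠ 0) (ε ε' : ℤˣ) :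
    c.s (sg ε * w - sg ε' * w') ≠ 0 := by
  have h1 := h 1
  have h2 := h (-1)
  rw [sg_one] at h1
  rw [sg_neg_one] at h2
  rcases Int.units_eq_one_or ε with rfl | rfl <;> rcases Int.units_eq_one_or ε' with rfl | rfl <;>
    simp only [sg_one, sg_neg_one]
  · exact s_neg_ne_zero hc h2 (.inl (by ring))
  · exact s_neg_ne_zero hc h1 (.inl (by ring))
  · exact s_neg_ne_zero hc h1 (.inr (by ring))
  · exact s_neg_ne_zero hc h2 (.inr (by ring))

lemma s_double_ne_zero {w : ℂ} (h : c.s (2 * w) ≠ 0) {ε ε' : ℤˣ} (hε : ε ≠ ε') :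
    c.s (sg ε * w - sg ε' * w) ≠ 0 := by
  rcases Int.units_eq_one_or ε with rfl | rfl <;> rcases Int.units_eq_one_or ε' with rfl | rfl <;>
    simp only [sg_one, sg_neg_one]
  · exact absurd rfl hε
  · exact s_neg_ne_zero hc h (.inl (by ring))
  · exact s_neg_ne_zero hc h (.inr (by ring))
  · exact absurd rfl hε

lemma s_omega_ne_zero (hsing : I * (lam - 1) * β ∉ c.Omega) (ν μ : Fin (c.rho + 1)) :
    c.s ((c.omega ν - c.omega μ + I * (1 - lam) * β) / 2) ≠ 0 := by
  obtain ⟨L, -, hL⟩ := Model.exists_duplication hc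
  have := Model.s_sub_half_omega_ne_zero hc hL (u := (c.omega ν + I * (1 - lam) * β) / 2) (by
    intro h
    refine hsing ?_
    have h1 := Model.mem_Omega_of_s_eq_zero hc h
    have h2 := sub_mem (Model.omega_mem ν) h1
    rwa [show c.omega ν - 2 * ((c.omega ν + I * (1 - lam) * β) / 2) = I * (lam - 1) * β by ring]
      at h2) μ
  rwa [show (c.omega ν + I * (1 - lam) * β) / 2 - c.omega μ / 2 =
    (c.omega ν - c.omega μ + I * (1 - lam) * β) / 2 by ring] at this

/-- Each pair of families of poles is separated by one kind of condition. Distances from a variable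
to a half-period are controlled through the duplication formula by a condition on twice the
variable; the two half-period families are separated by the assumption on `i(λ-1)β`. -/
lemma Generic.pole_ne (h : Generic c lam β x y) (hsing : I * (lam - 1) * β ∉ c.Omega)
    (i i' : PoleIndex c N M) (hij : i ≠ i') :
    c.s (pole c lam β x y i - pole c lam β x y i') ≠ 0 := by
  obtain ⟨L, -, hL⟩ := Model.exists_duplication hc
  have flip {u v : ℂ} (h : c.s (u - v) ≠ 0) : c.s (v - u) ≠ 0 :=
    s_neg_ne_zero hc h (.inr (by ring))
  have xy (ε : ℤˣ) (j : Fin N) (ε' : ℤˣ) (k : Fin M) :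
      c.s (sg ε * x j - (sg ε' * y k + I * (lam + 1) * β / 2)) ≠ 0 := by
    have := h.xy_pair j k
    rcases Int.units_eq_one_or ε with rfl | rfl <;>
      rcases Int.units_eq_one_or ε' with rfl | rfl
    · refine s_neg_ne_zero hc (this (-1) (-1)) (.inl ?_); simp only [sg_one, sg_neg_one]; ring
    · refine s_neg_ne_zero hc (this (-1) 1) (.inl ?_); simp only [sg_one, sg_neg_one]; ring
    · refine s_neg_ne_zero hc (this 1 1) (.inr ?_); simp only [sg_one, sg_neg_one]; ring
    · refine s_neg_ne_zero hc (this 1 (-1)) (.inr ?_); simp only [sg_one, sg_neg_one]; ring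
  have xω (ε : ℤˣ) (j : Fin N) (ν) : c.s (sg ε * x j - (c.omega ν / 2 + I * β / 2)) ≠ 0 := by
    have := Model.s_sub_half_omega_ne_zero hc hL (u := sg ε * x j - I * β / 2) (by
      have := s_signed_double_ne_zero hc (h.x_shift j) ε (.inr rfl)
      rwa [show 2 * (sg ε * x j) + -(I * β) = 2 * (sg ε * x j - I * β / 2) by ring] at this) ν
    exact s_neg_ne_zero hc this (.inl (by ring))
  have xω' (ε : ℤˣ) (j : Fin N) (ν) :
      c.s (sg ε * x j - (c.omega ν / 2 + I * lam * β / 2)) ≠ 0 := by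
    have := Model.s_sub_half_omega_ne_zero hc hL (u := sg ε * x j - I * lam * β / 2) (by
      have := s_signed_double_ne_zero hc (h.x_generic j) ε (.inr rfl)
      rwa [show 2 * (sg ε * x j) + -(I * lam * β) = 2 * (sg ε * x j - I * lam * β / 2) by ring]
        at this) ν
    exact s_neg_ne_zero hc this (.inl (by ring))
  have yω (ε : ℤˣ) (k : Fin M) (ν) :
      c.s (sg ε * y k + I * (lam + 1) * β / 2 - (c.omega ν / 2 + I * β / 2)) ≠ 0 := by
    have := Model.s_sub_half_omega_ne_zero hc hL (u := sg ε * y k + I * lam * β / 2) (by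
      have := s_signed_double_ne_zero hc (h.y_shift k) ε (.inl rfl)
      rwa [show 2 * (sg ε * y k) + I * lam * β = 2 * (sg ε * y k + I * lam * β / 2) by ring]
        at this) ν
    exact s_neg_ne_zero hc this (.inl (by ring))
  have yω' (ε : ℤˣ) (k : Fin M) (ν) :
      c.s (sg ε * y k + I * (lam + 1) * β / 2 - (c.omega ν / 2 + I * lam * β / 2)) ≠ 0 := by
    have := Model.s_sub_half_omega_ne_zero hc hL (u := sg ε * y k + I * β / 2) (by
      have := s_signed_double_ne_zero hc (h.y_generic k) ε (.inl rfl)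
      rwa [show 2 * (sg ε * y k) + I * β = 2 * (sg ε * y k + I * β / 2) by ring]
        at this) ν
    exact s_neg_ne_zero hc this (.inl (by ring))
  have ωω' (ν μ : Fin (c.rho + 1)) :
      c.s (c.omega ν / 2 + I * β / 2 - (c.omega μ / 2 + I * lam * β / 2)) ≠ 0 :=
    s_neg_ne_zero hc (s_omega_ne_zero hc hsing ν μ) (.inl (by ring))
  rcases i with ⟨ε, j⟩ | ⟨ε, k⟩ | ν | ν <;> rcases i' with ⟨ε', j'⟩ | ⟨ε', k'⟩ | ν' | ν' <;>
    simp only [pole]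
  · by_cases hj : j = j'
    · subst hj
      exact s_double_ne_zero hc (h.x_double j) fun hε => hij (by rw [hε])
    · exact s_signed_pair_ne_zero hc (h.x_pair j j' hj) ε ε'
  · exact xy _ _ _ _
  · exact xω _ _ _
  · exact xω' _ _ _
  · exact flip (xy _ _ _ _)
  · rw [add_sub_add_right_eq_sub]
    by_cases hk : k = k'
    · subst hk
      exact s_double_ne_zero hc (h.y_double k) fun hε => hij (by rw [hε])
    · exact s_signed_pair_ne_zero hc (h.y_pair k k' hk) ε ε'
  · exact yω _ _ _
  · exact yω' _ _ _
  · exact flip (xω _ _ _)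
  · exact flip (yω _ _ _)
  · have hne : ν ≠ ν' := fun h => hij (by rw [h])
    exact s_neg_ne_zero hc (Model.s_half_omega_sub_ne_zero hc hne) (.inl (by ring))
  · exact ωω' _ _
  · exact flip (xω' _ _ _)
  · exact flip (yω' _ _ _)
  · exact flip (ωω' _ _)
  · have hne : ν ≠ ν' := fun h => hij (by rw [h])
    exact s_neg_ne_zero hc (Model.s_half_omega_sub_ne_zero hc hne) (.inl (by ring))

omit hc in
lemma Balanced.sum_eq {g : Fin (2 * c.rho + 2) → ℝ} (h : Balanced c g lam N M)
    (hell : c.IsElliptic) :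
    2 * lam * N - 2 * M + (∑ μ, g μ : ℝ) - 1 / 2 * (c.rho + 1) * (lam + 1) = 0 := by
  have : (c.rho : ℝ) = 3 := by exact_mod_cast Model.rho_of_isElliptic hell
  unfold Balanced at h
  rw [this]
  linarith

/-- The residue identity multiplied by `L² = P`: the terms with shifts and `V⁰` appear with a minus
sign, `c⁰` with a plus sign, and the right-hand side is `-P s(…)` by oddness. -/
lemma Generic.apply_one (h : Generic c lam β x y) (hsing : I * (lam - 1) * β ∉ c.Omega)
    (hbal : c.IsElliptic → Balanced c g lam N M) :
    (∑ p : ℤˣ × Fin N, c.s (I * lam * β) * V c g lam β p.1 p.2 x y) +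
      ((∑ p : ℤˣ × Fin M, -(c.s (I * β) * Vt c g lam β p.1 p.2 x y)) + V0 c g lam β x y) =
      eigenvalue c g lam β N M := by
  obtain ⟨L, hP, hL⟩ := Model.exists_duplication hc
  have hL0 := Model.duplication_ne_zero hc hL
  have hbalC (hell : c.IsElliptic) : (2 * lam * N - 2 * M + (∑ μ, g μ : ℝ) -
      1 / 2 * (c.rho + 1) * (lam + 1) : ℂ) = 0 := by
    have := congrArg (fun t : ℝ => (t : ℂ)) ((hbal hell).sum_eq hell)
    push_cast at this ⊢
    exact this
  have hres := Model.residueSum_s hc (I := (Finset.univ : Finset (PoleIndex c N M)))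
    (a := zero c g lam β x y) (b := pole c lam β x y)
    ⟨.inr (.inr (.inl 0)), Finset.mem_univ _⟩
    (fun i _ j _ hij => h.pole_ne hc hsing i j hij) (fun hell => by
      rw [sum_pole_sub_zero, hbalC hell, Model.sum_omega_of_isElliptic hc hell]; ring)
  rw [sum_pole_sub_zero, Model.s_neg hc] at hres
  change ∑ i, residueTerm c g lam β x y i = _ at hres
  rw [Fintype.sum_sum_type, Fintype.sum_sum_type, Fintype.sum_sum_type] at hres
  have hx : ∑ p : ℤˣ × Fin N, c.s (I * lam * β) * V c g lam β p.1 p.2 x y =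
      -(L ^ 2 * ∑ p, residueTerm c g lam β x y (.inl p)) := by
    rw [Finset.mul_sum, ← Finset.sum_neg_distrib]
    refine Finset.sum_congr rfl fun p _ => ?_
    obtain ⟨ε, j⟩ := p
    rw [residueTerm_x hc g lam β x y hL hL0 ε j
      (s_signed_double_ne_zero hc (h.x_generic j) ε (.inr rfl)), neg_neg]
  have hy : ∑ p : ℤˣ × Fin M, -(c.s (I * β) * Vt c g lam β p.1 p.2 x y) =
      -(L ^ 2 * ∑ p, residueTerm c g lam β x y (.inr (.inl p))) := by
    rw [Finset.mul_sum, ← Finset.sum_neg_distrib]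
    refine Finset.sum_congr rfl fun p _ => ?_
    obtain ⟨ε, k⟩ := p
    rw [residueTerm_y hc g lam β x y hL hL0 ε k
      (s_signed_double_ne_zero hc (h.y_generic k) ε (.inl rfl))]
  have h0 : V0 c g lam β x y =
      -(L ^ 2 * ∑ ν, residueTerm c g lam β x y (.inr (.inr (.inl ν)))) := by
    rw [V0_eq, hP]
    congr 2
    refine Finset.sum_congr rfl fun ν _ => ?_
    rw [residueTerm_omega]
    congr 3
    -- The residue carries no exponential. That of `V⁰` is trivial because its exponent is the
    -- balanced quantity in the elliptic case and `ξ_ν = 0` otherwise.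
    by_cases hell : c.IsElliptic
    · rw [hbalC hell]; simp
    · rw [Model.rXi_eq_zero hell]; simp
  have hc0 : c0 c g lam β =
      L ^ 2 * ∑ ν, residueTerm c g lam β x y (.inr (.inr (.inr ν))) := by
    unfold c0
    rw [hP]
    congr 1
    refine Finset.sum_congr rfl fun ν _ => ?_
    rw [residueTerm_omega']
    have ex (j : Fin N) : xRatio c lam β (x j) (c.omega ν / 2 + I * lam * β / 2) =
        exp (2 * c.rXi ν * lam * β) := by
      obtain ⟨h1, h2⟩ : c.s (x j - (c.omega ν / 2 + I * lam * β / 2)) ≠ 0 ∧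
          c.s (-x j - (c.omega ν / 2 + I * lam * β / 2)) ≠ 0 := by
        have a1 := h.pole_ne hc hsing (.inl (1, j)) (.inr (.inr (.inr ν))) (by simp)
        have a2 := h.pole_ne hc hsing (.inl (-1, j)) (.inr (.inr (.inr ν))) (by simp)
        simp only [pole, sg_one, sg_neg_one, one_mul, neg_mul] at a1 a2
        exact ⟨a1, a2⟩
      rw [xRatio, Model.pairRatio_half_omega hc ν _ _ _ _ (by ring)
        (s_neg_ne_zero hc h1 (.inr (by ring))) (s_neg_ne_zero hc h2 (.inr (by ring)))]
      congr 1
      linear_combination (-2 * c.rXi ν * lam * β) * I_sq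
    have ey (k : Fin M) : yRatio c lam β (y k) (c.omega ν / 2 + I * lam * β / 2) =
        exp (-(2 * c.rXi ν * β)) := by
      obtain ⟨h1, h2⟩ : c.s (y k + I * (lam + 1) * β / 2 - (c.omega ν / 2 + I * lam * β / 2)) ≠ 0 ∧
          c.s (-y k + I * (lam + 1) * β / 2 - (c.omega ν / 2 + I * lam * β / 2)) ≠ 0 := by
        have a1 := h.pole_ne hc hsing (.inr (.inl (1, k))) (.inr (.inr (.inr ν))) (by simp)
        have a2 := h.pole_ne hc hsing (.inr (.inl (-1, k))) (.inr (.inr (.inr ν))) (by simp)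
        simp only [pole, sg_one, sg_neg_one, one_mul, neg_mul] at a1 a2
        exact ⟨a1, a2⟩
      rw [yRatio, Model.pairRatio_half_omega hc ν _ _ _ _ (by ring)
        (s_neg_ne_zero hc h1 (.inr (by ring))) (s_neg_ne_zero hc h2 (.inr (by ring)))]
      congr 1
      linear_combination (2 * c.rXi ν * β) * I_sq
    simp only [ex, ey, Finset.prod_const, Finset.card_univ, Fintype.card_fin]
    rw [← Complex.exp_nat_mul, ← Complex.exp_nat_mul, ← Complex.exp_add, ← gProd]
    -- The variables leave one constant exponential each at these poles. Balancing identifies their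
    -- product with the exponential in `c⁰`; in the other cases both are `1`.
    have e : exp (-(c.rXi ν * ((∑ μ, g μ : ℝ) - 1 / 2 * (c.rho + 1) * (lam + 1)) * β)) =
        exp (N * (2 * c.rXi ν * lam * β) + M * -(2 * c.rXi ν * β)) := by
      congr 1
      by_cases hell : c.IsElliptic
      · linear_combination -(c.rXi ν * β) * hbalC hell
      · rw [Model.rXi_eq_zero hell]; simp
    rw [e]
    ring
  rw [hx, hy, h0, eigenvalue, hc0, hP]
  linear_combination -c.prefactor * hres

end Generic

end DeformedVanDiejen

end


/-! ### Removal of the genericity conditions -/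

noncomputable section

namespace DeformedVanDiejen

section Density

variable {c : Model} (hc : c.Positive) {N M : ℕ} (g : Fin (2 * c.rho + 2) → ℝ) {lam β : ℝ}
  {x : Fin N → ℂ} {y : Fin M → ℂ}

include hc

lemma Regular.nonSingular {z : Fin N ⊕ Fin M → ℂ} (h : Regular c lam β z) :
    NonSingular c lam β (fun j => z (.inl j)) (fun k => z (.inr k)) where
  x_double j h0 := (h.x_single j).1 (Model.mem_Omega_of_s_eq_zero hc h0)
  x_shift j ε h0 := (h.x_single j).2 ε (Model.mem_Omega_of_s_eq_zero hc h0)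
  y_double k h0 := (h.y_single k).1 (Model.mem_Omega_of_s_eq_zero hc h0)
  y_shift k ε h0 := (h.y_single k).2 ε (Model.mem_Omega_of_s_eq_zero hc h0)
  x_pair j j' hj δ h0 := h.x_pair j j' hj δ (Model.mem_Omega_of_s_eq_zero hc h0)
  y_pair k k' hk δ h0 := h.y_pair k k' hk δ (Model.mem_Omega_of_s_eq_zero hc h0)
  xy_pair j k ε δ h0 := h.xy_pair j k ε δ (Model.mem_Omega_of_s_eq_zero hc h0)

lemma NonSingular.eventually (h : NonSingular c lam β x y) :
    ∀ᶠ t : ℂ in nhds 0, NonSingular c lam β (fun j => x j + t) (fun k => y k + t) := by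
  have hcont := (Model.differentiable_s hc).continuous
  have key {f : ℂ → ℂ} (hf : Continuous f) (h0 : c.s (f 0) ≠ 0) : ∀ᶠ t in nhds 0, c.s (f t) ≠ 0 :=
    (hcont.comp hf).continuousAt.eventually_ne h0
  have e1 : ∀ᶠ t in nhds (0 : ℂ), ∀ j, c.s (2 * (x j + t)) ≠ 0 :=
    eventually_all.2 fun j => key (by fun_prop) (by simpa using h.x_double j)
  have e2 : ∀ᶠ t in nhds (0 : ℂ), ∀ j (ε : ℤˣ), c.s (2 * (x j + t) + sg ε * (I * β)) ≠ 0 :=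
    eventually_all.2 fun j => eventually_all.2 fun ε =>
      key (by fun_prop) (by simpa using h.x_shift j ε)
  have e3 : ∀ᶠ t in nhds (0 : ℂ), ∀ k, c.s (2 * (y k + t)) ≠ 0 :=
    eventually_all.2 fun k => key (by fun_prop) (by simpa using h.y_double k)
  have e4 : ∀ᶠ t in nhds (0 : ℂ), ∀ k (ε : ℤˣ), c.s (2 * (y k + t) + sg ε * (I * lam * β)) ≠ 0 :=
    eventually_all.2 fun k => eventually_all.2 fun ε =>
      key (by fun_prop) (by simpa using h.y_shift k ε)
  have e5 : ∀ᶠ t in nhds (0 : ℂ), ∀ j j', j ≠ j' → ∀ δ : ℤˣ,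
      c.s (x j + t + sg δ * (x j' + t)) ≠ 0 :=
    eventually_all.2 fun j => eventually_all.2 fun j' => eventually_imp_distrib_left.2 fun hj =>
      eventually_all.2 fun δ => key (by fun_prop) (by simpa using h.x_pair j j' hj δ)
  have e6 : ∀ᶠ t in nhds (0 : ℂ), ∀ k k', k ≠ k' → ∀ δ : ℤˣ,
      c.s (y k + t + sg δ * (y k' + t)) ≠ 0 :=
    eventually_all.2 fun j => eventually_all.2 fun j' => eventually_imp_distrib_left.2 fun hj =>
      eventually_all.2 fun δ => key (by fun_prop) (by simpa using h.y_pair j j' hj δ)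
  have e7 : ∀ᶠ t in nhds (0 : ℂ), ∀ j k (ε δ : ℤˣ),
      c.s (x j + t + sg δ * (y k + t) + sg ε * (I * (lam + 1) * β / 2)) ≠ 0 :=
    eventually_all.2 fun j => eventually_all.2 fun k => eventually_all.2 fun ε =>
      eventually_all.2 fun δ => key (by fun_prop) (by simpa using h.xy_pair j k ε δ)
  filter_upwards [e1, e2, e3, e4, e5, e6, e7] with t h1 h2 h3 h4 h5 h6 h7
  exact ⟨h1, h2, h3, h4, h5, h6, h7⟩

lemma continuousAt_V (h : NonSingular c lam β x y) (ε : ℤˣ) (j : Fin N) :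
    ContinuousAt (fun t : ℂ => V c g lam β ε j (fun i => x i + t) (fun k => y k + t)) 0 := by
  have hcont := (Model.differentiable_s hc).continuous
  unfold V
  refine ContinuousAt.mul (ContinuousAt.div (by fun_prop) (by fun_prop) ?_)
    (tendsto_finsetProd _ fun δ _ => ContinuousAt.mul
      (tendsto_finsetProd _ fun j' hj' => ContinuousAt.div (by fun_prop) (by fun_prop) ?_)
      (tendsto_finsetProd _ fun k _ => ContinuousAt.div (by fun_prop) (by fun_prop) ?_))
  · simp only [add_zero]
    have h1 := s_signed_double_ne_zero hc (h.x_shift j) ε (.inr rfl)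
    have h2 : c.s (sg ε * (2 * x j)) ≠ 0 := by
      rcases Int.units_eq_one_or ε with rfl | rfl
      · exact s_neg_ne_zero hc (h.x_double j) (.inl (by simp only [sg_one]; ring))
      · exact s_neg_ne_zero hc (h.x_double j) (.inr (by simp only [sg_neg_one]; ring))
    exact mul_ne_zero h2 (s_neg_ne_zero hc h1 (.inl (by ring)))
  · simpa using h.x_pair j j' (Finset.ne_of_mem_erase hj').symm δ
  · simp only [add_zero]
    have := h.xy_pair j k (-ε) δ
    rcases Int.units_eq_one_or ε with rfl | rfl
    · exact s_neg_ne_zero hc this (.inl (by simp only [sg_one, sg_neg_one]; ring))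
    · exact s_neg_ne_zero hc this (.inl (by simp only [neg_neg, sg_one, sg_neg_one]; ring))

lemma continuousAt_Vt (h : NonSingular c lam β x y) (ε : ℤˣ) (k : Fin M) :
    ContinuousAt (fun t : ℂ => Vt c g lam β ε k (fun i => x i + t) (fun k => y k + t)) 0 := by
  have hcont := (Model.differentiable_s hc).continuous
  unfold Vt
  refine ContinuousAt.mul (ContinuousAt.div (by fun_prop) (by fun_prop) ?_)
    (tendsto_finsetProd _ fun δ _ => ContinuousAt.mul
      (tendsto_finsetProd _ fun j' hj' => ContinuousAt.div (by fun_prop) (by fun_prop) ?_)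
      (tendsto_finsetProd _ fun j _ => ContinuousAt.div (by fun_prop) (by fun_prop) ?_))
  · simp only [add_zero]
    have h1 := s_signed_double_ne_zero hc (h.y_shift k) ε (.inl rfl)
    have h2 : c.s (sg ε * (2 * y k)) ≠ 0 := by
      rcases Int.units_eq_one_or ε with rfl | rfl
      · exact s_neg_ne_zero hc (h.y_double k) (.inl (by simp only [sg_one]; ring))
      · exact s_neg_ne_zero hc (h.y_double k) (.inr (by simp only [sg_neg_one]; ring))
    exact mul_ne_zero h2 (s_neg_ne_zero hc h1 (.inl (by ring)))
  · simpa using h.y_pair k j' (Finset.ne_of_mem_erase hj').symm δ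
  · simp only [add_zero]
    rcases Int.units_eq_one_or δ with rfl | rfl
    · exact s_neg_ne_zero hc (h.xy_pair j k ε 1) (.inl (by simp only [sg_one]; ring))
    · have := h.xy_pair j k (-ε) (-1)
      rcases Int.units_eq_one_or ε with rfl | rfl
      · exact s_neg_ne_zero hc this (.inr (by simp only [sg_one, sg_neg_one]; ring))
      · exact s_neg_ne_zero hc this (.inr (by simp only [neg_neg, sg_one, sg_neg_one]; ring))

lemma continuousAt_V0 (h : NonSingular c lam β x y) :
    ContinuousAt (fun t : ℂ => V0 c g lam β (fun i => x i + t) (fun k => y k + t)) 0 := by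
  have hcont := (Model.differentiable_s hc).continuous
  obtain ⟨L, -, hL⟩ := Model.exists_duplication hc
  unfold V0
  refine ContinuousAt.neg (ContinuousAt.mul (by fun_prop) (tendsto_finsetSum _ fun ν _ =>
    ContinuousAt.mul (by fun_prop) (tendsto_finsetProd _ fun δ _ => ContinuousAt.mul
      (tendsto_finsetProd _ fun j _ => ContinuousAt.div (by fun_prop) (by fun_prop) ?_)
      (tendsto_finsetProd _ fun k _ => ContinuousAt.div (by fun_prop) (by fun_prop) ?_))))
  · simp only [add_zero]
    have := Model.s_sub_half_omega_ne_zero hc hL (u := -(sg δ * x j + I * β / 2))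
      (s_neg_ne_zero hc (s_signed_double_ne_zero hc (h.x_shift j) δ (.inl rfl))
        (.inr (by ring))) ν
    exact s_neg_ne_zero hc this (.inr (by ring))
  · simp only [add_zero]
    have := Model.s_sub_half_omega_ne_zero hc hL (u := -(sg δ * y k - I * lam * β / 2))
      (s_neg_ne_zero hc (s_signed_double_ne_zero hc (h.y_shift k) δ (.inr rfl))
        (.inr (by ring))) ν
    exact s_neg_ne_zero hc this (.inr (by ring))

/-- Under the common translation by `t` every extra condition concerns an injective affine function
of `t`, so it fails for at most countably many `t`. -/
lemma countable_not_generic (lam β : ℝ) (x : Fin N → ℂ)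
    (y : Fin M → ℂ) :
    ((⋃ j, ⋃ ε : ℤˣ, {t : ℂ | c.s (2 * (x j + t) + sg ε * (I * lam * β)) = 0}) ∪
      ⋃ k, ⋃ ε : ℤˣ, {t : ℂ | c.s (2 * (y k + t) + sg ε * (I * β)) = 0}).Countable := by
  have inj (w v : ℂ) : Function.Injective fun t : ℂ => 2 * (w + t) + v := fun t t' h => by
    simpa using h
  refine Set.Countable.union ?_ ?_ <;> refine Set.countable_iUnion fun j =>
    Set.countable_iUnion fun ε => ?_
  · exact (Model.countable_s_zeros hc).preimage
      (f := fun t => 2 * (x j + t) + sg ε * (I * lam * β)) (inj _ _)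
  · exact (Model.countable_s_zeros hc).preimage
      (f := fun t => 2 * (y j + t) + sg ε * (I * β)) (inj _ _)

/-- The extra genericity conditions do not come from denominators of the coefficients. Along the
translated points `(x + t, y + t)` the left-hand side is continuous at `t = 0`, and it equals the
constant eigenvalue for a dense set of small `t`. -/
lemma NonSingular.apply_one (h : NonSingular c lam β x y) (hsing : I * (lam - 1) * β ∉ c.Omega)
    (hbal : c.IsElliptic → Balanced c g lam N M) :
    (∑ p : ℤˣ × Fin N, c.s (I * lam * β) * V c g lam β p.1 p.2 x y) +
      ((∑ p : ℤˣ × Fin M, -(c.s (I * β) * Vt c g lam β p.1 p.2 x y)) + V0 c g lam β x y) =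
      eigenvalue c g lam β N M := by
  set F : ℂ → ℂ := fun t =>
    (∑ p : ℤˣ × Fin N, c.s (I * lam * β) *
      V c g lam β p.1 p.2 (fun i => x i + t) (fun k => y k + t)) +
    ((∑ p : ℤˣ × Fin M, -(c.s (I * β) *
      Vt c g lam β p.1 p.2 (fun i => x i + t) (fun k => y k + t))) +
      V0 c g lam β (fun i => x i + t) (fun k => y k + t)) with hF
  have hcont : ContinuousAt F 0 := by
    refine ContinuousAt.add (tendsto_finsetSum _ fun p _ => ?_)
      (ContinuousAt.add (tendsto_finsetSum _ fun p _ => ?_) (continuousAt_V0 hc g h))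
    · exact continuousAt_const.mul (continuousAt_V hc g h p.1 p.2)
    · exact (continuousAt_const.mul (continuousAt_Vt hc g h p.1 p.2)).neg
  have hd := (countable_not_generic hc lam β x y).dense_compl ℂ
  set S := ((⋃ j, ⋃ ε : ℤˣ, {t : ℂ | c.s (2 * (x j + t) + sg ε * (I * lam * β)) = 0}) ∪
      ⋃ k, ⋃ ε : ℤˣ, {t : ℂ | c.s (2 * (y k + t) + sg ε * (I * β)) = 0})ᶜ with hS
  have hne : (nhdsWithin (0 : ℂ) S).NeBot := mem_closure_iff_nhdsWithin_neBot.1 (hd 0)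
  have hev : ∀ᶠ t in nhdsWithin (0 : ℂ) S, F t = eigenvalue c g lam β N M := by
    filter_upwards [self_mem_nhdsWithin, nhdsWithin_le_nhds (h.eventually hc)] with t ht hns
    simp only [hS, Set.mem_compl_iff, Set.mem_union, Set.mem_iUnion, Set.mem_ofPred_eq, not_or,
      not_exists] at ht
    exact Generic.apply_one hc g { hns with x_generic := ht.1, y_generic := ht.2 } hsing hbal
  have h0 : F 0 = eigenvalue c g lam β N M :=
    tendsto_nhds_unique (hcont.tendsto.mono_left nhdsWithin_le_nhds)
      (tendsto_const_nhds.congr' (hev.mono fun _ h => h.symm))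
  simpa [hF] using h0

/-- The constant function is an eigenfunction. -/
theorem opA_apply_one {z : Fin N ⊕ Fin M → ℂ} (h : Regular c lam β z)
    (hsing : I * (lam - 1) * β ∉ c.Omega) (hbal : c.IsElliptic → Balanced c g lam N M) :
    (opA c g lam β N M).apply (fun _ => 1) z = eigenvalue c g lam β N M := by
  rw [← (h.nonSingular hc).apply_one hc g hsing hbal, DifferenceOperator.apply,
    Fintype.sum_sum_type, Fintype.sum_sum_type]
  simp only [opA, mul_one, Finset.univ_unique, Finset.sum_singleton]

end Density

end DeformedVanDiejen

end


noncomputable section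

namespace DeformedVanDiejen

/-! ### Formal anti-symmetry from a pointwise identity -/

lemma conjVec_ofRealVec_sub_imag {ι : Type*} (x a : ι → ℝ) :
    conjVec (ofRealVec x - imag a) = ofRealVec x + imag a := by
  funext i
  simp [conjVec, ofRealVec, imag]

lemma conjVec_ofRealVec {ι : Type*} (x : ι → ℝ) : conjVec (ofRealVec x) = ofRealVec x := by
  funext i
  simp [conjVec, ofRealVec]

lemma conjVec_conjVec {ι : Type*} (z : ι → ℂ) : conjVec (conjVec z) = z := by
  funext i
  simp [conjVec]

/-- The hypothesis `key` is the adjoint relation with the denominator `W` cleared. Dividing at `conj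
z` gives the operator statement; inserting it after the contour shift, term by term, gives the
statement about integrals. -/
theorem DifferenceOperator.isFormallyAntisymmetric_of_forall_mem {T ι : Type*} [Fintype T]
    [Fintype ι] {W : (ι → ℂ) → ℂ} {A : DifferenceOperator T ι} {S : Set (ι → ℂ)}
    (hC : ∀ᵐ z : ι → ℂ, conjVec z ∈ S) (hR : ∀ᵐ x : ι → ℝ, ofRealVec x ∈ S)
    (hW : ∀ z ∈ S, W z ≠ 0)
    (key : ∀ z ∈ S, ∀ t, W (z - imag (A.shift t)) * A.coeff t (z - imag (A.shift t)) =
      -(conj (A.coeff t (conjVec z)) * W z)) :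
    A.IsFormallyAntisymmetric W := by
  refine ⟨fun f => ?_, fun D f g hD h => ?_⟩
  · filter_upwards [hC] with z hz
    simp only [apply, formalAdjoint]
    rw [← Finset.sum_neg_distrib]
    refine Finset.sum_congr rfl fun t _ => ?_
    rw [key _ hz t, conjVec_conjVec, ← neg_mul, mul_div_cancel_right₀ _ (hW _ hz), map_neg,
      Complex.conj_conj]
    ring
  · have e1 : weightedInner W D f (A.apply g) =
        ∑ t, ∫ x in D, termIntegrand W A f g t (ofRealVec x) := by
      rw [← integral_finsetSum _ fun t _ => (h t).1]
      refine integral_congr_ae (.of_forall fun x => ?_)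
      simp only [termIntegrand, apply, conjVec_ofRealVec, Finset.mul_sum, Finset.sum_mul]
    -- On the shifted contour the conjugated function is evaluated at `x + i a_t`, which is the
    -- argument in `A f`, while the shift in the other function is undone.
    have e2 : -(weightedInner W D (A.apply f) g) =
        ∑ t, ∫ x in D, termIntegrand W A f g t (ofRealVec x - imag (A.shift t)) := by
      rw [← integral_finsetSum _ fun t _ => (h t).2.1, weightedInner, ← integral_neg]
      refine integral_congr_ae (ae_restrict_of_ae ?_)
      filter_upwards [hR] with x hx
      simp only [termIntegrand, apply, conjVec_ofRealVec_sub_imag, sub_add_cancel, map_sum,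
        Finset.sum_mul, map_mul, ← Finset.sum_neg_distrib]
      refine Finset.sum_congr rfl fun t _ => ?_
      have := key _ hx t
      rw [conjVec_ofRealVec] at this
      linear_combination -(conj (f (ofRealVec x + imag (A.shift t))) * g (ofRealVec x)) * this
    rw [e1, e2]
    exact Finset.sum_congr rfl fun t _ => (h t).2.2

/-! ### Generic points -/

lemma countable_compl_of_mem_codiscrete {S : Set ℂ} (hS : S ∈ codiscrete ℂ) : Sᶜ.Countable := by
  have : DiscreteTopology ↑(Sᶜ) := (mem_codiscrete'.1 hS).2.to_subtype
  exact Set.countable_coe_iff.1 (TopologicalSpace.separableSpace_iff_countable.1 inferInstance)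

/-- A fibre of a nonzero real-linear map is empty or a translate of a proper subspace, hence null,
and countably many null sets are null. -/
lemma ae_linearMap_notMem {E : Type*} [NormedAddCommGroup E] [NormedSpace ℝ E] [MeasurableSpace E]
    [BorelSpace E] [FiniteDimensional ℝ E] (μ : Measure E) [μ.IsAddHaarMeasure] (φ : E →ₗ[ℝ] ℂ)
    {e : E} (he : φ e ≠ 0) {B : Set ℂ} (hB : B.Countable) : ∀ᵐ z ∂μ, φ z ∉ B := by
  have h1 (b : ℂ) : μ (φ ⁻¹' {b}) = 0 := by
    rcases (φ ⁻¹' {b}).eq_empty_or_nonempty with h | ⟨z₀, hz₀⟩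
    · rw [h, measure_empty]
    · have h2 : φ ⁻¹' {b} = (fun z => z + -z₀) ⁻¹' (LinearMap.ker φ : Set E) := by
        ext z
        simp only [Set.mem_preimage, Set.mem_singleton_iff, SetLike.mem_coe, LinearMap.mem_ker,
          map_add, map_neg]
        rw [Set.mem_preimage, Set.mem_singleton_iff] at hz₀
        rw [hz₀, add_neg_eq_zero]
      rw [h2, measure_preimage_add_right]
      refine Measure.addHaar_submodule μ _ fun h => he ?_
      have : e ∈ LinearMap.ker φ := h ▸ Submodule.mem_top
      exact this
  rw [ae_iff]
  simp only [not_not]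
  have h3 : {z | φ z ∈ B} = ⋃ b ∈ B, φ ⁻¹' {b} := by
    ext z; simp
  rw [h3]
  exact (measure_biUnion_null_iff hB).2 fun b _ => h1 b

/-- The coordinates, their doubles, and their sums and differences avoid `B`. -/
structure Avoids {ι : Type*} (B : Set ℂ) (z : ι → ℂ) : Prop where
  single : ∀ i, z i ∉ B
  double : ∀ i, 2 * z i ∉ B
  pair : ∀ i i', i ≠ i' → ∀ δ : ℤˣ, z i + sg δ * z i' ∉ B

/-- Stated for a linear map `φ` so that it serves both for real points in `ℂ^ι` and for conjugates
of complex points. -/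
lemma ae_avoids {ι : Type*} [Finite ι] {E : Type*} [NormedAddCommGroup E] [NormedSpace ℝ E]
    [MeasurableSpace E] [BorelSpace E] [FiniteDimensional ℝ E] (μ : Measure E) [μ.IsAddHaarMeasure]
    (φ : E →ₗ[ℝ] (ι → ℂ)) (hφ : ∀ i, ∃ e, φ e i = 1 ∧ ∀ i' ≠ i, φ e i' = 0) {B : Set ℂ}
    (hB : B.Countable) : ∀ᵐ z ∂μ, Avoids B (φ z) := by
  have key (i i' : ι) (r r' : ℂ) (e : E) (he : r * φ e i + r' * φ e i' ≠ 0) :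
      ∀ᵐ z ∂μ, r * φ z i + r' * φ z i' ∉ B := by
    let ψ : E →ₗ[ℝ] ℂ :=
      { toFun := fun z => r * φ z i + r' * φ z i'
        map_add' := fun z w => by simp only [map_add, Pi.add_apply]; ring
        map_smul' := fun t z => by
          simp only [map_smul, Pi.smul_apply, Complex.real_smul, RingHom.id_apply]; ring }
    exact ae_linearMap_notMem μ ψ (e := e) he hB
  have h1 : ∀ᵐ z ∂μ, ∀ i, φ z i ∉ B := ae_all_iff.2 fun i => by
    obtain ⟨e, he, -⟩ := hφ i
    simpa using key i i 1 0 e (by simp [he])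
  have h2 : ∀ᵐ z ∂μ, ∀ i, 2 * φ z i ∉ B := ae_all_iff.2 fun i => by
    obtain ⟨e, he, -⟩ := hφ i
    simpa using key i i 2 0 e (by simp [he])
  have h3 : ∀ᵐ z ∂μ, ∀ i i', i ≠ i' → ∀ δ : ℤˣ, φ z i + sg δ * φ z i' ∉ B :=
    ae_all_iff.2 fun i => ae_all_iff.2 fun i' => ae_all_iff.2 fun hi => ae_all_iff.2 fun δ => by
      obtain ⟨e, he, he'⟩ := hφ i
      simpa using key i i' 1 (sg δ) e (by simp [he, he' i' hi.symm])
  filter_upwards [h1, h2, h3] with z a1 a2 a3 using ⟨a1, a2, a3⟩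

lemma ae_avoids_ofRealVec {ι : Type*} [Fintype ι] {B : Set ℂ} (hB : B.Countable) :
    ∀ᵐ x : ι → ℝ, Avoids B (ofRealVec x) := by
  classical
  let φ : (ι → ℝ) →ₗ[ℝ] (ι → ℂ) :=
    { toFun := ofRealVec
      map_add' := fun x y => by funext i; simp [ofRealVec]
      map_smul' := fun r x => by funext i; simp [ofRealVec] }
  exact ae_avoids volume φ (fun i => ⟨Pi.single i 1, by simp [φ, ofRealVec],
    fun i' hi => by simp [φ, ofRealVec, Pi.single_eq_of_ne hi]⟩) hB

lemma ae_avoids_conjVec {ι : Type*} [Fintype ι] {B : Set ℂ} (hB : B.Countable) :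
    ∀ᵐ z : ι → ℂ, Avoids B (conjVec z) := by
  classical
  let φ : (ι → ℂ) →ₗ[ℝ] (ι → ℂ) :=
    { toFun := conjVec
      map_add' := fun x y => by funext i; simp [conjVec]
      map_smul' := fun r x => by funext i; simp [conjVec] }
  exact ae_avoids volume φ (fun i => ⟨Pi.single i 1, by simp [φ, conjVec],
    fun i' hi => by simp [φ, conjVec, Pi.single_eq_of_ne hi]⟩) hB

end DeformedVanDiejen

end


noncomputable section

namespace DeformedVanDiejen

/-! ### Behaviour of the coefficients under conjugation and under exchange of the variables -/

section Conj

variable {c : Model} (hc : c.Positive) {N M : ℕ} (g : Fin (2 * c.rho + 2) → ℝ) (lam β : ℝ)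
  (x : Fin N → ℂ) (y : Fin M → ℂ)

include hc

lemma conj_pairRatio {u v : ℂ} (hu : conj u = -u) (hv : conj v = -v) (w z : ℂ) :
    conj (pairRatio c.s (conj w) u v z) = pairRatio c.s w u v (-conj z) := by
  have key (q : ℂ) : c.s (conj z - w + q) * c.s (conj z + w + q) =
      c.s (-conj z - w - q) * c.s (-conj z + w - q) := by
    rw [show -conj z - w - q = -(conj z + w + q) by ring,
      show -conj z + w - q = -(conj z - w + q) by ring, Model.s_neg hc, Model.s_neg hc]
    ring
  simp only [pairRatio, map_div₀, map_mul, Model.s_conj hc, map_sub, map_add, Complex.conj_conj,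
    hu, hv, sub_neg_eq_add, key]

/-- Conjugation acts as the reflection in `ω_ν/2`, which preserves the points occurring here up to
the sign of `w`. The factors come in pairs with `± w`, so both this exchange and the sign `χ` are
harmless. -/
lemma conj_pairRatio_half_omega {u v p : ℂ} (hu : conj u = -u) (hv : conj v = -v)
    (hp : conj p = -p) (w : ℂ) (ν : Fin (c.rho + 1)) :
    conj (pairRatio c.s (conj w) u v (c.omega ν / 2 + p)) =
      pairRatio c.s w u v (c.omega ν / 2 + p) := by
  obtain ⟨χ, hχ, h⟩ := Model.conj_s_half_omega_add hc ν
  have key (q : ℂ) (hq : conj q = -q) :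
      conj (c.s (c.omega ν / 2 + p - conj w - q) * c.s (c.omega ν / 2 + p + conj w - q)) =
        c.s (c.omega ν / 2 + p - w - q) * c.s (c.omega ν / 2 + p + w - q) := by
    have h1 := h (p - conj w - q)
    have h2 := h (p + conj w - q)
    simp only [map_sub, map_add, hp, hq, Complex.conj_conj] at h1 h2
    rw [show c.omega ν / 2 + p - conj w - q = c.omega ν / 2 + (p - conj w - q) by ring,
      show c.omega ν / 2 + p + conj w - q = c.omega ν / 2 + (p + conj w - q) by ring, map_mul,
      h1, h2, show c.omega ν / 2 - (-p - w - -q) = c.omega ν / 2 + p + w - q by ring,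
      show c.omega ν / 2 - (-p + w - -q) = c.omega ν / 2 + p - w - q by ring]
    rcases hχ with rfl | rfl <;> ring
  rw [pairRatio, pairRatio, map_div₀, key u hu, key v hv]

/-- Every factor changes sign by oddness, and there are `2ρ + 2` of them, an even number. -/
lemma conj_gProd (z : ℂ) : conj (gProd c g β z) = gProd c g β (-conj z) := by
  have key (ν) : conj (c.s (z - I * g ν * β)) = -1 * c.s (-conj z - I * g ν * β) := by
    rw [Model.s_conj hc, neg_one_mul, ← Model.s_neg hc]
    congr 1
    simp
    ring
  have h1 : (-1 : ℂ) ^ (2 * c.rho + 2) = 1 := by rw [← mul_add_one, pow_mul, neg_one_sq, one_pow]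
  rw [gProd, map_prod, Finset.prod_congr rfl fun ν _ => key ν, Finset.prod_mul_distrib,
    Finset.prod_const, Finset.card_univ, Fintype.card_fin, h1, one_mul, gProd]

lemma conj_gProd_half_omega {p : ℂ} (hp : conj p = -p) (ν : Fin (c.rho + 1)) :
    conj (gProd c g β (c.omega ν / 2 + p)) = gProd c g β (c.omega ν / 2 + p) := by
  obtain ⟨χ, hχ, h⟩ := Model.conj_s_half_omega_add hc ν
  have key (μ) : conj (c.s (c.omega ν / 2 + p - I * g μ * β)) =
      χ * c.s (c.omega ν / 2 + p - I * g μ * β) := by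
    rw [add_sub_assoc, h]
    congr 2
    simp [hp]
    ring
  have hχ2 : χ ^ (2 * c.rho + 2) = 1 := by
    rw [← mul_add_one, pow_mul]
    rcases hχ with rfl | rfl <;> norm_num
  rw [gProd, map_prod, Finset.prod_congr rfl fun ν _ => key ν, Finset.prod_mul_distrib,
    Finset.prod_const, Finset.card_univ, Fintype.card_fin, hχ2, one_mul]

lemma conj_V (ε : ℤˣ) (j : Fin N) :
    conj (V c g lam β ε j (conjVec x) (conjVec y)) = V c g lam β (-ε) j x y := by
  have hε : sg (-ε) = -sg ε := by simp [sg]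
  have hε' : conj (sg ε) = sg ε := by simp [sg]
  rw [V_eq hc, V_eq hc, map_mul, map_mul, map_div₀, map_mul, conj_gProd hc, map_prod, map_prod]
  simp only [xRatio, yRatio, conjVec, Model.s_conj hc]
  congr 1
  · congr 1
    · simp [hε, hε']
    · rw [show conj (2 * (sg ε * conj (x j))) = -(2 * (sg (-ε) * x j)) by simp [hε, hε', map_ofNat],
        show conj (2 * (sg ε * conj (x j)) - I * β) = -(2 * (sg (-ε) * x j) - I * β) by
          simp [hε, hε', map_ofNat]; ring, Model.s_neg hc, Model.s_neg hc, neg_mul_neg]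
  · congr 1
    · refine Finset.prod_congr rfl fun j' _ => ?_
      rw [conj_pairRatio hc (by simp) (by simp)]
      simp [hε, hε']
    · refine Finset.prod_congr rfl fun j' _ => ?_
      rw [conj_pairRatio hc (by simp [map_ofNat]; ring) (by simp [map_ofNat]; ring)]
      simp [hε, hε']

/-- The product of half-period denominators in `V⁰`, rewritten by duplication so that its behaviour
under conjugation becomes visible: only `s(w)` will not be real when `w` is imaginary. -/
lemma prefactor_div_prod (ν : Fin (c.rho + 1)) (w : ℂ) :
    (∏ μ ∈ Finset.univ.erase ν, c.s ((c.omega ν - c.omega μ) / 2)) *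
        ∏ μ, c.s ((c.omega ν - c.omega μ + w) / 2) =
      c.prefactor * (2 * exp (2 * I * c.rXi ν * c.omega ν) * exp (2 * I * c.rXi ν * w) * c.s w) := by
  obtain ⟨L, hL2, hL⟩ := Model.exists_duplication hc
  obtain ⟨σ, hσ, h1, h2⟩ := Model.prod_erase_half_omega_sub hc hL ν
  have h3 := hL ((c.omega ν + w) / 2)
  rw [show 2 * ((c.omega ν + w) / 2) = w + c.omega ν by ring, h1] at h3
  have h4 : ∏ μ, c.s ((c.omega ν - c.omega μ + w) / 2) =
      ∏ μ, c.s ((c.omega ν + w) / 2 - c.omega μ / 2) :=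
    Finset.prod_congr rfl fun μ _ => by ring_nf
  have h5 : exp (2 * I * c.rXi ν * (w + c.omega ν / 2)) =
      exp (2 * I * c.rXi ν * w) * exp (I * c.rXi ν * c.omega ν) := by
    rw [← Complex.exp_add]; ring_nf
  have h6 : exp (2 * I * c.rXi ν * c.omega ν) = exp (I * c.rXi ν * c.omega ν) ^ 2 := by
    rw [← Complex.exp_nat_mul]; ring_nf
  have hσ2 : σ ^ 2 = 1 := by rcases hσ with rfl | rfl <;> norm_num
  rw [h2, h4, h3, h5, h6, ← hL2]
  linear_combination (2 * L ^ 2 * exp (I * c.rXi ν * c.omega ν) ^ 2 * exp (2 * I * c.rXi ν * w) *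
    c.s w) * hσ2

/-- Once the denominators are rewritten, every factor is invariant under conjugation at conjugate
arguments, except `s(i(1-λ)β)`, which changes sign. -/
lemma conj_V0 : conj (V0 c g lam β (conjVec x) (conjVec y)) = -V0 c g lam β x y := by
  obtain ⟨L, hL2, hL⟩ := Model.exists_duplication hc
  have hP : c.prefactor ≠ 0 := hL2 ▸ pow_ne_zero 2 (Model.duplication_ne_zero hc hL)
  have main (x : Fin N → ℂ) (y : Fin M → ℂ) : V0 c g lam β x y =
      -∑ ν, exp (-(c.rXi ν *
          (2 * lam * N - 2 * M + ∑ μ, g μ - 1 / 2 * (c.rho + 1) * (lam + 1)) * β)) *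
        gProd c g β (c.omega ν / 2 + I * β / 2) *
        ((∏ j, xRatio c lam β (x j) (c.omega ν / 2 + I * β / 2)) *
        ∏ k, yRatio c lam β (y k) (c.omega ν / 2 + I * β / 2)) /
        (2 * exp (2 * I * c.rXi ν * c.omega ν) * exp (2 * I * c.rXi ν * (I * (1 - lam) * β)) *
          c.s (I * (1 - lam) * β)) := by
    rw [V0_eq, Finset.mul_sum]
    refine congrArg Neg.neg (Finset.sum_congr rfl fun ν _ => ?_)
    rw [div_mul_div_comm, prefactor_div_prod hc, div_mul_eq_mul_div, mul_div_assoc',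
      mul_div_mul_left _ _ hP]
  have hp : conj (I * β / 2 : ℂ) = -(I * β / 2) := by simp [map_ofNat]; ring
  rw [main, main, neg_neg, map_neg, map_sum, ← Finset.sum_neg_distrib]
  refine Finset.sum_congr rfl fun ν _ => ?_
  have e1 : conj (exp (-(c.rXi ν *
      (2 * lam * N - 2 * M + ∑ μ, g μ - 1 / 2 * (c.rho + 1) * (lam + 1)) * β) : ℂ)) =
      exp (-(c.rXi ν *
      (2 * lam * N - 2 * M + ∑ μ, g μ - 1 / 2 * (c.rho + 1) * (lam + 1)) * β)) := by
    rw [← Complex.exp_conj]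
    simp [map_ofNat]
  have e2 : conj (exp (2 * I * c.rXi ν * (I * (1 - lam) * β))) =
      exp (2 * I * c.rXi ν * (I * (1 - lam) * β)) := by
    rw [← Complex.exp_conj]
    simp [map_ofNat]
  have e3 : conj (c.s (I * (1 - lam) * β)) = -c.s (I * (1 - lam) * β) := by
    rw [Model.s_conj hc, ← Model.s_neg hc]
    simp
  simp only [map_div₀, map_mul, map_prod, e1, e2, e3, Model.conj_exp_rXi_omega hc,
    conj_gProd_half_omega hc g β hp, map_ofNat]
  have e4 (j) : conj (xRatio c lam β (conjVec x j) (c.omega ν / 2 + I * β / 2)) =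
      xRatio c lam β (x j) (c.omega ν / 2 + I * β / 2) :=
    conj_pairRatio_half_omega hc (by simp) (by simp) hp _ _
  have e5 (k) : conj (yRatio c lam β (conjVec y k) (c.omega ν / 2 + I * β / 2)) =
      yRatio c lam β (y k) (c.omega ν / 2 + I * β / 2) :=
    conj_pairRatio_half_omega hc (by simp [map_ofNat]; ring) (by simp [map_ofNat]; ring) hp _ _
  simp only [e4, e5, mul_neg, div_neg, neg_neg]

/-- The couplings `g'_ν` of the operator with the two groups of variables exchanged. -/
def dualCoupling {n : ℕ} (g : Fin n → ℝ) (lam : ℝ) : Fin n → ℝ :=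
  fun ν => (lam + 1 - 2 * g ν) / (2 * lam)

omit hc in
lemma dualCoupling_dualCoupling {lam : ℝ} (hlam : lam ≠ 0) :
    dualCoupling (dualCoupling g lam) (1 / lam) = g := by
  funext ν
  unfold dualCoupling
  field_simp
  ring

/-- The duality between the two kinds of variables. The sign `ε` is reversed because the shifts in
`x` and `y` are defined with opposite signs. -/
lemma Vt_eq_V {lam : ℝ} (hlam : lam ≠ 0) (ε : ℤˣ) (k : Fin M) :
    Vt c g lam β ε k x y = V c (dualCoupling g lam) (1 / lam) (lam * β) (-ε) k y x := by
  have hl : (lam : ℂ) ≠ 0 := by exact_mod_cast hlam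
  have hε : sg (-ε) = -sg ε := by simp [sg]
  unfold Vt V
  congr 1
  · congr 1
    · have key (ν) : c.s (sg ε * y k + I * ((lam + 1) / 2 - g ν) * β) =
          -1 * c.s (sg (-ε) * y k - I * dualCoupling g lam ν * (lam * β : ℝ)) := by
        rw [neg_one_mul, ← Model.s_neg hc, hε, dualCoupling]
        congr 1
        push_cast
        field_simp
        ring
      have h1 : (-1 : ℂ) ^ (2 * c.rho + 2) = 1 := by
        rw [← mul_add_one, pow_mul, neg_one_sq, one_pow]
      rw [Finset.prod_congr rfl fun ν _ => key ν, Finset.prod_mul_distrib,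
        Finset.prod_const, Finset.card_univ, Fintype.card_fin, h1, one_mul]
    · rw [hε, show -sg ε * (2 * y k) = -(sg ε * (2 * y k)) by ring,
        show -(sg ε * (2 * y k)) - I * (lam * β : ℝ) = -(sg ε * (2 * y k) + I * lam * β) by
          push_cast; ring, Model.s_neg hc, Model.s_neg hc, neg_mul_neg]
  · have e1 : sg (-ε) * (I * (1 / lam : ℝ) * (lam * β : ℝ)) = -(sg ε * (I * β)) := by
      rw [hε]; push_cast; field_simp
    have e2 : sg (-ε) * (I * ((1 / lam : ℝ) - 1) * (lam * β : ℝ) / 2) =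
        sg ε * (I * (lam - 1) * β / 2) := by
      rw [hε]; push_cast; field_simp; ring
    have e3 : sg (-ε) * (I * ((1 / lam : ℝ) + 1) * (lam * β : ℝ) / 2) =
        -(sg ε * (I * (lam + 1) * β / 2)) := by
      rw [hε]; push_cast; field_simp; ring
    simp only [e1, e2, e3, sub_neg_eq_add]

end Conj

end DeformedVanDiejen

end


noncomputable section

namespace DeformedVanDiejen

/-! ### The weight as a product of even functions -/

section Weight

variable (c : Model) (G : ℂ → ℂ → ℂ)

/-- `G(2 t + iβ/2) / ∏ ν, G(t + iβ/2 - i g_ν β)`. -/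
def singleHalf (g : Fin (2 * c.rho + 2) → ℝ) (β : ℝ) (t : ℂ) : ℂ :=
  G (2 * t + I * β / 2) β / ∏ ν, G (t + I * β / 2 - I * g ν * β) β

/-- `G(t + iβ/2) / G(t - iλβ + iβ/2)`. -/
def pairHalf (lam β : ℝ) (t : ℂ) : ℂ :=
  G (t + I * β / 2) β / G (t - I * lam * β + I * β / 2) β

/-- The factor of two variables of the same kind in the weight. -/
def pairFactor (lam β : ℝ) (t w : ℂ) : ℂ :=
  (pairHalf G lam β (t + w) * pairHalf G lam β (t - w)) *
    (pairHalf G lam β (-t + w) * pairHalf G lam β (-t - w))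

/-- The reciprocal of the factor of two variables of different kinds in the weight. -/
def mixedFactor (lam β : ℝ) (t w : ℂ) : ℂ :=
  (c.s (t + w - I * (lam - 1) * β / 2) * c.s (t - w - I * (lam - 1) * β / 2)) *
    (c.s (-t + w - I * (lam - 1) * β / 2) * c.s (-t - w - I * (lam - 1) * β / 2))

/-- The part of the weight that involves variables of a single kind. -/
def weightPart {n : ℕ} (g : Fin (2 * c.rho + 2) → ℝ) (lam β : ℝ) (x : Fin n → ℂ) : ℂ :=
  (∏ j, singleHalf c G g β (x j) * singleHalf c G g β (-x j)) *
    ∏ j, ∏ k ∈ Finset.Ioi j, pairFactor G lam β (x j) (x k)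

/-- The weight as a function of two groups of variables. -/
def pairWeight {N M : ℕ} (g : Fin (2 * c.rho + 2) → ℝ) (lam β : ℝ) (x : Fin N → ℂ)
    (y : Fin M → ℂ) : ℂ :=
  weightPart c G g lam β x * weightPart c G (dualCoupling g lam) (1 / lam) (lam * β) y /
    ∏ j, ∏ k, mixedFactor c lam β (x j) (y k)

lemma cpow_half_sq (b : ℂ) : (b ^ (1 / 2 : ℂ)) ^ 2 = b := by
  simp

lemma Psi_neg {n : ℕ} (g : Fin (2 * c.rho + 2) → ℝ) (lam β : ℝ) (x : Fin n → ℂ) :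
    Psi c G g lam β (fun j => -x j) = Psi c G g lam β x := by
  unfold Psi
  congr 1
  · refine Finset.prod_congr rfl fun j _ => ?_
    rw [mul_neg, neg_neg, neg_neg, mul_comm (G (-(2 * x j) + _) _)]
    congr 2
    exact Finset.prod_congr rfl fun ν _ => mul_comm _ _
  · refine Finset.prod_congr rfl fun j _ => Finset.prod_congr rfl fun k _ => ?_
    simp only [prod_units, sg_one, sg_neg_one, one_mul, neg_mul, neg_neg]
    ring

lemma Psi_sq {n : ℕ} (g : Fin (2 * c.rho + 2) → ℝ) (lam β : ℝ) (x : Fin n → ℂ) :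
    Psi c G g lam β x ^ 2 = weightPart c G g lam β x := by
  unfold Psi weightPart
  rw [mul_pow, ← Finset.prod_pow, ← Finset.prod_pow]
  congr 1
  · refine Finset.prod_congr rfl fun j _ => ?_
    rw [cpow_half_sq, singleHalf, singleHalf, div_mul_div_comm, Finset.prod_mul_distrib, mul_neg]
  · refine Finset.prod_congr rfl fun j _ => ?_
    rw [← Finset.prod_pow]
    refine Finset.prod_congr rfl fun k _ => ?_
    simp only [prod_units, mul_pow, cpow_half_sq, sg_one, sg_neg_one, one_mul, neg_mul,
      pairFactor, pairHalf, ← sub_eq_add_neg]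

/-- `Ψ` is even, so the weight is `Ψ²`; since `(b^(1/2))² = b` for the principal root, no choice of
branch survives. -/
lemma weight_eq (hc : c.Positive) {N M : ℕ} (g : Fin (2 * c.rho + 2) → ℝ) (lam β : ℝ)
    (z : Fin N ⊕ Fin M → ℂ) :
    weight c G g lam β z =
      pairWeight c G g lam β (fun j => z (.inl j)) (fun k => z (.inr k)) := by
  have h1 : PsiDeformed c G g lam β (-z) = PsiDeformed c G g lam β z := by
    unfold PsiDeformed
    congr 1
    · exact congrArg₂ _ (Psi_neg c G _ _ _ fun j => z (.inl j))
        (Psi_neg c G _ _ _ fun j => z (.inr j))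
    · refine Finset.prod_congr rfl fun j _ => Finset.prod_congr rfl fun δ _ =>
        Finset.prod_congr rfl fun k _ => ?_
      congr 1
      rw [Pi.neg_apply, Pi.neg_apply,
        show -z (.inl j) + sg δ * -z (.inr k) + I * (lam - 1) * β / 2 =
          -(z (.inl j) + sg δ * z (.inr k) - I * (lam - 1) * β / 2) by ring,
        show -z (.inl j) + sg δ * -z (.inr k) - I * (lam - 1) * β / 2 =
          -(z (.inl j) + sg δ * z (.inr k) + I * (lam - 1) * β / 2) by ring,
        Model.s_neg hc, Model.s_neg hc]
      ring
  rw [weight, h1, ← pow_two, PsiDeformed, div_pow, mul_pow, Psi_sq, Psi_sq, pairWeight]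
  congr 1
  rw [← Finset.prod_pow]
  refine Finset.prod_congr rfl fun j _ => ?_
  rw [← Finset.prod_pow, prod_units, ← Finset.prod_pow, ← Finset.prod_pow,
    ← Finset.prod_mul_distrib]
  refine Finset.prod_congr rfl fun k _ => ?_
  simp only [cpow_half_sq, sg_one, sg_neg_one, one_mul, neg_mul, mixedFactor]
  rw [show -z (.inl j) + z (.inr k) - I * (lam - 1) * β / 2 =
      -(z (.inl j) + -z (.inr k) + I * (lam - 1) * β / 2) by ring,
    show -z (.inl j) - z (.inr k) - I * (lam - 1) * β / 2 =
      -(z (.inl j) + z (.inr k) + I * (lam - 1) * β / 2) by ring,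
    Model.s_neg hc, Model.s_neg hc, ← sub_eq_add_neg]
  ring

/-- The couplings `g'` are an involution under `λ ↦ 1/λ`, and the mixed factor only sees the sign of
`i(λ-1)β/2` change, which oddness absorbs in its four factors. The difference equation in `y` thus
reduces to the one in `x`. -/
lemma pairWeight_swap (hc : c.Positive) {N M : ℕ} (g : Fin (2 * c.rho + 2) → ℝ) {lam : ℝ}
    (hlam : lam ≠ 0) (β : ℝ) (x : Fin N → ℂ) (y : Fin M → ℂ) :
    pairWeight c G g lam β x y =
      pairWeight c G (dualCoupling g lam) (1 / lam) (lam * β) y x := by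
  have hl : (lam : ℂ) ≠ 0 := by exact_mod_cast hlam
  unfold pairWeight
  rw [dualCoupling_dualCoupling g hlam, one_div_one_div, one_div, inv_mul_cancel_left₀ hlam,
    mul_comm (weightPart c G g lam β x), Finset.prod_comm]
  congr 1
  refine Finset.prod_congr rfl fun k _ => Finset.prod_congr rfl fun j _ => ?_
  unfold mixedFactor
  have e : I * ((lam⁻¹ : ℝ) - 1) * (lam * β : ℝ) / 2 = -(I * (lam - 1) * β / 2) := by
    push_cast; field_simp; ring
  rw [e]
  generalize I * (lam - 1) * β / 2 = q
  rw [show y k + x j - -q = -(-x j - y k - q) by ring, show y k - x j - -q = -(x j - y k - q) by ring,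
    show -y k + x j - -q = -(-x j + y k - q) by ring,
    show -y k - x j - -q = -(x j + y k - q) by ring]
  simp only [Model.s_neg hc]
  ring

lemma pairFactor_comm (lam β : ℝ) (t w : ℂ) : pairFactor G lam β t w = pairFactor G lam β w t := by
  unfold pairFactor
  rw [add_comm w t, ← sub_eq_neg_add w t, ← sub_eq_neg_add t w]
  rw [show -w - t = -t - w by ring]
  ring

end Weight

/-- `R` collects the pairs that avoid the index `j`. Symmetry of `F` is needed for the pairs in
which `j` is the larger index. -/
lemma exists_prod_Ioi_update {n : ℕ} {γ : Type*} [CommMonoid γ] (F : ℂ → ℂ → γ)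
    (hF : ∀ t w, F t w = F w t) (x : Fin n → ℂ) (j : Fin n) :
    ∃ R, ∀ t, ∏ i, ∏ k ∈ Finset.Ioi i, F (Function.update x j t i) (Function.update x j t k) =
      R * ∏ i ∈ Finset.univ.erase j, F t (x i) := by
  refine ⟨∏ i ∈ Finset.univ.erase j, ∏ k ∈ (Finset.Ioi i).erase j, F (x i) (x k), fun t => ?_⟩
  have h1 : ∏ k ∈ Finset.Ioi j, F (Function.update x j t j) (Function.update x j t k) =
      ∏ i ∈ Finset.univ.erase j, if j < i then F t (x i) else 1 := by
    rw [← Finset.prod_filter]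
    have : (Finset.univ.erase j).filter (j < ·) = Finset.Ioi j := by
      ext i; simp only [Finset.mem_filter, Finset.mem_erase, Finset.mem_univ, Finset.mem_Ioi]
      exact ⟨fun h => h.2, fun h => ⟨⟨h.ne', trivial⟩, h⟩⟩
    rw [this]
    refine Finset.prod_congr rfl fun k hk => ?_
    rw [Function.update_self, Function.update_of_ne (Finset.mem_Ioi.1 hk).ne']
  have h2 (i) (hi : i ∈ Finset.univ.erase j) :
      ∏ k ∈ Finset.Ioi i, F (Function.update x j t i) (Function.update x j t k) =
      (∏ k ∈ (Finset.Ioi i).erase j, F (x i) (x k)) * if i < j then F t (x i) else 1 := by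
    have hij := Finset.ne_of_mem_erase hi
    rw [Function.update_of_ne hij]
    have h3 : ∏ k ∈ (Finset.Ioi i).erase j, F (x i) (Function.update x j t k) =
        ∏ k ∈ (Finset.Ioi i).erase j, F (x i) (x k) :=
      Finset.prod_congr rfl fun k hk => by rw [Function.update_of_ne (Finset.ne_of_mem_erase hk)]
    split_ifs with h
    · rw [← Finset.prod_erase_mul _ _ (Finset.mem_Ioi.2 h), h3, Function.update_self, hF]
    · rw [← h3, mul_one, Finset.erase_eq_of_notMem (by simpa using h)]
  rw [← Finset.mul_prod_erase _ _ (Finset.mem_univ j), h1, Finset.prod_congr rfl h2,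
    Finset.prod_mul_distrib, mul_left_comm, ← Finset.prod_mul_distrib]
  congr 1
  refine Finset.prod_congr rfl fun i hi => ?_
  rcases lt_or_gt_of_ne (Finset.ne_of_mem_erase hi) with h | h
  · rw [if_neg h.asymm, if_pos h, one_mul]
  · rw [if_pos h, if_neg h.asymm, mul_one]

lemma exists_prod_update {n : ℕ} {γ : Type*} [CommMonoid γ] (F : ℂ → γ) (x : Fin n → ℂ)
    (j : Fin n) : ∃ R, ∀ t, ∏ i, F (Function.update x j t i) = R * F t := by
  refine ⟨∏ i ∈ Finset.univ.erase j, F (x i), fun t => ?_⟩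
  rw [← Finset.prod_erase_mul _ _ (Finset.mem_univ j), Function.update_self]
  congr 1
  exact Finset.prod_congr rfl fun k hk => by rw [Function.update_of_ne (Finset.ne_of_mem_erase hk)]

section Local

variable (c : Model) (G : ℂ → ℂ → ℂ) {N M : ℕ} (g : Fin (2 * c.rho + 2) → ℝ) (lam β : ℝ)
  (x : Fin N → ℂ) (y : Fin M → ℂ) (j : Fin N)

/-- The dependence of the weight on `x_j = t` is through `halfWeight t * halfWeight (-t)`. -/
def halfWeight (t : ℂ) : ℂ :=
  singleHalf c G g β t *
    ((∏ i ∈ Finset.univ.erase j, pairHalf G lam β (t + x i) * pairHalf G lam β (t - x i)) *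
      ∏ k, (c.s (t + y k - I * (lam - 1) * β / 2) * c.s (t - y k - I * (lam - 1) * β / 2))⁻¹)

lemma exists_pairWeight_update : ∃ R, ∀ t, pairWeight c G g lam β (Function.update x j t) y =
    R * (halfWeight c G g lam β x y j t * halfWeight c G g lam β x y j (-t)) := by
  obtain ⟨R₁, h1⟩ := exists_prod_update
    (fun t => singleHalf c G g β t * singleHalf c G g β (-t)) x j
  obtain ⟨R₂, h2⟩ := exists_prod_Ioi_update (pairFactor G lam β) (pairFactor_comm G lam β) x j
  obtain ⟨R₃, h3⟩ := exists_prod_update (fun t => ∏ k, mixedFactor c lam β t (y k)) x j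
  refine ⟨R₁ * R₂ * weightPart c G (dualCoupling g lam) (1 / lam) (lam * β) y / R₃, fun t => ?_⟩
  rw [pairWeight, weightPart, h1, h2, h3]
  simp only [pairFactor, mixedFactor, halfWeight, Finset.prod_mul_distrib, Finset.prod_inv_distrib,
    mul_inv]
  simp only [div_eq_mul_inv, mul_inv]
  ring

end Local

end DeformedVanDiejen

end


noncomputable section

namespace DeformedVanDiejen

/-! ### The difference equation of the weight -/

/-- The difference equation of `G` holds at `u`, without zeros or poles. -/
structure GoodAt (c : Model) (G : ℂ → ℂ → ℂ) (β : ℝ) (κ u : ℂ) : Prop where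
  s_ne : c.s u ≠ 0
  ne : G (u - I * β / 2) β ≠ 0
  eq : G (u + I * β / 2) β = κ * c.s u * G (u - I * β / 2) β

/-- The points `± u + h`, `h ∈ H`, are good. -/
def Tame (c : Model) (G : ℂ → ℂ → ℂ) (H : AddSubgroup ℂ) (β : ℝ) (κ u : ℂ) : Prop :=
  ∀ h ∈ H, ∀ ε : ℤˣ, GoodAt c G β κ (sg ε * u + h)

/-- The points where the equation of `G` fails have codiscrete complement and are countable; so are
the zeros of `s`. All their translates by the countable group `H`, with both signs, still form a
countable set. -/
lemma exists_tame {c : Model} (hc : c.Positive) {G : ℂ → ℂ → ℂ} (hG : IsGammaFunction c.s G)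
    {H : AddSubgroup ℂ} (hH : (H : Set ℂ).Countable) {β : ℝ} (hβ : β ≠ 0) :
    ∃ κ : ℂ, κ ≠ 0 ∧ ∃ B : Set ℂ, B.Countable ∧ ∀ u ∉ B, Tame c G H β κ u := by
  obtain ⟨-, κ, hκ, h⟩ := hG β (by simpa using hβ)
  set B₀ : Set ℂ := {x | G (x + I * β / 2) β / G (x - I * β / 2) β = κ * c.s x}ᶜ ∪ {x | c.s x = 0}
    with hB₀def
  have hB₀ : B₀.Countable :=
    (countable_compl_of_mem_codiscrete h).union (Model.countable_s_zeros hc)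
  have hgood (u : ℂ) (hu : u ∉ B₀) : GoodAt c G β κ u := by
    rw [hB₀def, Set.mem_union, not_or, Set.notMem_compl_iff] at hu
    obtain ⟨h1, h2⟩ := hu
    have h1 : G (u + I * β / 2) β / G (u - I * β / 2) β = κ * c.s u := h1
    have h2 : c.s u ≠ 0 := h2
    -- Division by zero gives `0`, whereas the right-hand side `κ s(u)` of the difference equation
    -- is nonzero; so the denominator cannot vanish.
    have h3 : G (u - I * β / 2) β ≠ 0 := fun h0 => by
      rw [h0, div_zero] at h1
      exact mul_ne_zero hκ h2 h1.symm
    exact ⟨h2, h3, (div_eq_iff h3).1 h1⟩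
  refine ⟨κ, hκ, ⋃ h ∈ (H : Set ℂ), ⋃ ε : ℤˣ, (fun u => sg ε * u + h) ⁻¹' B₀,
    hH.biUnion fun h _ => Set.countable_iUnion fun ε => hB₀.preimage ?_, fun u hu h hh ε => ?_⟩
  · intro u v huv
    rcases Int.units_eq_one_or ε with rfl | rfl <;> simpa using huv
  · refine hgood _ fun hB => hu ?_
    simp only [Set.mem_iUnion]
    exact ⟨h, hh, ε, hB⟩

/-- `H` contains the shifts that occur in the operator and in the weight. -/
structure ContainsShifts (H : AddSubgroup ℂ) {n : ℕ} (g : Fin n → ℝ) (lam β : ℝ) : Prop where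
  half : I * β / 2 ∈ H
  half_lam : I * lam * β / 2 ∈ H
  coupling : ∀ ν, I * g ν * β ∈ H

section ContainsShifts

variable {H : AddSubgroup ℂ} {n : ℕ} {g : Fin n → ℝ} {lam β : ℝ} (hH : ContainsShifts H g lam β)

include hH

lemma ContainsShifts.step : I * β ∈ H := by
  have := H.add_mem hH.half hH.half
  rwa [add_halves] at this

lemma ContainsShifts.step_lam : I * lam * β ∈ H := by
  have := H.add_mem hH.half_lam hH.half_lam
  rwa [add_halves] at this

lemma ContainsShifts.half_sub : I * (lam - 1) * β / 2 ∈ H := by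
  have := H.sub_mem hH.half_lam hH.half
  rwa [show I * lam * β / 2 - I * β / 2 = I * (lam - 1) * β / 2 by ring] at this

lemma ContainsShifts.dual (hlam : lam ≠ 0) :
    ContainsShifts H (dualCoupling g lam) (1 / lam) (lam * β) := by
  have hl : (lam : ℂ) ≠ 0 := by exact_mod_cast hlam
  refine ⟨?_, ?_, fun ν => ?_⟩
  · simpa [mul_assoc] using hH.half_lam
  · have : I * (1 / lam : ℝ) * (lam * β : ℝ) / 2 = I * β / 2 := by push_cast; field_simp
    rw [this]; exact hH.half
  · have : I * dualCoupling g lam ν * (lam * β : ℝ) =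
        I * β / 2 + I * lam * β / 2 - I * g ν * β := by
      unfold dualCoupling; push_cast; field_simp; ring
    rw [this]
    exact H.sub_mem (H.add_mem hH.half hH.half_lam) (hH.coupling ν)

end ContainsShifts

lemma exists_countable_containsShifts {n : ℕ} (g : Fin n → ℝ) (lam β : ℝ) :
    ∃ H : AddSubgroup ℂ, (H : Set ℂ).Countable ∧ ContainsShifts H g lam β := by
  let v : Option (Option (Fin n)) → ℂ
    | none => I * β / 2
    | some none => I * lam * β / 2
    | some (some ν) => I * g ν * β
  have hv (i) : v i ∈ AddSubgroup.closure (Set.range v) := AddSubgroup.subset_closure ⟨i, rfl⟩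
  exact ⟨_, countable_closure_range v, hv none, hv (some none), fun ν => hv (some (some ν))⟩

section Local

variable {c : Model} {G : ℂ → ℂ → ℂ} {β : ℝ} {κ : ℂ}

/-- The argument `2u` moves by two steps, which yields `κ²` and both denominators of `V`; each
coupling factor moves by one step, which yields `κ^(2ρ+2)` and the product of the `s(z - i g_ν β)`.
-/
lemma singleHalf_add (hκ : κ ≠ 0) (g : Fin (2 * c.rho + 2) → ℝ) {u : ℂ}
    (h1 : GoodAt c G β κ (2 * u + I * β)) (h2 : GoodAt c G β κ (2 * u + 2 * (I * β)))
    (h3 : ∀ ν, GoodAt c G β κ (u + I * β - I * g ν * β)) :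
    singleHalf c G g β (u + I * β) * (gProd c g β (u + I * β) /
      (c.s (2 * (u + I * β)) * c.s (2 * (u + I * β) - I * β))) =
      κ ^ 2 / κ ^ (2 * c.rho + 2) * singleHalf c G g β u := by
  have e1 := h1.eq
  have e2 := h2.eq
  rw [show 2 * u + I * β - I * β / 2 = 2 * u + I * β / 2 by ring] at e1
  rw [show 2 * u + 2 * (I * β) - I * β / 2 = 2 * u + I * β + I * β / 2 by ring, e1] at e2
  have e3 : ∏ ν, G (u + I * β + I * β / 2 - I * g ν * β) β =
      κ ^ (2 * c.rho + 2) * gProd c g β (u + I * β) * ∏ ν, G (u + I * β / 2 - I * g ν * β) β := by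
    have key (ν) : G (u + I * β + I * β / 2 - I * g ν * β) β =
        κ * c.s (u + I * β - I * g ν * β) * G (u + I * β / 2 - I * g ν * β) β := by
      have := (h3 ν).eq
      rwa [show u + I * β - I * g ν * β + I * β / 2 = u + I * β + I * β / 2 - I * g ν * β by ring,
        show u + I * β - I * g ν * β - I * β / 2 = u + I * β / 2 - I * g ν * β by ring] at this
    rw [Finset.prod_congr rfl fun ν _ => key ν, Finset.prod_mul_distrib, Finset.prod_mul_distrib,
      Finset.prod_const, Finset.card_univ, Fintype.card_fin, gProd]
  have hg : gProd c g β (u + I * β) ≠ 0 := Finset.prod_ne_zero_iff.2 fun ν _ => (h3 ν).s_ne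
  have n1 := h1.s_ne
  have n2 := h2.s_ne
  unfold singleHalf
  rw [e3, show 2 * (u + I * β) + I * β / 2 = 2 * u + 2 * (I * β) + I * β / 2 by ring, e2,
    show 2 * (u + I * β) - I * β = 2 * u + I * β by ring,
    show 2 * (u + I * β) = 2 * u + 2 * (I * β) by ring]
  generalize c.s (2 * u + 2 * (I * β)) = s₂ at *
  generalize c.s (2 * u + I * β) = s₁ at *
  generalize gProd c g β (u + I * β) = p at *
  generalize ∏ ν, G (u + I * β / 2 - I * g ν * β) β = q
  generalize G (2 * u + I * β / 2) β = r
  have := pow_ne_zero (2 * c.rho + 2) hκ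
  generalize κ ^ (2 * c.rho + 2) = k at *
  rw [div_mul_div_comm, div_mul_div_comm, show κ * s₂ * (κ * s₁ * r) * p = s₂ * s₁ * p * (κ ^ 2 * r)
    by ring, show k * p * q * (s₂ * s₁) = s₂ * s₁ * p * (k * q) by ring]
  exact mul_div_mul_left _ _ (mul_ne_zero (mul_ne_zero n2 n1) hg)

lemma pairHalf_add (hκ : κ ≠ 0) {lam : ℝ} {u : ℂ} (h1 : GoodAt c G β κ (u + I * β))
    (h2 : GoodAt c G β κ (u + I * β - I * lam * β)) :
    pairHalf G lam β (u + I * β) * (c.s (u + I * β - I * lam * β) / c.s (u + I * β)) =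
      pairHalf G lam β u := by
  have n1 := h1.s_ne
  have n2 := h2.s_ne
  have e1 := h1.eq
  have e2 := h2.eq
  unfold pairHalf
  rw [e1, e2, show u + I * β - I * β / 2 = u + I * β / 2 by ring,
    show u + I * β - I * lam * β - I * β / 2 = u - I * lam * β + I * β / 2 by ring]
  generalize c.s (u + I * β) = s₁ at *
  generalize c.s (u + I * β - I * lam * β) = s₂ at *
  rw [div_mul_div_comm]
  generalize G (u + I * β / 2) β = p
  generalize G (u - I * lam * β + I * β / 2) β = q
  rw [show κ * s₁ * p * s₂ = κ * s₁ * s₂ * p by ring,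
    show κ * s₂ * q * s₁ = κ * s₁ * s₂ * q by ring]
  exact mul_div_mul_left _ _ (mul_ne_zero (mul_ne_zero hκ n1) n2)

end Local

/-- Genericity of a point with respect to the difference equation of step `iβ`. -/
structure TamePoint (c : Model) (G : ℂ → ℂ → ℂ) (H : AddSubgroup ℂ) (β : ℝ) (κ : ℂ) {N M : ℕ}
    (x : Fin N → ℂ) (y : Fin M → ℂ) : Prop where
  single : ∀ j, Tame c G H β κ (x j)
  double : ∀ j, Tame c G H β κ (2 * x j)
  pair : ∀ j i, j ≠ i → ∀ δ : ℤˣ, Tame c G H β κ (x j + sg δ * x i)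
  mixed : ∀ j k, ∀ δ : ℤˣ, Tame c G H β κ (x j + sg δ * y k)

section Point

variable {c : Model} (hc : c.Positive) {G : ℂ → ℂ → ℂ} {H : AddSubgroup ℂ} {lam β : ℝ} {κ : ℂ}
  {N M : ℕ} {g : Fin (2 * c.rho + 2) → ℝ} {x : Fin N → ℂ} {y : Fin M → ℂ}
  (hH : ContainsShifts H g lam β) (hz : TamePoint c G H β κ x y)

lemma sg_mul_sg (ε : ℤˣ) : sg ε * sg ε = 1 := by
  rcases Int.units_eq_one_or ε with rfl | rfl <;> simp

lemma sg_neg (ε : ℤˣ) : sg (-ε) = -sg ε := by simp [sg]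

include hH hz

/-- Up to a constant independent of `u`, the factors of `V` form the ratio of `halfWeight` at `u`
and at `u + iβ`. The freedom in `h` and `ε` allows both orientations of the step to be used. -/
lemma halfWeight_add (hκ : κ ≠ 0) (j : Fin N) (ε : ℤˣ) {h : ℂ} (hh : h ∈ H) {u : ℂ}
    (hu : u = sg ε * x j + h) :
    halfWeight c G g lam β x y j (u + I * β) * (gProd c g β (u + I * β) /
      (c.s (2 * (u + I * β)) * c.s (2 * (u + I * β) - I * β)) *
      ((∏ i ∈ Finset.univ.erase j, xRatio c lam β (x i) (u + I * β)) *
        ∏ k, yRatio c lam β (y k) (u + I * β))) =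
      κ ^ 2 / κ ^ (2 * c.rho + 2) * halfWeight c G g lam β x y j u := by
  have hε := sg_mul_sg ε
  have A1 (q : ℂ) (hq : q ∈ H) : GoodAt c G β κ (u + q) := by
    have := hz.single j _ (H.add_mem hh hq) ε
    rwa [← add_assoc, ← hu] at this
  have A2 (q : ℂ) (hq : q ∈ H) : GoodAt c G β κ (2 * u + q) := by
    have := hz.double j _ (H.add_mem (H.add_mem hh hh) hq) ε
    rwa [show sg ε * (2 * x j) + (h + h + q) = 2 * u + q by rw [hu]; ring] at this
  have A3 (i : Fin N) (hi : i ∈ Finset.univ.erase j) (q : ℂ) (hq : q ∈ H) :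
      GoodAt c G β κ (u + x i + q) ∧ GoodAt c G β κ (u - x i + q) := by
    have hij := (Finset.ne_of_mem_erase hi).symm
    have h1 := hz.pair j i hij ε _ (H.add_mem hh hq) ε
    have h2 := hz.pair j i hij (-ε) _ (H.add_mem hh hq) ε
    rw [show sg ε * (x j + sg ε * x i) + (h + q) = u + x i + q by
      rw [hu]; linear_combination (x i) * hε] at h1
    rw [sg_neg, show sg ε * (x j + -sg ε * x i) + (h + q) = u - x i + q by
      rw [hu]; linear_combination -(x i) * hε] at h2
    exact ⟨h1, h2⟩
  have A4 (k : Fin M) (q : ℂ) (hq : q ∈ H) :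
      c.s (u + y k + q) ≠ 0 ∧ c.s (u - y k + q) ≠ 0 := by
    have h1 := hz.mixed j k ε _ (H.add_mem hh hq) ε
    have h2 := hz.mixed j k (-ε) _ (H.add_mem hh hq) ε
    rw [show sg ε * (x j + sg ε * y k) + (h + q) = u + y k + q by
      rw [hu]; linear_combination (y k) * hε] at h1
    rw [sg_neg, show sg ε * (x j + -sg ε * y k) + (h + q) = u - y k + q by
      rw [hu]; linear_combination -(y k) * hε] at h2
    exact ⟨h1.s_ne, h2.s_ne⟩
  have B1 := singleHalf_add hκ g (u := u) (A2 _ hH.step)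
    (A2 _ (by rw [two_mul]; exact H.add_mem hH.step hH.step))
    (fun ν => by rw [add_sub_assoc]; exact A1 _ (H.sub_mem hH.step (hH.coupling ν)))
  have B2 (i : Fin N) (hi : i ∈ Finset.univ.erase j) :
      pairHalf G lam β (u + I * β + x i) * pairHalf G lam β (u + I * β - x i) *
        xRatio c lam β (x i) (u + I * β) =
      pairHalf G lam β (u + x i) * pairHalf G lam β (u - x i) := by
    have h3 := H.sub_mem hH.step hH.step_lam
    have e1 := pairHalf_add hκ (A3 i hi _ hH.step).1 (lam := lam)
      (by rw [add_sub_assoc]; exact (A3 i hi _ h3).1)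
    have e2 := pairHalf_add hκ (A3 i hi _ hH.step).2 (lam := lam)
      (by rw [add_sub_assoc]; exact (A3 i hi _ h3).2)
    rw [← e1, ← e2, xRatio, pairRatio, sub_zero, sub_zero, add_right_comm u (x i),
      show u - x i + I * β = u + I * β - x i by ring]
    simp only [div_eq_mul_inv, mul_inv]
    ring
  have B3 (k : Fin M) :
      (c.s (u + I * β + y k - I * (lam - 1) * β / 2) *
        c.s (u + I * β - y k - I * (lam - 1) * β / 2))⁻¹ * yRatio c lam β (y k) (u + I * β) =
      (c.s (u + y k - I * (lam - 1) * β / 2) * c.s (u - y k - I * (lam - 1) * β / 2))⁻¹ := by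
    obtain ⟨n1, n2⟩ := A4 k _ (H.sub_mem hH.step hH.half_sub)
    rw [show u + y k + (I * β - I * (lam - 1) * β / 2) =
      u + I * β + y k - I * (lam - 1) * β / 2 by ring] at n1
    rw [show u - y k + (I * β - I * (lam - 1) * β / 2) =
      u + I * β - y k - I * (lam - 1) * β / 2 by ring] at n2
    rw [yRatio, pairRatio,
      show u + I * β - y k - I * (lam + 1) * β / 2 = u - y k - I * (lam - 1) * β / 2 by ring,
      show u + I * β + y k - I * (lam + 1) * β / 2 = u + y k - I * (lam - 1) * β / 2 by ring,
      mul_comm (c.s (u + I * β - y k - _)), mul_div_assoc', inv_mul_cancel₀ (mul_ne_zero n1 n2),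
      one_div, mul_comm (c.s (u - y k - _))]
  unfold halfWeight
  rw [mul_mul_mul_comm, B1, mul_assoc, mul_mul_mul_comm, ← Finset.prod_mul_distrib,
    ← Finset.prod_mul_distrib, Finset.prod_congr rfl B2, Finset.prod_congr rfl fun k _ => B3 k]

include hc

/-- In `halfWeight(t) * halfWeight(-t)` one factor moves forward by a step and the other backward.
The two applications of the difference equation produce `V^ε` at the shifted point and `V^{-ε}` at
the original one, with the same constant, which cancels. -/
lemma pairWeight_mul_V (hκ : κ ≠ 0) (ε : ℤˣ) (j : Fin N) :
    pairWeight c G g lam β (Function.update x j (x j + sg ε * (I * β))) y *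
        V c g lam β ε j (Function.update x j (x j + sg ε * (I * β))) y =
      V c g lam β (-ε) j x y * pairWeight c G g lam β x y := by
  have hε := sg_mul_sg ε
  obtain ⟨R, hR⟩ := exists_pairWeight_update c G g lam β x y j
  have hsymm (t : ℂ) : halfWeight c G g lam β x y j (sg ε * t) *
      halfWeight c G g lam β x y j (-(sg ε * t)) =
      halfWeight c G g lam β x y j t * halfWeight c G g lam β x y j (-t) := by
    rcases Int.units_eq_one_or ε with rfl | rfl
    · simp
    · simp [mul_comm]
  have h1 := hR (x j)
  rw [Function.update_eq_self, ← hsymm] at h1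
  have h2 := hR (x j + sg ε * (I * β))
  rw [← hsymm, show sg ε * (x j + sg ε * (I * β)) = sg ε * x j + I * β by
    linear_combination (I * β) * hε] at h2
  have k1 := halfWeight_add hH hz hκ j ε H.zero_mem (u := sg ε * x j) (by ring)
  -- The starting point is chosen one step before `-εx_j`, so that the step ends at the argument of
  -- `V^{-ε}`.
  have k2 := halfWeight_add hH hz hκ j (-ε) (H.neg_mem hH.step) (u := -(sg ε * x j) - I * β)
    (by rw [sg_neg]; ring)
  rw [sub_add_cancel] at k2
  rw [h1, h2, V_eq hc, V_eq hc, Function.update_self, sg_neg, neg_mul,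
    show sg ε * (x j + sg ε * (I * β)) = sg ε * x j + I * β by linear_combination (I * β) * hε,
    Finset.prod_congr rfl fun i hi => by
      rw [Function.update_of_ne (Finset.ne_of_mem_erase hi)],
    show -(sg ε * x j + I * β) = -(sg ε * x j) - I * β by ring]
  linear_combination (R * halfWeight c G g lam β x y j (-(sg ε * x j) - I * β)) * k1 -
    (R * halfWeight c G g lam β x y j (sg ε * x j)) * k2

omit hc in
lemma weightPart_ne_zero : weightPart c G g lam β x ≠ 0 := by
  have A (u : ℂ) (hu : Tame c G H β κ u) (q : ℂ) (hq : q ∈ H) (ε : ℤˣ) :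
      G (sg ε * u + q) β ≠ 0 := by
    have := (hu _ (H.add_mem hq hH.half) ε).ne
    rwa [← add_assoc, add_sub_cancel_right] at this
  have h1 (j : Fin N) (ε : ℤˣ) : singleHalf c G g β (sg ε * x j) ≠ 0 := by
    refine div_ne_zero ?_ (Finset.prod_ne_zero_iff.2 fun ν _ => ?_)
    · rw [mul_left_comm]
      exact A _ (hz.double j) _ hH.half ε
    · rw [add_sub_assoc]
      exact A _ (hz.single j) _ (H.sub_mem hH.half (hH.coupling ν)) ε
  have h2 (j k : Fin N) (hjk : j ≠ k) (ε δ : ℤˣ) :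
      pairHalf G lam β (sg ε * (x j + sg δ * x k)) ≠ 0 := by
    refine div_ne_zero (A _ (hz.pair j k hjk δ) _ hH.half ε) ?_
    rw [sub_add]
    have := A _ (hz.pair j k hjk δ) _ (H.sub_mem hH.half hH.step_lam) ε
    rwa [show sg ε * (x j + sg δ * x k) + (I * β / 2 - I * lam * β) =
      sg ε * (x j + sg δ * x k) - (I * lam * β - I * β / 2) by ring] at this
  refine mul_ne_zero (Finset.prod_ne_zero_iff.2 fun j _ => mul_ne_zero ?_ ?_)
    (Finset.prod_ne_zero_iff.2 fun j _ => Finset.prod_ne_zero_iff.2 fun k hk => ?_)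
  · simpa using h1 j 1
  · simpa using h1 j (-1)
  · have hjk := (Finset.mem_Ioi.1 hk).ne
    refine mul_ne_zero (mul_ne_zero ?_ ?_) (mul_ne_zero ?_ ?_)
    · simpa using h2 j k hjk 1 1
    · simpa [sub_eq_add_neg] using h2 j k hjk 1 (-1)
    · simpa [sub_eq_add_neg, add_comm] using h2 j k hjk (-1) (-1)
    · simpa [sub_eq_add_neg, add_comm] using h2 j k hjk (-1) 1

omit hc in
lemma pairWeight_ne_zero (hlam : lam ≠ 0) {κ' : ℂ} (hz' : TamePoint c G H (lam * β) κ' y x) :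
    pairWeight c G g lam β x y ≠ 0 := by
  refine div_ne_zero (mul_ne_zero (weightPart_ne_zero hH hz)
    (weightPart_ne_zero (hH.dual hlam) hz'))
    (Finset.prod_ne_zero_iff.2 fun j _ => Finset.prod_ne_zero_iff.2 fun k _ => ?_)
  have A (δ ε : ℤˣ) : c.s (sg ε * (x j + sg δ * y k) - I * (lam - 1) * β / 2) ≠ 0 := by
    rw [sub_eq_add_neg]
    exact (hz.mixed j k δ _ (H.neg_mem hH.half_sub) ε).s_ne
  refine mul_ne_zero (mul_ne_zero ?_ ?_) (mul_ne_zero ?_ ?_)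
  · simpa using A 1 1
  · simpa [sub_eq_add_neg] using A (-1) 1
  · simpa [sub_eq_add_neg, add_comm] using A (-1) (-1)
  · simpa [sub_eq_add_neg, add_comm] using A 1 (-1)

end Point

end DeformedVanDiejen

end


noncomputable section

namespace DeformedVanDiejen

/-! ### Formal anti-symmetry of the deformed operator -/

lemma Avoids.mono {ι : Type*} {B B' : Set ℂ} (h : B' ⊆ B) {z : ι → ℂ} (hz : Avoids B z) :
    Avoids B' z :=
  ⟨fun i hi => hz.single i (h hi), fun i hi => hz.double i (h hi),
    fun i i' hne δ hi => hz.pair i i' hne δ (h hi)⟩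

section

variable {c : Model} (hc : c.Positive) {N M : ℕ} (g : Fin (2 * c.rho + 2) → ℝ) (lam β : ℝ)
  (z : Fin N ⊕ Fin M → ℂ)

lemma sub_imag_single_inl (j : Fin N) (r : ℝ) :
    ((fun i => (z - imag (Pi.single (Sum.inl j) r) : Fin N ⊕ Fin M → ℂ) (Sum.inl i)) =
      Function.update (fun i => z (Sum.inl i)) j (z (Sum.inl j) - I * r)) ∧
    (fun k => (z - imag (Pi.single (Sum.inl j) r) : Fin N ⊕ Fin M → ℂ) (Sum.inr k)) = fun k => z (Sum.inr k) := by
  constructor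
  · funext i
    rcases eq_or_ne i j with rfl | h
    · simp [imag]
    · simp [imag, Function.update_of_ne h, Pi.single_eq_of_ne (Sum.inl_injective.ne h)]
  · funext k
    simp [imag]

lemma sub_imag_single_inr (k : Fin M) (r : ℝ) :
    ((fun i => (z - imag (Pi.single (Sum.inr k) r) : Fin N ⊕ Fin M → ℂ) (Sum.inr i)) =
      Function.update (fun i => z (Sum.inr i)) k (z (Sum.inr k) - I * r)) ∧
    (fun j => (z - imag (Pi.single (Sum.inr k) r) : Fin N ⊕ Fin M → ℂ) (Sum.inl j)) = fun j => z (Sum.inl j) := by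
  constructor
  · funext i
    rcases eq_or_ne i k with rfl | h
    · simp [imag]
    · simp [imag, Function.update_of_ne h, Pi.single_eq_of_ne (Sum.inr_injective.ne h)]
  · funext k
    simp [imag]

include hc

/-- The two sides differ by a sign because `s` is odd and real while `iλβ` and `iβ` are imaginary;
the moved coefficient itself is reproduced exactly. The `y`-terms are first rewritten by the
exchange of the two groups of variables. -/
lemma weight_mul_coeff {G : ℂ → ℂ → ℂ} {H : AddSubgroup ℂ} {κ κ' : ℂ} (hlam : lam ≠ 0)
    (hκ : κ ≠ 0) (hκ' : κ' ≠ 0) (hH : ContainsShifts H g lam β)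
    (hx : TamePoint c G H β κ (fun j => z (.inl j)) fun k => z (.inr k))
    (hy : TamePoint c G H (lam * β) κ' (fun k => z (.inr k)) fun j => z (.inl j))
    (t : (ℤˣ × Fin N) ⊕ (ℤˣ × Fin M) ⊕ Unit) :
    weight c G g lam β (z - imag ((opA c g lam β N M).shift t)) *
        (opA c g lam β N M).coeff t (z - imag ((opA c g lam β N M).shift t)) =
      -(conj ((opA c g lam β N M).coeff t (conjVec z)) * weight c G g lam β z) := by
  have hs (q : ℂ) (hq : conj q = -q) : conj (c.s q) = -c.s q := by
    rw [Model.s_conj hc, hq, Model.s_neg hc]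
  rcases t with ⟨ε, j⟩ | ⟨ε, k⟩ | u
  · simp only [opA]
    obtain ⟨e1, e2⟩ := sub_imag_single_inl z j (-(((ε : ℤ) : ℝ) * β))
    rw [weight_eq c G hc, weight_eq c G hc, e1, e2,
      show z (.inl j) - I * (-(((ε : ℤ) : ℝ) * β) : ℝ) = z (.inl j) + sg ε * (I * β) by
        simp [sg]; ring,
      map_mul, hs _ (by simp)]
    have h1 := pairWeight_mul_V hc hH hx hκ ε j
    have h2 := conj_V hc g lam β (fun i => z (.inl i)) (fun k => z (.inr k)) ε j
    have h3 : conj (V c g lam β ε j (fun i => conjVec z (.inl i)) fun k => conjVec z (.inr k)) =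
      V c g lam β (-ε) j (fun i => z (.inl i)) fun k => z (.inr k) := h2
    rw [h3]
    linear_combination c.s (I * lam * β) * h1
  · simp only [opA]
    obtain ⟨e1, e2⟩ := sub_imag_single_inr z k (((ε : ℤ) : ℝ) * lam * β)
    rw [weight_eq c G hc, weight_eq c G hc, pairWeight_swap c G hc g hlam,
      pairWeight_swap c G hc g hlam, e1, e2,
      show z (.inr k) - I * (((ε : ℤ) : ℝ) * lam * β : ℝ) =
        z (.inr k) + sg (-ε) * (I * (lam * β : ℝ)) by simp [sg]; ring,
      map_neg, map_mul, hs _ (by simp), Vt_eq_V hc g β _ _ hlam, Vt_eq_V hc g β _ _ hlam]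
    have h1 := pairWeight_mul_V hc (hH.dual hlam) hy hκ' (-ε) k
    have h2 := conj_V hc (dualCoupling g lam) (1 / lam) (lam * β) (fun i => z (.inr i))
      (fun k => z (.inl k)) (-ε) k
    have h3 : conj (V c (dualCoupling g lam) (1 / lam) (lam * β) (-ε) k
        (fun i => conjVec z (.inr i)) fun k => conjVec z (.inl k)) =
      V c (dualCoupling g lam) (1 / lam) (lam * β) (- -ε) k (fun i => z (.inr i))
        fun k => z (.inl k) := h2
    rw [h3]
    linear_combination -c.s (I * β) * h1
  · simp only [opA]
    have h1 : conj (V0 c g lam β (fun i => conjVec z (.inl i)) fun k => conjVec z (.inr k)) =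
      -V0 c g lam β (fun i => z (.inl i)) fun k => z (.inr k) := conj_V0 hc g lam β _ _
    have h2 : z - imag 0 = z := by funext i; simp [imag]
    rw [h1, h2]
    ring

theorem opA_isFormallyAntisymmetric (hlam : lam ≠ 0) (hβ : β ≠ 0) {G : ℂ → ℂ → ℂ}
    (hG : IsGammaFunction c.s G) :
    (opA c g lam β N M).IsFormallyAntisymmetric (weight c G g lam β) := by
  obtain ⟨H, hHc, hH⟩ := exists_countable_containsShifts g lam β
  obtain ⟨κ, hκ, B, hB, h1⟩ := exists_tame hc hG hHc hβ
  -- The `y`-variables need the equation of `G` with step `iλβ`, hence a second exceptional set; a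
  -- point must avoid both.
  obtain ⟨κ', hκ', B', hB', h2⟩ := exists_tame hc hG hHc (mul_ne_zero hlam hβ)
  have hx (z : Fin N ⊕ Fin M → ℂ) (hz : Avoids (B ∪ B') z) :
      TamePoint c G H β κ (fun j => z (.inl j)) fun k => z (.inr k) := by
    have hz := hz.mono Set.subset_union_left
    exact ⟨fun j => h1 _ (hz.single _), fun j => h1 _ (hz.double _),
      fun j i hij δ => h1 _ (hz.pair _ _ (Sum.inl_injective.ne hij) δ),
      fun j k δ => h1 _ (hz.pair _ _ Sum.inl_ne_inr δ)⟩
  have hy (z : Fin N ⊕ Fin M → ℂ) (hz : Avoids (B ∪ B') z) :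
      TamePoint c G H (lam * β : ℝ) κ' (fun k => z (.inr k)) fun j => z (.inl j) := by
    have hz := hz.mono Set.subset_union_right
    exact ⟨fun j => h2 _ (hz.single _), fun j => h2 _ (hz.double _),
      fun j i hij δ => h2 _ (hz.pair _ _ (Sum.inr_injective.ne hij) δ),
      fun j k δ => h2 _ (hz.pair _ _ Sum.inr_ne_inl δ)⟩
  refine DifferenceOperator.isFormallyAntisymmetric_of_forall_mem
    (S := {z | Avoids (B ∪ B') z}) (ae_avoids_conjVec (hB.union hB'))
    (ae_avoids_ofRealVec (hB.union hB')) (fun z hz => ?_) fun z hz t =>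
      weight_mul_coeff hc g lam β z hlam hκ hκ' hH (hx z hz) (hy z hz) t
  rw [weight_eq c G hc]
  exact pairWeight_ne_zero hH (hx z hz) hlam (hy z hz)

end

end DeformedVanDiejen

end

theorem mainTheorem9
    (c : DeformedVanDiejen.Model) (hc : c.Positive) (N M : ℕ)
    (g : Fin (2 * c.rho + 2) → ℝ) (lam β : ℝ) (hlam : lam ≠ 0) (hβ : 0 < β)
    (hres : DeformedVanDiejen.NonResonant c lam β)
    (hsing : Complex.I * (lam - 1) * β ∉ c.Omega) :
    ((c.IsElliptic → DeformedVanDiejen.Balanced c g lam N M) →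
      ∀ z : Fin N ⊕ Fin M → ℂ, DeformedVanDiejen.Regular c lam β z →
        (DeformedVanDiejen.opA c g lam β N M).apply (fun _ => 1) z =
          DeformedVanDiejen.eigenvalue c g lam β N M) ∧
    (∀ G : ℂ → ℂ → ℂ, DeformedVanDiejen.IsGammaFunction c.s G →
      (DeformedVanDiejen.opA c g lam β N M).IsFormallyAntisymmetric
        (DeformedVanDiejen.weight c G g lam β)) := by
  refine ⟨fun hbal z hz => DeformedVanDiejen.opA_apply_one hc g hz hsing hbal, fun G hG =>
    DeformedVanDiejen.opA_isFormallyAntisymmetric hc g lam β hlam hβ.ne' hG⟩
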